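/- Let $n\ge 0$ be an integer and work in $L^2(\mathbb R^n)$. Let $(V_kf)(y)=e^{i\langle k,y\rangle}f(y)$ and $(U_xf)(y)=f(x+y)$ for $k,x\in\mathbb R^n$, let $\theta(Q)$ denote multiplication by the function $\theta$, and let $\mathscr C(\mathbb R^n)$ be the $C^*$-algebra of bounded operators $T$ on $L^2(\mathbb R^n)$ such that $\lim_{k\to0}\|[T,V_k]\|=0$, $\lim_{x\to0}\|(U_x-1)T\|=0$ and $\lim_{x\to0}\|(U_x-1)T^*\|=0$. An observable $H$ is a not necessarily densely defined self-adjoint operator, identified with its functional calculus $\varphi\mapsto\varphi(H)$, which is a $*$-morphism from $C_0(\mathbb R)$ to the bounded operators; it is affiliated to $\mathscr C(\mathbb R^n)$ if $\varphi(H)\in\mathscr C(\mathbb R^n)$ for all $\varphi\in C_0(\mathbb R)$. Its spectrum $\sigma(H)$ is the set of $\lambda\in\mathbb R$ such that $\varphi(H)\ne0$ for all $\varphi\in C_0(\mathbb R)$ with $\varphi(\lambda)\neq0$, and its essential spectrum $\sigma_{\rm ess}(H)$ is the set of $\lambda\in\mathbb R$ such that $\varphi(H)$ is not a compact operator belonging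 to $\mathscr C(\mathbb R^n)$ for all $\varphi\in C_0(\mathbb R)$ with $\varphi(\lambda)\ne0$. Let $\mathcal H^1$ be the Sobolev space of order $1$, $\mathcal H^{-1}$ its adjoint space, and $\Delta\ge0$ the positive Laplacian. Let $W$ be a continuous symmetric sesquilinear form on $\mathcal H^1$ such that (1) $W\ge-\mu\Delta-\nu$ as forms on $\mathcal H^1$ for some real numbers $\mu<1$ and $\nu>0$; (2) $\lim_{k\to0}\|[V_k,W]\|_{\mathcal H^1\to\mathcal H^{-1}}=0$. Then the form sum $H_0=\Delta+W$ is a self-adjoint operator. Let $V\in L^1_{\rm loc}(\mathbb R^n)$ be real and suppose that its negative part $V_-$ is form bounded with respect to $H_0$ with relative bound $<1$, that is, there are $a\in[0,1)$ and $b\in\mathbb R$ with $\int V_-|u|^2\,dx\le a\langle u,H_0u\rangle+b\|u\|^2$ for all $u\in\mathcal H^1$, where $\langle u,H_0u\rangle$ is understood in the form sense. Then the form sum $H=H_0+V(Q)$, with form domain $\{u\in\mathcal H^1: V_+^{1/2}u\in L^2\}$, is a self-adjoint operator affiliated to $\mathscr C(\mathbb R^n)$. Consequently, for each ultrafilter $\varkappa$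 on $\mathbb R^n$ finer than the filter of sets with relatively compact complement, there is an observable $\varkappa.H$ affiliated to $\mathscr C(\mathbb R^n)$ such that, for all $\varphi\in C_0(\mathbb R)$ and all $\theta\in C_0(\mathbb R^n)$, $$\lim_{x\to\varkappa}\Big(\big\|\big(U_x\varphi(H)U_x^*-\varphi(\varkappa.H)\big)\theta(Q)\big\|+\big\|\theta(Q)\big(U_x\varphi(H)U_x^*-\varphi(\varkappa.H)\big)\big\|\Big)=0,$$ and $$\sigma_{\rm ess}(H)=\overline{\bigcup_{\varkappa}\sigma(\varkappa.H)} .$$ -/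

import Mathlib

open MeasureTheory Filter Topology
open scoped ENNReal NNReal ZeroAtInfty BoundedContinuousFunction FourierTransform
open scoped ComplexConjugate SchwartzMap

noncomputable section

namespace LocInfty

/-- The configuration space `ℝⁿ`; characters are identified with vectors `k` through
`x ↦ exp (i ⟨k, x⟩)`. -/
abbrev Space (n : ℕ) : Type := EuclideanSpace ℝ (Fin n)

/-- The Hilbert space `L²(ℝⁿ)`. -/
abbrev L2 (n : ℕ) : Type := Lp ℂ 2 (volume : Measure (Space n))

variable {n : ℕ}

/-! ### The operators `m(Q)`, `V_k`, `U_x` -/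

/-- The operator `m(Q)` of multiplication by a bounded continuous function `m`. -/
def mulOp (m : Space n →ᵇ ℂ) : L2 n →L[ℂ] L2 n :=
  (ContinuousLinearMap.lsmul ℂ ℂ).holderL (volume : Measure (Space n)) ∞ 2 2
    ((m.memLp_top (μ := (volume : Measure (Space n)))).toLp _)

/-- The character `x ↦ exp (i ⟨k, x⟩)`. -/
def character (k : Space n) : Space n →ᵇ ℂ :=
  BoundedContinuousFunction.ofNormedAddCommGroup
    (fun x => Complex.exp ((inner ℝ k x : ℝ) * Complex.I)) (by fun_prop) 1
    (fun x => by rw [Complex.norm_exp_ofReal_mul_I])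

/-- `V_k`: multiplication by the character `k`. -/
def V (k : Space n) : L2 n →L[ℂ] L2 n := mulOp (character k)

/-- `U_x`: translation, `(U_x f)(y) = f (x + y)`. -/
def U (x : Space n) : L2 n →L[ℂ] L2 n :=
  (Lp.compMeasurePreservingₗᵢ ℂ (fun y => x + y)
    (measurePreserving_add_left (volume : Measure (Space n)) x)).toContinuousLinearMap

theorem coeFn_mulOp (m : Space n →ᵇ ℂ) (u : L2 n) :
    ∀ᵐ x, (mulOp m u : L2 n) x = m x * u x := by
  have h := (ContinuousLinearMap.lsmul ℂ ℂ).coeFn_holder (r := 2)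
    ((m.memLp_top (μ := (volume : Measure (Space n)))).toLp _) u
  filter_upwards [h, (m.memLp_top (μ := (volume : Measure (Space n)))).coeFn_toLp] with x hx hm
  have : (mulOp m u : L2 n) x = _ := hx
  rw [this, hm]
  simp

theorem coeFn_V (k : Space n) (u : L2 n) :
    ∀ᵐ x, (V k u : L2 n) x = Complex.exp ((inner ℝ k x : ℝ) * Complex.I) * u x :=
  coeFn_mulOp _ _

theorem coeFn_U (x : Space n) (u : L2 n) : ∀ᵐ y, (U x u : L2 n) y = u (x + y) :=
  Lp.coeFn_compMeasurePreserving u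
    (measurePreserving_add_left (volume : Measure (Space n)) x)

/-! ### The algebra `𝒞(ℝⁿ)` and observables -/

/-- The algebra `𝒞(ℝⁿ)`: bounded operators `T` on `L²(ℝⁿ)` such that
`‖[T, V_k]‖ → 0` as `k → 0` and `‖(U_x - 1) T‖ → 0`, `‖(U_x - 1) T*‖ → 0` as `x → 0`. -/
def algC (n : ℕ) : Set (L2 n →L[ℂ] L2 n) :=
  {T | Tendsto (fun k : Space n => ‖T * V k - V k * T‖) (𝓝 0) (𝓝 0) ∧
    Tendsto (fun x : Space n => ‖(U x - 1) * T‖) (𝓝 0) (𝓝 0) ∧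
    Tendsto (fun x : Space n => ‖(U x - 1) * star T‖) (𝓝 0) (𝓝 0)}

/-- An observable on `L²(ℝⁿ)`, that is, a self-adjoint operator which is not necessarily densely
defined, given by its `C₀`-functional calculus: a `*`-morphism `φ ↦ φ(H)` from `C₀(ℝ)` to
the bounded operators. The zero morphism is the observable `∞` with domain `{0}`. -/
abbrev Observable (n : ℕ) : Type := C₀(ℝ, ℂ) →⋆ₙₐ[ℂ] (L2 n →L[ℂ] L2 n)

/-- `H` is affiliated to `𝒞(ℝⁿ)`: `φ(H) ∈ 𝒞(ℝⁿ)` for all `φ ∈ C₀(ℝ)`. -/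
def Observable.Affiliated (H : Observable n) : Prop := ∀ φ : C₀(ℝ, ℂ), H φ ∈ algC n

/-- The spectrum of an observable. -/
def Observable.spectrum (H : Observable n) : Set ℝ :=
  {t | ∀ φ : C₀(ℝ, ℂ), φ t ≠ 0 → H φ ≠ 0}

/-- The essential spectrum of an observable: `𝒦 = 𝒞(ℝⁿ) ∩ K(L²)` is the ideal of compact operators
in `𝒞(ℝⁿ)`, and `t` is in the essential spectrum if `φ(H) ∉ 𝒦` whenever `φ(t) ≠ 0`. -/
def Observable.essSpectrum (H : Observable n) : Set ℝ :=
  {t | ∀ φ : C₀(ℝ, ℂ), φ t ≠ 0 → ¬ (H φ ∈ algC n ∧ IsCompactOperator (H φ))}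

/-- The function `t ↦ (t - z)⁻¹` on `ℝ`, for non-real `z`. -/
def resolventFun (z : ℂ) (hz : z.im ≠ 0) : C₀(ℝ, ℂ) where
  toFun t := ((t : ℂ) - z)⁻¹
  continuous_toFun := by
    refine Continuous.inv₀ (by fun_prop) (fun t h => hz ?_)
    have := congrArg Complex.im h
    simpa using this
  zero_at_infty' := by
    refine tendsto_inv₀_cobounded.comp ?_
    rw [← tendsto_norm_atTop_iff_cobounded]
    refine tendsto_atTop_mono (f := fun t : ℝ => ‖t‖ - ‖z‖) (fun t => ?_) ?_
    · simpa using norm_sub_norm_le (t : ℂ) z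
    · exact tendsto_atTop_add_const_right _ _ (tendsto_norm_cocompact_atTop)

/-- `R = (A - z)⁻¹`: the bounded operator `R` is the two-sided inverse of `A - z`. -/
def IsResolventAt (A : L2 n →ₗ.[ℂ] L2 n) (z : ℂ) (R : L2 n →L[ℂ] L2 n) : Prop :=
  (∀ f : L2 n, ∃ u : A.domain, (u : L2 n) = R f ∧ A u - z • (u : L2 n) = f) ∧
    ∀ u : A.domain, R (A u - z • (u : L2 n)) = u

/-- The observable `Φ` is the self-adjoint operator `A`, that is, `Φ` is the functional calculus
`φ ↦ φ(A)`: the `*`-morphism on `C₀(ℝ)` with `(t - z)⁻¹ ↦ (A - z)⁻¹` for all non-real `z`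
(there is at most one, by the Stone-Weierstrass theorem). -/
def IsObservableOf (A : L2 n →ₗ.[ℂ] L2 n) (Φ : Observable n) : Prop :=
  ∀ (z : ℂ) (hz : z.im ≠ 0), IsResolventAt A z (Φ (resolventFun z hz))

/-! ### Localizations at infinity -/

/-- `δℝⁿ`: the ultrafilters finer than the Fréchet filter of sets with relatively compact
complement. -/
def UltraInfty (n : ℕ) : Type := {ϰ : Ultrafilter (Space n) // (ϰ : Filter (Space n)) ≤ cocompact _}

/-- `T x → S` in `𝒞ₛ(ℝⁿ)` along `l`, i.e. in the topology defined by the seminorms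
`‖T θ(Q)‖ + ‖θ(Q) T‖` with `θ ∈ C₀(ℝⁿ)`. -/
def TendstoCs (T : Space n → L2 n →L[ℂ] L2 n) (l : Filter (Space n))
    (S : L2 n →L[ℂ] L2 n) : Prop :=
  ∀ θ : C₀(Space n, ℂ),
    Tendsto (fun x => ‖(T x - S) * mulOp θ.toBCF‖ + ‖mulOp θ.toBCF * (T x - S)‖) l (𝓝 0)

/-- `H'` is the localization of `H` at `ϰ`: `U_x φ(H) U_x* → φ(H')` in `𝒞ₛ(ℝⁿ)` as `x → ϰ`,
for all `φ ∈ C₀(ℝ)`. -/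
def IsLocalizationAt (H : Observable n) (ϰ : UltraInfty n) (H' : Observable n) : Prop :=
  ∀ φ : C₀(ℝ, ℂ), TendstoCs (fun x => U x * H φ * star (U x)) ϰ.1 (H' φ)

/-! ### The Sobolev space `ℋ¹` and forms on it -/

/-- The Sobolev space `ℋ¹(ℝⁿ)`, as a subspace of `L²(ℝⁿ)`. -/
def H1 (n : ℕ) : Submodule ℂ (L2 n) where
  carrier := {u | TemperedDistribution.MemSobolev 1 2 (Lp.toTemperedDistribution u)}
  add_mem' {u v} hu hv := by
    have := TemperedDistribution.MemSobolev.add hu hv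
    simp only [Set.mem_ofPred_eq, ← Lp.toTemperedDistributionCLM_apply, map_add] at this ⊢
    exact this
  zero_mem' := by
    simp only [Set.mem_ofPred_eq, ← Lp.toTemperedDistributionCLM_apply, map_zero]
    exact TemperedDistribution.memSobolev_fun_zero _ _ _ _
  smul_mem' c u hu := by
    have := TemperedDistribution.MemSobolev.smul c hu
    simp only [Set.mem_ofPred_eq, ← Lp.toTemperedDistributionCLM_apply, map_smul] at this ⊢
    exact this

theorem toTD_injective : Function.Injective
    (Lp.toTemperedDistribution : L2 n → 𝓢'(Space n, ℂ)) := by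
  have h := LinearMap.ker_eq_bot.1 (Lp.ker_toTemperedDistributionCLM_eq_bot
    (F := ℂ) (μ := (volume : Measure (Space n))) (p := 2))
  exact h

theorem mem_H1_iff_weight (u : L2 n) : u ∈ H1 n ↔
    MemLp (fun ξ : Space n => (((1 + ‖ξ‖ ^ 2) ^ ((1 : ℝ) / 2) : ℝ) : ℂ) * (𝓕 u : L2 n) ξ) 2
      volume := by
  have hw : Function.HasTemperateGrowth
      (fun x : Space n => (((1 + ‖x‖ ^ 2) ^ ((1 : ℝ) / 2) : ℝ) : ℂ)) := by fun_prop
  have hw' : Function.HasTemperateGrowth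
      (fun x : Space n => (((1 + ‖x‖ ^ 2) ^ (-(1 : ℝ) / 2) : ℝ) : ℂ)) := by fun_prop
  have hmul : ∀ x : Space n, (((1 + ‖x‖ ^ 2) ^ ((1 : ℝ) / 2) : ℝ) : ℂ) *
      (((1 + ‖x‖ ^ 2) ^ (-(1 : ℝ) / 2) : ℝ) : ℂ) = 1 := by
    intro x
    rw [← Complex.ofReal_mul, ← Real.rpow_add (by positivity), neg_div, add_neg_cancel,
      Real.rpow_zero, Complex.ofReal_one]
  have hb : MemLp (fun x : Space n => (((1 + ‖x‖ ^ 2) ^ (-(1 : ℝ) / 2) : ℝ) : ℂ)) ∞ volume := by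
    refine memLp_top_of_bound hw'.1.continuous.aestronglyMeasurable 1 (ae_of_all _ fun x => ?_)
    rw [Complex.norm_real, Real.norm_eq_abs, abs_of_nonneg (by positivity)]
    exact Real.rpow_le_one_of_one_le_of_nonpos (by nlinarith [norm_nonneg x]) (by norm_num)
  have key : ∀ f' : L2 n, TemperedDistribution.smulLeftCLM ℂ
      (fun x : Space n => (((1 + ‖x‖ ^ 2) ^ ((1 : ℝ) / 2) : ℝ) : ℂ))
        (Lp.toTemperedDistribution (𝓕 u : L2 n)) = Lp.toTemperedDistribution f' ↔
      (hb.toLp _ • f' : L2 n) = 𝓕 u := by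
    intro f'
    rw [← toTD_injective.eq_iff, Lp.toTemperedDistribution_smul_eq hw' hb f']
    constructor
    · intro h
      rw [← h, TemperedDistribution.smulLeftCLM_smulLeftCLM_apply hw hw']
      rw [show ((fun x : Space n => (((1 + ‖x‖ ^ 2) ^ ((1 : ℝ) / 2) : ℝ) : ℂ)) *
        fun x : Space n => (((1 + ‖x‖ ^ 2) ^ (-(1 : ℝ) / 2) : ℝ) : ℂ)) = fun _ => 1 from
          funext fun x => hmul x, TemperedDistribution.smulLeftCLM_const, one_smul]
    · intro h
      rw [← h, TemperedDistribution.smulLeftCLM_smulLeftCLM_apply hw' hw]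
      rw [show ((fun x : Space n => (((1 + ‖x‖ ^ 2) ^ (-(1 : ℝ) / 2) : ℝ) : ℂ)) *
        fun x : Space n => (((1 + ‖x‖ ^ 2) ^ ((1 : ℝ) / 2) : ℝ) : ℂ)) = fun _ => 1 from
          funext fun x => (mul_comm _ _).trans (hmul x), TemperedDistribution.smulLeftCLM_const, one_smul]
  change TemperedDistribution.MemSobolev 1 2 (Lp.toTemperedDistribution u) ↔ _
  rw [TemperedDistribution.memSobolev_iff_exists_smulLeftCLM_fourier,
    Lp.fourier_toTemperedDistribution_eq]
  constructor
  · rintro ⟨f', hf'⟩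
    have h := (key f').1 hf'
    refine (memLp_congr_ae ?_).1 (Lp.memLp f')
    have h2 := Lp.coeFn_lpSMul (r := 2) (hb.toLp _) f'
    rw [h] at h2
    filter_upwards [h2, hb.coeFn_toLp] with x hx hx'
    rw [hx, Pi.smul_apply', hx', smul_eq_mul, ← mul_assoc, hmul, one_mul]
  · intro h
    refine ⟨h.toLp _, (key _).2 ?_⟩
    refine Lp.ext ?_
    filter_upwards [Lp.coeFn_lpSMul (r := 2) (hb.toLp _) (h.toLp _), hb.coeFn_toLp,
      h.coeFn_toLp] with x hx hx' hx''
    rw [hx, Pi.smul_apply', hx', hx'', smul_eq_mul, ← mul_assoc, mul_comm (Complex.ofReal _), hmul,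
      one_mul]

/-- Fourier characterization of `ℋ¹`. -/
theorem mem_H1_iff (u : L2 n) : u ∈ H1 n ↔
    MemLp (fun ξ : Space n => (‖ξ‖ : ℂ) * (𝓕 u : L2 n) ξ) 2 volume := by
  rw [mem_H1_iff_weight]
  have hm : AEStronglyMeasurable (fun ξ : Space n => (𝓕 u : L2 n) ξ) volume :=
    (Lp.memLp (𝓕 u : L2 n)).1
  constructor
  · intro h
    refine h.mono (Continuous.aestronglyMeasurable (by fun_prop) |>.mul hm)
      (ae_of_all _ fun ξ => ?_)
    rw [norm_mul, norm_mul]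
    gcongr
    rw [Complex.norm_real, Complex.norm_real, norm_norm, Real.norm_eq_abs,
      abs_of_nonneg (by positivity), ← Real.sqrt_eq_rpow]
    exact Real.le_sqrt_of_sq_le (by linarith)
  · intro h
    refine (h.norm.add (Lp.memLp (𝓕 u : L2 n)).norm).mono
      (Continuous.aestronglyMeasurable ?_ |>.mul hm) (ae_of_all _ fun ξ => ?_)
    · have hw : Function.HasTemperateGrowth
        (fun x : Space n => (((1 + ‖x‖ ^ 2) ^ ((1 : ℝ) / 2) : ℝ) : ℂ)) := by fun_prop
      exact hw.1.continuous
    · rw [Pi.add_apply, norm_mul, norm_mul, Complex.norm_real, Complex.norm_real, norm_norm,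
        Real.norm_eq_abs, Real.norm_eq_abs, abs_of_nonneg (by positivity),
        abs_of_nonneg (by positivity), ← Real.sqrt_eq_rpow, ← add_one_mul]
      gcongr
      exact Real.sqrt_le_iff.2 ⟨by positivity, by nlinarith [norm_nonneg ξ]⟩

/-- Modulation becomes translation under the Fourier transform. -/
theorem fourier_V (k : Space n) (u : L2 n) :
    (𝓕 (V k u) : L2 n) = U (-((2 * Real.pi)⁻¹ • k)) (𝓕 u : L2 n) := by
  have hc : Continuous fun u : L2 n => (𝓕 u : L2 n) := (Lp.fourierTransformₗᵢ _ _).continuous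
  refine DenseRange.induction_on (p := fun u : L2 n =>
    (𝓕 (V k u) : L2 n) = U (-((2 * Real.pi)⁻¹ • k)) (𝓕 u : L2 n))
    (SchwartzMap.denseRange_toLpCLM (E := Space n) (F := ℂ) (p := 2) (μ := volume)
      ENNReal.ofNat_ne_top) u ?_ ?_
  · exact isClosed_eq (hc.comp (V k).continuous) ((U _).continuous.comp hc)
  intro f
  set a : Space n := (2 * Real.pi)⁻¹ • k with ha
  set g : 𝓢(Space n, ℂ) := (𝓕 f).compSubConstCLM ℂ a with hg
  have h1 : V k (f.toLp 2 volume : L2 n) = ((𝓕⁻ g : 𝓢(Space n, ℂ)).toLp 2 volume : L2 n) := by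
    refine Lp.ext ?_
    filter_upwards [coeFn_V k (f.toLp 2 volume : L2 n), f.coeFn_toLp 2 volume,
      (𝓕⁻ g : 𝓢(Space n, ℂ)).coeFn_toLp 2 volume] with x h1 h2 h3
    rw [h1, h2, h3]
    have hf : f x = (𝓕⁻ (𝓕 f : 𝓢(Space n, ℂ)) : 𝓢(Space n, ℂ)) x := by simp
    rw [hf, SchwartzMap.fourierInv_coe, SchwartzMap.fourierInv_coe, Real.fourierInv_eq',
      Real.fourierInv_eq', ← integral_sub_right_eq_self _ a, ← smul_eq_mul, ← integral_smul]
    refine integral_congr_ae (ae_of_all _ fun v => ?_)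
    simp only [hg, SchwartzMap.compSubConstCLM_apply, smul_eq_mul, ← mul_assoc, ← Complex.exp_add]
    congr 2
    rw [← add_mul]
    congr 1
    norm_cast
    rw [ha, inner_sub_left, real_inner_smul_left]
    field_simp
    ring
  change (𝓕 (V k (f.toLp 2 volume : L2 n)) : L2 n) = U (-a) (𝓕 (f.toLp 2 volume : L2 n) : L2 n)
  rw [h1, SchwartzMap.toLp_fourier_eq, SchwartzMap.toLp_fourier_eq]
  refine Lp.ext ?_
  have h4 : (fun y => ((𝓕 f : 𝓢(Space n, ℂ)).toLp 2 volume : L2 n) (-a + y)) =ᵐ[volume]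
      fun y => (𝓕 f : 𝓢(Space n, ℂ)) (-a + y) :=
    (measurePreserving_add_left (volume : Measure (Space n)) (-a)).quasiMeasurePreserving.ae_eq_comp
      ((𝓕 f : 𝓢(Space n, ℂ)).coeFn_toLp 2 volume)
  filter_upwards [coeFn_U (-a) ((𝓕 f : 𝓢(Space n, ℂ)).toLp 2 volume : L2 n), h4,
      (𝓕 (𝓕⁻ g) : 𝓢(Space n, ℂ)).coeFn_toLp 2 volume] with x h1 h2 h3
  rw [h1, h2, h3]
  simp [hg, sub_eq_neg_add]

theorem V_mem_H1 (k : Space n) {u : L2 n} (hu : u ∈ H1 n) : V k u ∈ H1 n := by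
  rw [mem_H1_iff] at hu ⊢
  rw [fourier_V]
  set a : Space n := -((2 * Real.pi)⁻¹ • k)
  have hp := measurePreserving_add_left (volume : Measure (Space n)) a
  have h1 := hu.comp_measurePreserving hp
  have h2 := (Lp.memLp (𝓕 u : L2 n)).comp_measurePreserving hp
  have h3 := h1.norm.add (h2.norm.const_mul ‖a‖)
  refine h3.mono (Continuous.aestronglyMeasurable (by fun_prop) |>.mul (Lp.memLp _).1) ?_
  filter_upwards [coeFn_U a (𝓕 u : L2 n)] with x hx
  rw [hx]
  simp only [Pi.add_apply, Function.comp_apply, norm_mul, Complex.norm_real, norm_norm]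
  rw [Real.norm_eq_abs, abs_of_nonneg (by positivity), ← add_mul]
  gcongr
  have := norm_sub_le (a + x) a
  simpa using this

/-- The form of the positive Laplacian `Δ = |P|²` on `ℋ¹`, antilinear in the first argument:
`⟨u, Δ v⟩ = ∫ |2πξ|² conj (û(ξ)) v̂(ξ) dξ`, where `û(ξ) = ∫ exp (-2πi⟨x, ξ⟩) u(x) dx`. -/
def laplacianForm (u v : H1 n) : ℂ :=
  ∫ ξ : Space n, (((2 * Real.pi * ‖ξ‖) ^ 2 : ℝ) : ℂ) *
    (conj ((𝓕 (u : L2 n) : L2 n) ξ) * (𝓕 (v : L2 n) : L2 n) ξ)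

/-- The norm of `ℋ¹`: `‖u‖₁² = ‖u‖² + ⟨u, Δ u⟩`. -/
def sobolevNorm (u : H1 n) : ℝ := √(‖(u : L2 n)‖ ^ 2 + (laplacianForm u u).re)

/-- The norm `‖B‖_{ℋ¹ → ℋ⁻¹}` of a form `B` on `ℋ¹`, seen as the map `v ↦ B(·, v)` into the space
of antilinear forms: the least `C` with `|B(u, v)| ≤ C ‖u‖₁ ‖v‖₁` (and `∞` if `B` is not
continuous). -/
def formNorm (B : H1 n → H1 n → ℂ) : ℝ≥0∞ :=
  ⨅ (C : ℝ≥0) (_ : ∀ u v, ‖B u v‖ ≤ C * sobolevNorm u * sobolevNorm v), (C : ℝ≥0∞)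

/-- `V_k` as an operator on `ℋ¹`. -/
def VH1 (k : Space n) (u : H1 n) : H1 n := ⟨V k (u : L2 n), V_mem_H1 k u.2⟩

/-- The commutator `[V_k, W] = V_k W - W V_k : ℋ¹ → ℋ⁻¹` as a form on `ℋ¹`, where `V_k` acts on
`ℋ⁻¹` as the adjoint of `V_k* = V_{-k}`: `⟨u, [V_k, W] v⟩ = W(V_{-k} u, v) - W(u, V_k v)`. -/
def commutatorForm (k : Space n) (W : H1 n → H1 n → ℂ) (u v : H1 n) : ℂ :=
  W (VH1 (-k) u) v - W u (VH1 k v)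

/-! ### Form sums -/

/-- `A` is the operator associated to the form `q` (antilinear in the first argument) with domain
`D`: `u ∈ D(A)` and `A u = f` if and only if `u ∈ D` and `q(v, u) = ⟨v, f⟩` for all `v ∈ D`. -/
def IsFormOperator {D : Submodule ℂ (L2 n)} (q : D → D → ℂ) (A : L2 n →ₗ.[ℂ] L2 n) : Prop :=
  ∀ u f : L2 n, (u, f) ∈ A.graph ↔ ∃ hu : u ∈ D, ∀ v : D, q v ⟨u, hu⟩ = inner ℂ (v : L2 n) f

/-- The form sum `Δ + W` on `ℋ¹`. -/
def freeForm (W : H1 n → H1 n → ℂ) (u v : H1 n) : ℂ := laplacianForm u v + W u v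

/-- The form domain of `Δ + W + p(Q)`: all `u ∈ ℋ¹` with `p₊^{1/2} u ∈ L²`, where `p₊` is the
positive part of `p`. -/
def formDomain (p : Space n → ℝ) : Submodule ℂ (L2 n) where
  carrier := {u | u ∈ H1 n ∧ MemLp (fun x => (√(max (p x) 0) : ℂ) * u x) 2 volume}
  add_mem' {u v} hu hv := by
    refine ⟨add_mem hu.1 hv.1, (memLp_congr_ae ?_).1 (hu.2.add hv.2)⟩
    filter_upwards [Lp.coeFn_add u v] with x hx
    simp only [Pi.add_apply] at hx ⊢
    rw [hx, mul_add]
  zero_mem' := by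
    refine ⟨zero_mem _, (memLp_congr_ae ?_).1 (MemLp.zero (ε := ℂ))⟩
    filter_upwards [Lp.coeFn_zero ℂ 2 (volume : Measure (Space n))] with x hx
    rw [hx]
    simp
  smul_mem' c u hu := by
    refine ⟨Submodule.smul_mem _ c hu.1, (memLp_congr_ae ?_).1 (hu.2.const_mul c)⟩
    filter_upwards [Lp.coeFn_smul c u] with x hx
    rw [hx, Pi.smul_apply, smul_eq_mul]
    ring

/-- The form sum `Δ + W + p(Q)` on its form domain. -/
def fullForm (W : H1 n → H1 n → ℂ) (p : Space n → ℝ) (u v : formDomain p) : ℂ :=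
  freeForm W ⟨u.1, u.2.1⟩ ⟨v.1, v.2.1⟩ +
    ∫ x : Space n, (p x : ℂ) * (conj ((u : L2 n) x) * (v : L2 n) x)

/-- The negative part `p₋` of `p` is form bounded with respect to `Δ + W` with relative bound
`< 1`. -/
def NegPartRelBounded (W : H1 n → H1 n → ℂ) (p : Space n → ℝ) : Prop :=
  ∃ a b : ℝ, 0 ≤ a ∧ a < 1 ∧ ∀ u : H1 n,
    Integrable (fun x => max (-p x) 0 * ‖(u : L2 n) x‖ ^ 2) ∧
    ∫ x : Space n, max (-p x) 0 * ‖(u : L2 n) x‖ ^ 2 ≤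
      a * (freeForm W u u).re + b * ‖(u : L2 n)‖ ^ 2

end LocInfty

end

open LocInfty

noncomputable section

namespace LocInfty

variable {n : ℕ}

/-! ### Multiplication operators -/

/-! The proof has an algebraic half, valid for every observable affiliated to `𝒞(ℝⁿ)`, and an
analytic half which places the resolvent of the form sum in `𝒞(ℝⁿ)`.

Existence of localizations. The three norms defining `𝒞(ℝⁿ)` are unchanged when `T` is replaced by a
translate `T_x = U_x T U_x*`. Gaussians `g(sQ)` of position and `g(tP)` of momentum are averages of
the groups `V` and `U`. Hence, for small `s` and `t` and uniformly in `x`, `T_x` almost commutes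
with `g(sQ)` and is almost unchanged under multiplication by `g(tP)` on either side. As `g(sQ)
g(tP)` is compact, `T_x θ(Q)` is uniformly close to `K T_x K'` with `K`, `K'` compact and
independent of `x` (`exists_compact_sandwich`). Bounded families have weak limits along ultrafilters
(`exists_weakTendsto`), and the sandwich turns weak convergence of translates into convergence in
`𝒞ₛ(ℝⁿ)`, hence into strong convergence. So the limit is multiplicative in `T`, and `φ(H)` localizes
to a `*`-morphism `φ(ϰ.H)`.

Essential spectrum. The point is that `T ∈ 𝒞(ℝⁿ)` is compact exactly when all its localizations
vanish. Compact operators localize to zero because translations tend weakly to zero at infinity.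
Conversely, if all localizations vanish, then `‖T M_b‖ → 0` as `|b| → ∞`, where `M_b` is
multiplication by the Gaussian `exp(-π|sy - b|²)`. The vector `T M_b f` is the Fourier transform at
`b` of `k ↦ g(k) T V_{2πsk} f`, so Plancherel in `b`, together with the smallness of `[T, V_k]`,
controls `‖T f‖²` by `∫ ‖T M_b f‖² db`. Applied to `(1 - g(rQ)) f`, this shows that `T` is a norm
limit of the compact operators `T g(rQ)` (`isCompactOperator_of_weakTendsto_zero`).

Affiliation. After adding a large constant `c` the form is bounded and coercive on its natural
Hilbert space, and Lax-Milgram gives `R = (H + c)⁻¹`, bounded from `L²` to `ℋ¹`. This bound controls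
`(U_x - 1) R`. Multiplication by the potential commutes with `V_k`, so only `Δ` and `W` contribute
to `[R, V_k]`, and coercivity makes this commutator small (`resolvent_mem_algC`). Since `𝒞(ℝⁿ)` is a
closed `*`-algebra and `φ(H)` is a continuous function of `R` vanishing at `0`, every `φ(H)` lies in
it. -/

theorem mulOp_eq_of_ae {m : Space n →ᵇ ℂ} {u v : L2 n} (h : ∀ᵐ x, v x = m x * u x) :
    mulOp m u = v := by
  refine Lp.ext ?_
  filter_upwards [coeFn_mulOp m u, h] with x h1 h2
  rw [h1, h2]

theorem mulOp_mul (m m' : Space n →ᵇ ℂ) : mulOp (m * m') = mulOp m * mulOp m' := by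
  refine ContinuousLinearMap.ext fun u => mulOp_eq_of_ae ?_
  filter_upwards [coeFn_mulOp m (mulOp m' u), coeFn_mulOp m' u] with x h1 h2
  rw [mul_apply_eq_comp, h1, h2, BoundedContinuousFunction.mul_apply, mul_assoc]

theorem mulOp_sub (m m' : Space n →ᵇ ℂ) : mulOp (m - m') = mulOp m - mulOp m' := by
  refine ContinuousLinearMap.ext fun u => mulOp_eq_of_ae ?_
  rw [sub_apply]
  filter_upwards [coeFn_mulOp m u, coeFn_mulOp m' u, Lp.coeFn_sub (mulOp m u) (mulOp m' u)]
    with x h1 h2 h3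
  rw [h3, Pi.sub_apply, h1, h2, BoundedContinuousFunction.sub_apply, sub_mul]

theorem mulOp_one : mulOp (1 : Space n →ᵇ ℂ) = 1 := by
  refine ContinuousLinearMap.ext fun u => mulOp_eq_of_ae ?_
  simp

theorem norm_mulOp_le (m : Space n →ᵇ ℂ) : ‖mulOp m‖ ≤ ‖m‖ := by
  refine ContinuousLinearMap.opNorm_le_bound _ (norm_nonneg _) fun u => ?_
  refine Lp.norm_le_mul_norm_of_ae_le_mul ?_
  filter_upwards [coeFn_mulOp m u] with x hx
  rw [hx, norm_mul]
  gcongr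
  exact m.norm_coe_le_norm x

theorem inner_eq_integral (u v : L2 n) : inner ℂ u v = ∫ x, conj (u x) * v x := by
  rw [L2.inner_def]
  refine integral_congr_ae (ae_of_all _ fun x => ?_)
  simp [RCLike.inner_apply, mul_comm]

theorem integrable_conj_mul (u v : L2 n) : Integrable (fun x => conj (u x) * v x) := by
  refine (L2.integrable_inner (𝕜 := ℂ) u v).congr (ae_of_all _ fun x => ?_)
  simp [RCLike.inner_apply, mul_comm]

theorem star_mulOp (m : Space n →ᵇ ℂ) : star (mulOp m) = mulOp (star m) := by
  refine ((ContinuousLinearMap.eq_adjoint_iff _ _).2 fun u v => ?_).symm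
  rw [inner_eq_integral, inner_eq_integral]
  refine integral_congr_ae ?_
  filter_upwards [coeFn_mulOp m v, coeFn_mulOp (star m) u] with x h1 h2
  rw [h1, h2, map_mul, BoundedContinuousFunction.star_apply, RCLike.star_def, Complex.conj_conj]
  ring

/-! ### The groups `V` and `U` -/

theorem V_eq_of_ae {k : Space n} {u v : L2 n}
    (h : ∀ᵐ x, v x = Complex.exp ((inner ℝ k x : ℝ) * Complex.I) * u x) : V k u = v :=
  mulOp_eq_of_ae h

theorem character_apply (k x : Space n) :
    character k x = Complex.exp ((inner ℝ k x : ℝ) * Complex.I) := rfl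

theorem character_add (k k' : Space n) : character (k + k') = character k * character k' := by
  ext x
  rw [BoundedContinuousFunction.mul_apply, character_apply, character_apply, character_apply,
    ← Complex.exp_add, inner_add_left]
  push_cast
  ring_nf

theorem star_character (k : Space n) : star (character k) = character (-k) := by
  ext x
  rw [BoundedContinuousFunction.star_apply, character_apply, character_apply, RCLike.star_def,
    ← Complex.exp_conj, inner_neg_left]
  simp

theorem character_zero : character (0 : Space n) = 1 := by
  ext x
  simp [character_apply]

theorem V_add (k k' : Space n) : V (k + k') = V k * V k' := by
  rw [V, character_add, mulOp_mul]; rfl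

theorem V_zero : V (0 : Space n) = 1 := by rw [V, character_zero, mulOp_one]

theorem star_V (k : Space n) : star (V k) = V (-k) := by
  rw [V, star_mulOp, star_character]; rfl

theorem V_mul_V_neg (k : Space n) : V k * V (-k) = 1 := by
  rw [← V_add, add_neg_cancel, V_zero]

theorem V_neg_mul_V (k : Space n) : V (-k) * V k = 1 := by
  rw [← V_add, neg_add_cancel, V_zero]

theorem norm_V_apply (k : Space n) (u : L2 n) : ‖V k u‖ = ‖u‖ := by
  rw [Lp.norm_def, Lp.norm_def]
  congr 1
  refine eLpNorm_congr_norm_ae ?_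
  filter_upwards [coeFn_V k u] with x hx
  rw [hx, norm_mul, Complex.norm_exp_ofReal_mul_I, one_mul]

theorem U_eq_of_ae {x : Space n} {u v : L2 n} (h : ∀ᵐ y, v y = u (x + y)) : U x u = v := by
  refine Lp.ext ?_
  filter_upwards [coeFn_U x u, h] with y h1 h2
  rw [h1, h2]

theorem ae_comp_add {P : Space n → Prop} (h : ∀ᵐ y, P y) (x : Space n) : ∀ᵐ y, P (x + y) :=
  (measurePreserving_add_left (volume : Measure (Space n)) x).quasiMeasurePreserving.ae h

theorem U_add (x y : Space n) : U (x + y) = U x * U y := by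
  refine ContinuousLinearMap.ext fun u => U_eq_of_ae ?_
  rw [mul_apply_eq_comp]
  filter_upwards [coeFn_U x (U y u), ae_comp_add (coeFn_U y u) x] with z h1 h2
  rw [h1, h2]
  congr 1
  abel

theorem U_zero : U (0 : Space n) = 1 := by
  refine ContinuousLinearMap.ext fun u => U_eq_of_ae ?_
  simp

theorem norm_U_apply (x : Space n) (u : L2 n) : ‖U x u‖ = ‖u‖ :=
  (Lp.compMeasurePreservingₗᵢ ℂ (fun y => x + y)
    (measurePreserving_add_left (volume : Measure (Space n)) x)).norm_map u

theorem U_mul_U_neg (x : Space n) : U x * U (-x) = 1 := by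
  rw [← U_add, add_neg_cancel, U_zero]

theorem U_neg_mul_U (x : Space n) : U (-x) * U x = 1 := by
  rw [← U_add, neg_add_cancel, U_zero]

theorem inner_U_U (x : Space n) (u v : L2 n) : inner ℂ (U x u) (U x v) = inner ℂ u v :=
  (Lp.compMeasurePreservingₗᵢ ℂ (fun y => x + y)
    (measurePreserving_add_left (volume : Measure (Space n)) x)).inner_map_map u v

theorem star_U (x : Space n) : star (U x) = U (-x) := by
  refine ((ContinuousLinearMap.eq_adjoint_iff _ _).2 fun u v => ?_).symm
  rw [← inner_U_U x, ← mul_apply_eq_comp, U_mul_U_neg, one_apply_eq_self]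

theorem U_mem_unitary (x : Space n) : U x ∈ unitary (L2 n →L[ℂ] L2 n) := by
  rw [Unitary.mem_iff, star_U]
  exact ⟨U_neg_mul_U x, U_mul_U_neg x⟩

theorem V_mem_unitary (k : Space n) : V k ∈ unitary (L2 n →L[ℂ] L2 n) := by
  rw [Unitary.mem_iff, star_V]
  exact ⟨V_neg_mul_V k, V_mul_V_neg k⟩

theorem norm_U_mul (x : Space n) (T : L2 n →L[ℂ] L2 n) : ‖U x * T‖ = ‖T‖ :=
  CStarRing.norm_mem_unitary_mul T (U_mem_unitary x)

theorem norm_mul_U (x : Space n) (T : L2 n →L[ℂ] L2 n) : ‖T * U x‖ = ‖T‖ :=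
  CStarRing.norm_mul_mem_unitary T (U_mem_unitary x)

theorem norm_V_mul (k : Space n) (T : L2 n →L[ℂ] L2 n) : ‖V k * T‖ = ‖T‖ :=
  CStarRing.norm_mem_unitary_mul T (V_mem_unitary k)

theorem norm_mul_V (k : Space n) (T : L2 n →L[ℂ] L2 n) : ‖T * V k‖ = ‖T‖ :=
  CStarRing.norm_mul_mem_unitary T (V_mem_unitary k)

theorem U_mul_mulOp (x : Space n) {m m' : Space n →ᵇ ℂ} (h : ∀ y, m' y = m (x + y)) :
    U x * mulOp m = mulOp m' * U x := by
  refine ContinuousLinearMap.ext fun u => ?_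
  rw [mul_apply_eq_comp, mul_apply_eq_comp]
  refine (mulOp_eq_of_ae ?_).symm
  filter_upwards [coeFn_U x (mulOp m u), coeFn_U x u, ae_comp_add (coeFn_mulOp m u) x]
    with y h1 h2 h3
  rw [h1, h3, h2, h]

theorem U_mul_V (x k : Space n) :
    U x * V k = Complex.exp ((inner ℝ k x : ℝ) * Complex.I) • (V k * U x) := by
  have h : U x * V k
      = mulOp (Complex.exp ((inner ℝ k x : ℝ) * Complex.I) • character k) * U x :=
    U_mul_mulOp x fun y => by
      rw [BoundedContinuousFunction.smul_apply, character_apply, character_apply, smul_eq_mul,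
        ← Complex.exp_add, inner_add_right]
      push_cast
      ring_nf
  rw [h, ← smul_mul_assoc]
  congr 1
  refine ContinuousLinearMap.ext fun u => mulOp_eq_of_ae ?_
  filter_upwards [Lp.coeFn_smul (Complex.exp ((inner ℝ k x : ℝ) * Complex.I)) (V k u),
    coeFn_V k u] with y h1 h2
  rw [smul_apply, h1, Pi.smul_apply, h2, BoundedContinuousFunction.smul_apply,
    smul_eq_mul, smul_eq_mul, character_apply, mul_assoc]

theorem continuous_U_apply (u : L2 n) : Continuous fun x : Space n => U x u := by
  have hg : Continuous fun x : Space n => (⟨fun y => x + y, by fun_prop⟩ : C(Space n, Space n)) :=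
    (ContinuousMap.curry ⟨fun p : Space n × Space n => p.1 + p.2, by fun_prop⟩).continuous
  exact Continuous.compMeasurePreservingLp (f := fun _ : Space n => u) continuous_const hg
    (fun x => measurePreserving_add_left (volume : Measure (Space n)) x) ENNReal.ofNat_ne_top

theorem V_apply_eq_fourierInv (k : Space n) (u : L2 n) :
    V k u = (𝓕⁻ (U (-((2 * Real.pi)⁻¹ • k)) (𝓕 u : L2 n)) : L2 n) := by
  rw [← fourier_V]
  simp

theorem continuous_V_apply (u : L2 n) : Continuous fun k : Space n => V k u := by
  simp_rw [V_apply_eq_fourierInv]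
  have h1 := (continuous_U_apply (𝓕 u : L2 n)).comp
    (show Continuous fun k : Space n => -((2 * Real.pi)⁻¹ • k) by fun_prop)
  exact (Lp.fourierTransformₗᵢ (Space n) ℂ).symm.continuous.comp h1

/-- Translation becomes modulation under the Fourier transform. -/
theorem fourier_U (x : Space n) (u : L2 n) :
    (𝓕 (U x u) : L2 n) = V ((2 * Real.pi) • x) (𝓕 u : L2 n) := by
  have hc : Continuous fun u : L2 n => (𝓕 u : L2 n) := (Lp.fourierTransformₗᵢ _ _).continuous
  refine DenseRange.induction_on (p := fun u : L2 n =>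
    (𝓕 (U x u) : L2 n) = V ((2 * Real.pi) • x) (𝓕 u : L2 n))
    (SchwartzMap.denseRange_toLpCLM (E := Space n) (F := ℂ) (p := 2) (μ := volume)
      ENNReal.ofNat_ne_top) u ?_ ?_
  · exact isClosed_eq (hc.comp (U x).continuous) ((V _).continuous.comp hc)
  intro f
  change (𝓕 (U x (f.toLp 2 volume : L2 n)) : L2 n) = V _ (𝓕 (f.toLp 2 volume : L2 n) : L2 n)
  set g : 𝓢(Space n, ℂ) := f.compSubConstCLM ℂ (-x) with hg
  have h1 : U x (f.toLp 2 volume : L2 n) = (g.toLp 2 volume : L2 n) := by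
    refine U_eq_of_ae ?_
    filter_upwards [g.coeFn_toLp 2 volume, ae_comp_add (f.coeFn_toLp 2 volume) x] with y h1 h2
    rw [h1, h2, hg, SchwartzMap.compSubConstCLM_apply, sub_neg_eq_add, add_comm]
  rw [h1, SchwartzMap.toLp_fourier_eq, SchwartzMap.toLp_fourier_eq]
  symm
  refine V_eq_of_ae ?_
  filter_upwards [(𝓕 g).coeFn_toLp 2 volume, (𝓕 f).coeFn_toLp 2 volume] with ξ h1 h2
  rw [h1, h2, SchwartzMap.fourier_coe, SchwartzMap.fourier_coe]
  have h3 : (g : Space n → ℂ) = (f : Space n → ℂ) ∘ fun v => v + x := by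
    ext y
    simp [hg, SchwartzMap.compSubConstCLM_apply]
  rw [h3]
  have h4 := congrFun (VectorFourier.fourierIntegral_comp_add_right Real.fourierChar
    (volume : Measure (Space n)) (innerₗ (Space n)) f x) ξ
  rw [Real.fourier_eq, Real.fourier_eq]
  refine h4.trans ?_
  rw [Circle.smul_def, Real.fourierChar_apply, smul_eq_mul, real_inner_smul_left]
  congr 2

/-! ### Fourier integrals and Gaussians -/

/-- On `L¹ ∩ L²` the Fourier transform of `L²` is given by the Fourier integral. -/
theorem fourier_toLp_ae {E : Type*} [NormedAddCommGroup E] [InnerProductSpace ℂ E]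
    [CompleteSpace E] {F : Space n → E} (h1 : Integrable F) (h2 : MemLp F 2 volume) :
    ∀ᵐ ξ, (𝓕 (h2.toLp F) : Lp E 2 (volume : Measure (Space n))) ξ = 𝓕 F ξ := by
  have hc : Continuous (𝓕 F) :=
    VectorFourier.fourierIntegral_continuous Real.continuous_fourierChar
      (L := innerₗ (Space n)) continuous_inner h1
  -- The two functions are compared by testing against smooth compactly supported functions: on the
  -- `L²` side the transform moves to the test function through tempered distributions, on the `L¹`
  -- side through Fubini.
  refine ae_eq_of_integral_contDiff_smul_eq
    ((Lp.memLp _).locallyIntegrable (by norm_num)) hc.locallyIntegrable fun g hg hgs => ?_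
  have hgs' : HasCompactSupport fun x => (g x : ℂ) :=
    hgs.comp_left (g := fun r : ℝ => (r : ℂ)) Complex.ofReal_zero
  set φ : 𝓢(Space n, ℂ) :=
    hgs'.toSchwartzMap (Complex.ofRealCLM.contDiff.comp hg) with hφ
  have hφg : ∀ x, φ x = g x := fun x => rfl
  have e1 : ∫ x, g x • (𝓕 (h2.toLp F) : Lp E 2 (volume : Measure (Space n))) x
      = Lp.toTemperedDistribution (𝓕 (h2.toLp F) : Lp E 2 (volume : Measure (Space n))) φ := by
    rw [Lp.toTemperedDistribution_apply]
    simp_rw [hφg, Complex.coe_smul]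
  rw [e1, ← Lp.fourier_toTemperedDistribution_eq, TemperedDistribution.fourier_apply,
    Lp.toTemperedDistribution_apply]
  have e2 : ∫ x, (𝓕 φ) x • (h2.toLp F : Space n → E) x = ∫ x, (𝓕 (φ : Space n → ℂ)) x • F x := by
    refine integral_congr_ae ?_
    filter_upwards [h2.coeFn_toLp] with x hx
    rw [hx, SchwartzMap.fourier_coe]
  rw [e2]
  have := VectorFourier.integral_fourierIntegral_smul_eq_flip (L := innerₗ (Space n))
    Real.continuous_fourierChar continuous_inner (φ.integrable (μ := volume)) h1
  rw [flip_innerₗ] at this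
  refine this.trans (integral_congr_ae (ae_of_all _ fun x => ?_))
  simp only [hφg, Complex.coe_smul]
  rfl

/-- Plancherel for `L¹ ∩ L²`. -/
theorem integral_norm_sq_fourier {E : Type*} [NormedAddCommGroup E] [InnerProductSpace ℂ E]
    [CompleteSpace E] {F : Space n → E} (h1 : Integrable F) (h2 : MemLp F 2 volume) :
    MemLp (𝓕 F) 2 volume ∧ ∫ ξ, ‖𝓕 F ξ‖ ^ 2 = ∫ x, ‖F x‖ ^ 2 := by
  have h := fourier_toLp_ae h1 h2
  refine ⟨(memLp_congr_ae h).1 (Lp.memLp _), ?_⟩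
  have key : ∀ f : Lp E 2 (volume : Measure (Space n)), ∫ x, ‖f x‖ ^ 2 = ‖f‖ ^ 2 := by
    intro f
    have := L2.inner_def (𝕜 := ℂ) f f
    rw [inner_self_eq_norm_sq_to_K] at this
    have h3 : ((‖f‖ ^ 2 : ℝ) : ℂ) = ((∫ x, ‖f x‖ ^ 2 : ℝ) : ℂ) := by
      rw [← integral_complex_ofReal]
      push_cast
      refine this.trans (integral_congr_ae (ae_of_all _ fun x => ?_))
      simp [inner_self_eq_norm_sq_to_K]
    exact_mod_cast h3.symm
  have e1 : ∫ ξ, ‖𝓕 F ξ‖ ^ 2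
      = ∫ ξ, ‖(𝓕 (h2.toLp F) : Lp E 2 (volume : Measure (Space n))) ξ‖ ^ 2 :=
    integral_congr_ae (h.mono fun x hx => by simp only [hx])
  have e2 : ∫ ξ, ‖F ξ‖ ^ 2 = ∫ ξ, ‖(h2.toLp F : Space n → E) ξ‖ ^ 2 :=
    integral_congr_ae (h2.coeFn_toLp.mono fun x hx => by simp only [hx])
  rw [e1, e2, key, key, Lp.norm_fourier_eq]

/-- The Gaussian `exp (-π ‖z‖²)`. -/
def gauss (z : Space n) : ℝ := Real.exp (-Real.pi * ‖z‖ ^ 2)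

theorem continuous_gauss : Continuous (gauss : Space n → ℝ) := by
  unfold gauss; fun_prop

theorem gauss_pos (z : Space n) : 0 < gauss z := Real.exp_pos _

theorem gauss_le_one (z : Space n) : gauss z ≤ 1 := by
  rw [gauss, Real.exp_le_one_iff]
  nlinarith [Real.pi_pos, sq_nonneg ‖z‖, mul_nonneg Real.pi_pos.le (sq_nonneg ‖z‖)]

theorem gauss_neg (z : Space n) : gauss (-z) = gauss z := by simp [gauss]

theorem fourier_gauss (z : Space n) : 𝓕 (fun v : Space n => (gauss v : ℂ)) z = gauss z := by
  have h := fourier_gaussian_innerProductSpace (V := Space n) (b := Real.pi)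
    (by simpa using Real.pi_pos) z
  have hpi : (Real.pi : ℂ) ≠ 0 := by exact_mod_cast Real.pi_ne_zero
  rw [div_self hpi, Complex.one_cpow, one_mul] at h
  have e : (fun v : Space n => (gauss v : ℂ))
      = fun v : Space n => Complex.exp (-(Real.pi : ℂ) * ‖v‖ ^ 2) := by
    ext v; simp [gauss]
  rw [e, h, gauss]
  push_cast
  congr 1
  field_simp

theorem integrable_rexp_neg_mul_norm_sq {b : ℝ} (hb : 0 < b) :
    Integrable (fun v : Space n => Real.exp (-b * ‖v‖ ^ 2)) := by
  have h := GaussianFourier.integrable_cexp_neg_mul_sq_norm_add (V := Space n)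
    (b := (b : ℂ)) (by simpa using hb) 0 0
  refine h.re.congr (ae_of_all _ fun v => ?_)
  have e : (-(b : ℂ) * (‖v‖ : ℂ) ^ 2 + 0 * ((inner ℝ (0 : Space n) v : ℝ) : ℂ))
    = ((-b * ‖v‖ ^ 2 : ℝ) : ℂ) := by push_cast; ring
  change (Complex.exp _).re = _
  rw [e, ← Complex.ofReal_exp, Complex.ofReal_re]

theorem integrable_gauss : Integrable (gauss : Space n → ℝ) :=
  integrable_rexp_neg_mul_norm_sq Real.pi_pos

theorem integral_gauss : ∫ v : Space n, gauss v = 1 := by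
  have h := GaussianFourier.integral_rexp_neg_mul_sq_norm (V := Space n) Real.pi_pos
  rw [div_self Real.pi_ne_zero, Real.one_rpow] at h
  exact h

theorem integrable_gauss_mul_norm_sq : Integrable (fun v : Space n => gauss v * ‖v‖ ^ 2) := by
  -- Half of the Gaussian absorbs the factor `‖v‖²`; the other half remains integrable.
  have hb : ∀ v : Space n, ‖v‖ ^ 2 * Real.exp (-Real.pi / 2 * ‖v‖ ^ 2) ≤ 1 := by
    intro v
    have h1 : ‖v‖ ^ 2 ≤ Real.exp (Real.pi / 2 * ‖v‖ ^ 2) := by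
      have := Real.add_one_le_exp (Real.pi / 2 * ‖v‖ ^ 2)
      nlinarith [Real.pi_gt_three, sq_nonneg ‖v‖]
    rw [show -Real.pi / 2 * ‖v‖ ^ 2 = -(Real.pi / 2 * ‖v‖ ^ 2) by ring, Real.exp_neg,
      ← div_eq_mul_inv]
    exact div_le_one_of_le₀ h1 (Real.exp_pos _).le
  have hi := integrable_rexp_neg_mul_norm_sq (n := n) (b := Real.pi / 2) (by positivity)
  refine hi.mono' ((continuous_gauss.mul (by fun_prop)).aestronglyMeasurable)
    (ae_of_all _ fun v => ?_)
  rw [Real.norm_of_nonneg (mul_nonneg (gauss_pos v).le (by positivity)), gauss]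
  have e : Real.exp (-Real.pi * ‖v‖ ^ 2)
    = Real.exp (-(Real.pi / 2) * ‖v‖ ^ 2) * Real.exp (-Real.pi / 2 * ‖v‖ ^ 2) := by
    rw [← Real.exp_add]; ring_nf
  rw [e, mul_assoc, mul_comm (Real.exp (-Real.pi / 2 * ‖v‖ ^ 2))]
  exact mul_le_of_le_one_right (Real.exp_pos _).le (hb v)

theorem gauss_sq_le (v : Space n) : gauss v ^ 2 ≤ gauss v := by
  nlinarith [gauss_pos v, gauss_le_one v]

theorem integrable_gauss_sq : Integrable (fun v : Space n => gauss v ^ 2) :=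
  integrable_gauss.mono' (continuous_gauss.pow 2).aestronglyMeasurable
    (ae_of_all _ fun v => by rw [Real.norm_of_nonneg (by positivity)]; exact gauss_sq_le v)

theorem memLp_gauss : MemLp (fun v : Space n => (gauss v : ℂ)) 2 volume := by
  refine (memLp_two_iff_integrable_sq_norm
    (Complex.continuous_ofReal.comp continuous_gauss).aestronglyMeasurable).2 ?_
  refine integrable_gauss_sq.congr (ae_of_all _ fun v => ?_)
  simp

theorem integral_gauss_sq_pos : 0 < ∫ v : Space n, gauss v ^ 2 := by
  refine (integral_pos_iff_support_of_nonneg (fun v => by positivity) integrable_gauss_sq).2 ?_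
  have : Function.support (fun v : Space n => gauss v ^ 2) = Set.univ := by
    ext v; simp [(gauss_pos v).ne']
  rw [this]
  exact Measure.measure_univ_pos.2 (NeZero.ne _)

/-- The bounded function `y ↦ exp (-π ‖s y - b‖²)`. -/
def gaussMul (s : ℝ) (b : Space n) : Space n →ᵇ ℂ :=
  BoundedContinuousFunction.ofNormedAddCommGroup (fun y => (gauss (s • y - b) : ℂ))
    (Complex.continuous_ofReal.comp (continuous_gauss.comp (by fun_prop))) 1
    (fun y => by
      rw [Complex.norm_real, Real.norm_of_nonneg (gauss_pos _).le]; exact gauss_le_one _)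

theorem gaussMul_apply (s : ℝ) (b y : Space n) : gaussMul s b y = gauss (s • y - b) := rfl

theorem star_gaussMul (s : ℝ) (b : Space n) : star (gaussMul s b) = gaussMul s b := by
  ext y
  rw [BoundedContinuousFunction.star_apply, gaussMul_apply, RCLike.star_def, Complex.conj_ofReal]

theorem norm_gaussMul_le (s : ℝ) (b : Space n) : ‖gaussMul s b‖ ≤ 1 :=
  BoundedContinuousFunction.norm_ofNormedAddCommGroup_le _ zero_le_one _

theorem fourierChar_smul_eq (k b : Space n) {E : Type*} [NormedAddCommGroup E] [NormedSpace ℂ E]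
    (e : E) : Real.fourierChar (-(inner ℝ k b)) • e
      = Complex.exp ((-(2 * Real.pi * inner ℝ k b) : ℝ) * Complex.I) • e := by
  rw [Circle.smul_def, Real.fourierChar_apply]
  congr 2
  push_cast
  ring

theorem norm_gauss_smul_V (s : ℝ) (T : L2 n →L[ℂ] L2 n) (f : L2 n) (k : Space n) :
    ‖(gauss k : ℂ) • T (V ((2 * Real.pi * s) • k) f)‖ ≤ gauss k * (‖T‖ * ‖f‖) := by
  rw [norm_smul, Complex.norm_real, Real.norm_of_nonneg (gauss_pos _).le]
  gcongr
  · exact (gauss_pos _).le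
  · refine (T.le_opNorm _).trans (le_of_eq ?_)
    rw [norm_V_apply]

theorem continuous_gauss_smul_V (s : ℝ) (T : L2 n →L[ℂ] L2 n) (f : L2 n) :
    Continuous fun k : Space n => (gauss k : ℂ) • T (V ((2 * Real.pi * s) • k) f) := by
  refine (Complex.continuous_ofReal.comp continuous_gauss).smul (T.continuous.comp ?_)
  exact (continuous_V_apply f).comp (by fun_prop)

theorem integrable_gauss_smul_V (s : ℝ) (T : L2 n →L[ℂ] L2 n) (f : L2 n) :
    Integrable fun k : Space n => (gauss k : ℂ) • T (V ((2 * Real.pi * s) • k) f) :=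
  (integrable_gauss.mul_const (‖T‖ * ‖f‖)).mono'
    (continuous_gauss_smul_V s T f).aestronglyMeasurable (ae_of_all _ (norm_gauss_smul_V s T f))

theorem memLp_gauss_smul_V (s : ℝ) (T : L2 n →L[ℂ] L2 n) (f : L2 n) :
    MemLp (fun k : Space n => (gauss k : ℂ) • T (V ((2 * Real.pi * s) • k) f)) 2 volume := by
  refine (memLp_gauss.norm.mul_const (‖T‖ * ‖f‖)).mono'
    (continuous_gauss_smul_V s T f).aestronglyMeasurable (ae_of_all _ fun k => ?_)
  refine (norm_gauss_smul_V s T f k).trans (le_of_eq ?_)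
  rw [Complex.norm_real, Real.norm_of_nonneg (gauss_pos _).le]

/-- Gaussian multiplication operators are Gaussian averages of the unitaries `V`. -/
theorem fourier_gauss_smul_V (s : ℝ) (b : Space n) (T : L2 n →L[ℂ] L2 n) (f : L2 n) :
    𝓕 (fun k : Space n => (gauss k : ℂ) • T (V ((2 * Real.pi * s) • k) f)) b
      = T (mulOp (gaussMul s b) f) := by
  have hint (S : L2 n →L[ℂ] L2 n) : Integrable fun k : Space n =>
      Real.fourierChar (-(inner ℝ k b)) • (gauss k : ℂ) • S (V ((2 * Real.pi * s) • k) f) :=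
    (Real.fourierIntegral_convergent_iff b).2 (integrable_gauss_smul_V s S f)
  have h1 : 𝓕 (fun k : Space n => (gauss k : ℂ) • T (V ((2 * Real.pi * s) • k) f)) b
      = T (∫ k : Space n, Real.fourierChar (-(inner ℝ k b)) • (gauss k : ℂ) •
        (1 : L2 n →L[ℂ] L2 n) (V ((2 * Real.pi * s) • k) f)) := by
    rw [← ContinuousLinearMap.integral_comp_comm T (hint 1), Real.fourier_eq]
    refine integral_congr_ae (ae_of_all _ fun k => ?_)
    simp only [Circle.smul_def, map_smul, one_apply_eq_self]
  rw [h1]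
  congr 1
  -- Matrix elements reduce the vector-valued integral to a scalar double integral, where Fubini
  -- lets the `k`-integral be done first. It is the Fourier transform of a Gaussian, which
  -- reproduces the Gaussian at `s • y - b`.
  refine ext_inner_left ℂ fun h => ?_
  rw [← integral_inner (hint 1), inner_eq_integral]
  set a : Space n → ℂ := fun y => conj (h y) * f y with ha
  have hai : Integrable a := integrable_conj_mul h f
  set K : Space n → Space n → ℂ := fun k y =>
    (Complex.exp ((2 * Real.pi * (inner ℝ k (s • y - b)) : ℝ) * Complex.I)) *
      ((gauss k : ℂ) * a y) with hK
  have hKi : Integrable (Function.uncurry K) (volume.prod volume) := by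
    refine (Integrable.mul_prod (f := fun k : Space n => (gauss k : ℂ)) (g := a)
      integrable_gauss.ofReal hai).bdd_mul (c := 1) ?_ (ae_of_all _ fun p => ?_)
    · exact Continuous.aestronglyMeasurable (by fun_prop)
    · rw [Complex.norm_exp_ofReal_mul_I]
  have h2 (k : Space n) : inner ℂ h (Real.fourierChar (-(inner ℝ k b)) • (gauss k : ℂ) •
      (1 : L2 n →L[ℂ] L2 n) (V ((2 * Real.pi * s) • k) f)) = ∫ y, K k y := by
    rw [one_apply_eq_self, fourierChar_smul_eq, inner_smul_right, inner_smul_right,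
      inner_eq_integral, ← integral_const_mul, ← integral_const_mul]
    refine integral_congr_ae ?_
    filter_upwards [coeFn_V ((2 * Real.pi * s) • k) f] with y hy
    rw [hy, hK, ha]
    simp only
    have e : Complex.exp ((2 * Real.pi * (inner ℝ k (s • y - b)) : ℝ) * Complex.I)
        = Complex.exp ((-(2 * Real.pi * inner ℝ k b) : ℝ) * Complex.I) *
          Complex.exp ((inner ℝ ((2 * Real.pi * s) • k) y : ℝ) * Complex.I) := by
      rw [← Complex.exp_add, inner_sub_right, real_inner_smul_left, real_inner_smul_right]
      push_cast
      ring_nf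
    rw [e]
    ring
  simp_rw [h2]
  rw [integral_integral_swap hKi]
  refine integral_congr_ae ?_
  filter_upwards [coeFn_mulOp (gaussMul s b) f] with y hy
  rw [hy, gaussMul_apply, hK, ha]
  simp only
  have h3 : ∫ k : Space n, Complex.exp ((2 * Real.pi * (inner ℝ k (s • y - b)) : ℝ) * Complex.I) *
      (gauss k : ℂ) = gauss (s • y - b) := by
    rw [← gauss_neg, ← fourier_gauss, Real.fourier_eq]
    refine integral_congr_ae (ae_of_all _ fun k => ?_)
    change _ = Real.fourierChar (-(inner ℝ k (-(s • y - b)))) • (gauss k : ℂ)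
    rw [fourierChar_smul_eq, inner_neg_right, smul_eq_mul, mul_neg, neg_neg]
  simp_rw [← mul_assoc]
  rw [integral_mul_const, integral_mul_const, h3]
  ring

/-! ### Compact operators from square integrable kernels -/

/-- The operator `f ↦ (x ↦ g x f)` attached to a square integrable function with values in a dual
space. -/
def kerOp {E : Type*} [NormedAddCommGroup E] [NormedSpace ℂ E]
    (g : Lp (E →L[ℂ] ℂ) 2 (volume : Measure (Space n))) : E →L[ℂ] L2 n :=
  LinearMap.mkContinuous
    { toFun := fun f => (ContinuousLinearMap.apply ℂ ℂ f).compLp g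
      map_add' := fun f f' => by
        rw [map_add, ContinuousLinearMap.add_compLp]
      map_smul' := fun c f => by
        rw [map_smul, ContinuousLinearMap.smul_compLp]; rfl } ‖g‖ fun f => by
    refine ((ContinuousLinearMap.apply ℂ ℂ f).norm_compLp_le g).trans ?_
    rw [mul_comm]
    gcongr
    refine ContinuousLinearMap.opNorm_le_bound _ (norm_nonneg _) fun g => ?_
    rw [ContinuousLinearMap.apply_apply, mul_comm]
    exact g.le_opNorm f

theorem coeFn_kerOp {E : Type*} [NormedAddCommGroup E] [NormedSpace ℂ E]
    (g : Lp (E →L[ℂ] ℂ) 2 (volume : Measure (Space n))) (f : E) :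
    ∀ᵐ x, (kerOp g f : L2 n) x = g x f :=
  (ContinuousLinearMap.apply ℂ ℂ f).coeFn_compLp g

theorem norm_kerOp_le {E : Type*} [NormedAddCommGroup E] [NormedSpace ℂ E]
    (g : Lp (E →L[ℂ] ℂ) 2 (volume : Measure (Space n))) : ‖kerOp g‖ ≤ ‖g‖ :=
  LinearMap.mkContinuous_norm_le _ (norm_nonneg _) _

theorem kerOp_add {E : Type*} [NormedAddCommGroup E] [NormedSpace ℂ E]
    (g h : Lp (E →L[ℂ] ℂ) 2 (volume : Measure (Space n))) :
    kerOp (g + h) = kerOp g + kerOp h := by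
  refine ContinuousLinearMap.ext fun f => Lp.ext ?_
  rw [add_apply]
  filter_upwards [coeFn_kerOp (g + h) f, coeFn_kerOp g f, coeFn_kerOp h f,
    Lp.coeFn_add (kerOp g f) (kerOp h f), Lp.coeFn_add g h] with x h1 h2 h3 h4 h5
  rw [h1, h4, h5, Pi.add_apply, Pi.add_apply, h2, h3, add_apply]

theorem continuous_kerOp {E : Type*} [NormedAddCommGroup E] [NormedSpace ℂ E] :
    Continuous (kerOp : Lp (E →L[ℂ] ℂ) 2 (volume : Measure (Space n)) → E →L[ℂ] L2 n) :=
  (AddMonoidHomClass.continuous_of_bound (AddMonoidHom.mk' kerOp kerOp_add) 1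
    fun g => (norm_kerOp_le g).trans_eq (one_mul _).symm)

theorem isClosed_setOf_isCompactOperator :
    IsClosed {A : L2 n →L[ℂ] L2 n | IsCompactOperator A} :=
  isClosed_setOfPred_isCompactOperator

/-- Simple functions are dense in `L²` with values in the dual, and an indicator with a constant
functional gives a rank-one operator. The adjoint is carried along so that products of the Gaussians
in position and momentum are available in both orders. -/
theorem isCompactOperator_kerOp (g : Lp (L2 n →L[ℂ] ℂ) 2 (volume : Measure (Space n))) :
    IsCompactOperator (kerOp g) ∧ IsCompactOperator (star (kerOp g) : L2 n →L[ℂ] L2 n) := by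
  refine Lp.induction ENNReal.ofNat_ne_top (motive := fun g =>
    IsCompactOperator (kerOp g) ∧ IsCompactOperator (star (kerOp g) : L2 n →L[ℂ] L2 n))
    (fun c s hs hμs => ?_) (fun f g hf hg _ h1 h2 => ?_) ?_ g
  · set w : L2 n := indicatorConstLp 2 hs hμs.ne 1 with hw
    have h : kerOp (Lp.simpleFunc.indicatorConst 2 hs hμs.ne c : Lp (L2 n →L[ℂ] ℂ) 2 volume)
        = (ContinuousLinearMap.toSpanSingleton ℂ w).comp c := by
      refine ContinuousLinearMap.ext fun f => Lp.ext ?_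
      rw [Lp.simpleFunc.coe_indicatorConst]
      filter_upwards [coeFn_kerOp (indicatorConstLp 2 hs hμs.ne c) f,
        indicatorConstLp_coeFn (p := 2) (hs := hs) (hμs := hμs.ne) (c := c),
        indicatorConstLp_coeFn (p := 2) (hs := hs) (hμs := hμs.ne) (c := (1 : ℂ)),
        Lp.coeFn_smul (c f) w] with x h1 h2 h3 h4
      rw [h1, h2, ContinuousLinearMap.comp_apply, ContinuousLinearMap.toSpanSingleton_apply, h4,
        Pi.smul_apply, hw, h3]
      by_cases hx : x ∈ s <;> simp [hx]
    rw [h]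
    refine ⟨(isCompactOperator_of_locallyCompactSpace_rng
      (ContinuousLinearMap.toSpanSingleton ℂ w)).comp_clm c, ?_⟩
    rw [ContinuousLinearMap.star_eq_adjoint, ContinuousLinearMap.adjoint_comp]
    exact (isCompactOperator_of_locallyCompactSpace_dom (ContinuousLinearMap.adjoint
      (ContinuousLinearMap.toSpanSingleton ℂ w))).clm_comp (ContinuousLinearMap.adjoint c)
  · rw [kerOp_add, star_add]
    exact ⟨h1.1.add h2.1, h1.2.add h2.2⟩
  · refine IsClosed.inter ?_ ?_
    · exact isClosed_setOf_isCompactOperator.preimage continuous_kerOp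
    · exact isClosed_setOf_isCompactOperator.preimage (continuous_star.comp continuous_kerOp)

/-! ### Gaussian functions of position and momentum -/

/-- The Fourier transform as a bounded operator on `L²`. -/
def ft (n : ℕ) : L2 n →L[ℂ] L2 n :=
  (Lp.fourierTransformₗᵢ (Space n) ℂ).toContinuousLinearEquiv

theorem ft_apply (u : L2 n) : ft n u = 𝓕 u := rfl

theorem star_ft_mul_ft : star (ft n) * ft n = 1 := by
  refine ContinuousLinearMap.ext fun u => ext_inner_left ℂ fun v => ?_
  rw [mul_apply_eq_comp, ContinuousLinearMap.star_eq_adjoint,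
    ContinuousLinearMap.adjoint_inner_right, ft_apply, ft_apply, Lp.inner_fourier_eq]
  rfl

theorem U_eq (x : Space n) : U x = star (ft n) * V ((2 * Real.pi) • x) * ft n := by
  have h : ft n * U x = V ((2 * Real.pi) • x) * ft n :=
    ContinuousLinearMap.ext fun u => fourier_U x u
  rw [mul_assoc, ← h, ← mul_assoc, star_ft_mul_ft, one_mul]

/-- Multiplication by `exp (-π ‖s y‖²)`. -/
def gaussOp (n : ℕ) (s : ℝ) : L2 n →L[ℂ] L2 n := mulOp (gaussMul s 0)

theorem star_gaussOp (s : ℝ) : star (gaussOp n s) = gaussOp n s := by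
  rw [gaussOp, star_mulOp, star_gaussMul]

theorem norm_gaussOp_le (s : ℝ) : ‖gaussOp n s‖ ≤ 1 :=
  (norm_mulOp_le _).trans (norm_gaussMul_le _ _)

theorem gaussOp_apply_eq_integral (s : ℝ) (T : L2 n →L[ℂ] L2 n) (f : L2 n) :
    T (gaussOp n s f) = ∫ k : Space n, (gauss k : ℂ) • T (V ((2 * Real.pi * s) • k) f) := by
  rw [gaussOp, ← fourier_gauss_smul_V, Real.fourier_eq]
  refine integral_congr_ae (ae_of_all _ fun k => ?_)
  simp only [inner_zero_right, neg_zero, AddChar.map_zero_eq_one, one_smul]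

/-- The Gaussian convolution operator. -/
def psiOp (n : ℕ) (t : ℝ) : L2 n →L[ℂ] L2 n := star (ft n) * gaussOp n t * ft n

theorem star_psiOp (t : ℝ) : star (psiOp n t) = psiOp n t := by
  rw [psiOp, star_mul, star_mul, star_star, star_gaussOp, mul_assoc]

theorem star_ft_V_ft (t : ℝ) (k : Space n) (f : L2 n) :
    star (ft n) (V ((2 * Real.pi * t) • k) (ft n f)) = U (t • k) f := by
  rw [U_eq, smul_smul]; rfl

theorem psiOp_apply_eq_integral (t : ℝ) (T : L2 n →L[ℂ] L2 n) (f : L2 n) :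
    T (psiOp n t f) = ∫ k : Space n, (gauss k : ℂ) • T (U (t • k) f) := by
  have h := gaussOp_apply_eq_integral t (T * star (ft n)) (ft n f)
  refine Eq.trans (Eq.trans rfl h) (integral_congr_ae (ae_of_all _ fun k => ?_))
  simp only [mul_apply_eq_comp, star_ft_V_ft]

theorem integrable_gauss_smul_U (t : ℝ) (T : L2 n →L[ℂ] L2 n) (f : L2 n) :
    Integrable fun k : Space n => (gauss k : ℂ) • T (U (t • k) f) := by
  refine (integrable_gauss_smul_V t (T * star (ft n)) (ft n f)).congr (ae_of_all _ fun k => ?_)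
  simp only [mul_apply_eq_comp, star_ft_V_ft]

theorem norm_psiOp_le (t : ℝ) : ‖psiOp n t‖ ≤ 1 := by
  have h : ‖ft n‖ ≤ 1 := ContinuousLinearMap.opNorm_le_bound _ zero_le_one fun u => by
    rw [ft_apply, Lp.norm_fourier_eq, one_mul]
  have h' : ‖star (ft n)‖ ≤ 1 := (norm_star _).trans_le h
  calc ‖psiOp n t‖ ≤ ‖star (ft n)‖ * ‖gaussOp n t‖ * ‖ft n‖ :=
        (norm_mul_le _ _).trans (by gcongr; exact norm_mul_le _ _)
    _ ≤ 1 * 1 * 1 := by gcongr; exact norm_gaussOp_le t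
    _ = 1 := by norm_num

theorem memLp_gauss_smul {s : ℝ} (hs : s ≠ 0) :
    MemLp (fun y : Space n => (gauss (s • y) : ℂ)) 2 volume := by
  refine (memLp_two_iff_integrable_sq_norm (Complex.continuous_ofReal.comp
    (continuous_gauss.comp (by fun_prop))).aestronglyMeasurable).2 ?_
  refine ((integrable_gauss_sq (n := n)).comp_smul hs).congr (ae_of_all _ fun v => ?_)
  simp

/-- The kernel `exp(-π|tξ|²) exp(-2πi⟨ξ,y⟩) exp(-π|sy|²)` is square integrable: as a function of `ξ`
with values in the dual of `L²` it is a Gaussian times a functional of constant norm. -/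
theorem isCompactOperator_gaussOp_ft_gaussOp {s t : ℝ} (hs : s ≠ 0) (ht : t ≠ 0) :
    IsCompactOperator (gaussOp n t * ft n * gaussOp n s) ∧
      IsCompactOperator (star (gaussOp n t * ft n * gaussOp n s) : L2 n →L[ℂ] L2 n) := by
  set w : L2 n := (memLp_gauss_smul hs).toLp _ with hw
  set G : Space n → (L2 n →L[ℂ] ℂ) := fun ξ =>
    (gauss (t • ξ) : ℂ) • innerSL ℂ (V ((2 * Real.pi) • ξ) w) with hG
  have hGc : Continuous G := by
    refine (Complex.continuous_ofReal.comp (continuous_gauss.comp (by fun_prop))).smul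
      ((innerSL ℂ).continuous.comp ((continuous_V_apply w).comp (by fun_prop)))
  have hG2 : MemLp G 2 volume := by
    refine ((memLp_gauss_smul ht).norm.mul_const ‖w‖).mono' hGc.aestronglyMeasurable
      (ae_of_all _ fun ξ => ?_)
    rw [hG]
    simp only [norm_smul, innerSL_apply_norm, norm_V_apply]
    exact le_rfl
  have h : gaussOp n t * ft n * gaussOp n s = kerOp (hG2.toLp G) := by
    refine ContinuousLinearMap.ext fun f => Lp.ext ?_
    have hfi : Integrable (fun y : Space n => (gauss (s • y) : ℂ) * f y) :=
      (memLp_gauss_smul hs).integrable_mul (Lp.memLp f)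
    have hf2 : MemLp (fun y : Space n => (gauss (s • y) : ℂ) * f y) 2 volume := by
      refine (memLp_congr_ae ?_).1 (Lp.memLp (gaussOp n s f))
      filter_upwards [coeFn_mulOp (gaussMul s 0) f] with y hy
      rw [gaussOp, hy, gaussMul_apply, sub_zero]
    have e : gaussOp n s f = hf2.toLp _ := by
      refine mulOp_eq_of_ae ?_
      filter_upwards [hf2.coeFn_toLp] with y hy
      rw [hy, gaussMul_apply, sub_zero]
    rw [mul_apply_eq_comp, mul_apply_eq_comp, e, ft_apply]
    filter_upwards [coeFn_kerOp (hG2.toLp G) f, hG2.coeFn_toLp,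
      coeFn_mulOp (gaussMul t 0) (𝓕 (hf2.toLp _) : L2 n), fourier_toLp_ae hfi hf2]
      with ξ h1 h2 h3 h4
    rw [h1, h2, gaussOp, h3, h4, hG, gaussMul_apply, sub_zero, smul_apply, smul_eq_mul]
    congr 1
    rw [innerSL_apply_apply, inner_eq_integral, Real.fourier_eq]
    refine integral_congr_ae ?_
    filter_upwards [coeFn_V ((2 * Real.pi) • ξ) w, (memLp_gauss_smul hs).coeFn_toLp] with y h5 h6
    have e1 : conj (Complex.exp ((inner ℝ ((2 * Real.pi) • ξ) y : ℝ) * Complex.I))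
        = Complex.exp ((-(2 * Real.pi * inner ℝ y ξ) : ℝ) * Complex.I) := by
      rw [← Complex.exp_conj, map_mul, Complex.conj_I, Complex.conj_ofReal, real_inner_smul_left,
        real_inner_comm]
      push_cast
      ring_nf
    rw [h5, hw, h6, fourierChar_smul_eq, map_mul, e1, Complex.conj_ofReal, smul_eq_mul]
    ring
  rw [h]
  exact isCompactOperator_kerOp _

theorem isCompactOperator_psiOp_mul_gaussOp {s t : ℝ} (hs : s ≠ 0) (ht : t ≠ 0) :
    IsCompactOperator (psiOp n t * gaussOp n s) := by
  have h := (isCompactOperator_gaussOp_ft_gaussOp (n := n) hs ht).1.clm_comp (star (ft n))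
  have e : psiOp n t * gaussOp n s = star (ft n) * (gaussOp n t * ft n * gaussOp n s) := by
    rw [psiOp]; simp only [mul_assoc]
  rw [e]
  exact h

theorem isCompactOperator_gaussOp_mul_psiOp {s t : ℝ} (hs : s ≠ 0) (ht : t ≠ 0) :
    IsCompactOperator (gaussOp n s * psiOp n t) := by
  have h := (isCompactOperator_gaussOp_ft_gaussOp (n := n) hs ht).2.comp_clm (ft n)
  have e : gaussOp n s * psiOp n t = star (gaussOp n t * ft n * gaussOp n s) * ft n := by
    rw [psiOp, star_mul, star_mul, star_gaussOp, star_gaussOp]; simp only [mul_assoc]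
  rw [e]
  exact h

/-! ### Weak operator limits along ultrafilters and compact operators -/

section WeakLimits

variable {H : Type*} [NormedAddCommGroup H] [InnerProductSpace ℂ H] {α : Type*}

/-- Convergence in the weak operator topology. -/
def WeakTendsto (F : α → H →L[ℂ] H) (l : Filter α) (S : H →L[ℂ] H) : Prop :=
  ∀ u v : H, Tendsto (fun x => inner ℂ u (F x v)) l (𝓝 (inner ℂ u (S v)))

theorem WeakTendsto.unique {F : α → H →L[ℂ] H} {l : Filter α} [NeBot l] {S S' : H →L[ℂ] H}
    (h : WeakTendsto F l S) (h' : WeakTendsto F l S') : S = S' :=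
  ContinuousLinearMap.ext fun v => ext_inner_left ℂ fun u => tendsto_nhds_unique (h u v) (h' u v)

theorem WeakTendsto.add {F G : α → H →L[ℂ] H} {l : Filter α} {S R : H →L[ℂ] H}
    (h : WeakTendsto F l S) (h' : WeakTendsto G l R) :
    WeakTendsto (fun x => F x + G x) l (S + R) := fun u v => by
  simpa only [add_apply, inner_add_right] using (h u v).add (h' u v)

theorem WeakTendsto.sub {F G : α → H →L[ℂ] H} {l : Filter α} {S R : H →L[ℂ] H}
    (h : WeakTendsto F l S) (h' : WeakTendsto G l R) :
    WeakTendsto (fun x => F x - G x) l (S - R) := fun u v => by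
  simpa only [sub_apply, inner_sub_right] using (h u v).sub (h' u v)

theorem WeakTendsto.smul {F : α → H →L[ℂ] H} {l : Filter α} {S : H →L[ℂ] H}
    (h : WeakTendsto F l S) (c : ℂ) : WeakTendsto (fun x => c • F x) l (c • S) := fun u v => by
  simpa only [smul_apply, inner_smul_right] using (h u v).const_mul c

theorem weakTendsto_const (S : H →L[ℂ] H) (l : Filter α) : WeakTendsto (fun _ => S) l S :=
  fun _ _ => tendsto_const_nhds

/-- Lower semicontinuity of the norm. It transfers estimates that are uniform over translates to the
localizations. -/
theorem WeakTendsto.norm_le {F : α → H →L[ℂ] H} {l : Filter α} [NeBot l] {S : H →L[ℂ] H}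
    (h : WeakTendsto F l S) {C : ℝ} (hC : ∀ x, ‖F x‖ ≤ C) : ‖S‖ ≤ C := by
  obtain ⟨x⟩ := l.nonempty_of_neBot
  have hC0 : 0 ≤ C := (norm_nonneg _).trans (hC x)
  refine S.opNorm_le_bound hC0 fun v => ?_
  have h1 : ‖inner ℂ (S v) (S v)‖ ≤ ‖S v‖ * (C * ‖v‖) := by
    refine le_of_tendsto (h (S v) v).norm (Eventually.of_forall fun x => ?_)
    refine (norm_inner_le_norm _ _).trans ?_
    gcongr
    exact (F x).le_of_opNorm_le (hC x) v
  rw [inner_self_eq_norm_sq_to_K] at h1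
  rcases (norm_nonneg (S v)).eq_or_lt with h2 | h2
  · rw [← h2]; positivity
  · have h3 : ‖S v‖ * ‖S v‖ ≤ ‖S v‖ * (C * ‖v‖) := by
      refine le_trans (le_of_eq ?_) h1
      simp [sq]
    exact le_of_mul_le_mul_left h3 h2

variable [CompleteSpace H]

theorem WeakTendsto.mul_mul {F : α → H →L[ℂ] H} {l : Filter α} {S : H →L[ℂ] H}
    (h : WeakTendsto F l S) (A B : H →L[ℂ] H) :
    WeakTendsto (fun x => A * F x * B) l (A * S * B) := fun u v => by
  simpa only [mul_apply_eq_comp, ContinuousLinearMap.adjoint_inner_left] using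
    h (ContinuousLinearMap.adjoint A u) (B v)

theorem WeakTendsto.const_mul {F : α → H →L[ℂ] H} {l : Filter α} {S : H →L[ℂ] H}
    (h : WeakTendsto F l S) (A : H →L[ℂ] H) : WeakTendsto (fun x => A * F x) l (A * S) := by
  simpa only [mul_one] using h.mul_mul A 1

theorem WeakTendsto.mul_const {F : α → H →L[ℂ] H} {l : Filter α} {S : H →L[ℂ] H}
    (h : WeakTendsto F l S) (B : H →L[ℂ] H) : WeakTendsto (fun x => F x * B) l (S * B) := by
  simpa only [one_mul] using h.mul_mul 1 B

theorem WeakTendsto.star {F : α → H →L[ℂ] H} {l : Filter α} {S : H →L[ℂ] H}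
    (h : WeakTendsto F l S) : WeakTendsto (fun x => star (F x)) l (star S) := fun u v => by
  have := (Complex.continuous_conj.tendsto _).comp (h v u)
  simpa only [Function.comp_def, inner_conj_symm, ContinuousLinearMap.star_eq_adjoint,
    ContinuousLinearMap.adjoint_inner_right] using this

/-- Bounded families of operators converge weakly along ultrafilters. -/
theorem exists_weakTendsto (l : Ultrafilter α) {F : α → H →L[ℂ] H} {C : ℝ}
    (hC : ∀ x, ‖F x‖ ≤ C) : ∃ S, WeakTendsto F l S := by
  obtain ⟨x⟩ := (l : Filter α).nonempty_of_neBot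
  have hC0 : 0 ≤ C := (norm_nonneg _).trans (hC x)
  have hb (u v : H) (x : α) : ‖inner ℂ u (F x v)‖ ≤ C * ‖u‖ * ‖v‖ := by
    refine (norm_inner_le_norm _ _).trans ?_
    rw [mul_comm C, mul_assoc]
    gcongr
    exact (F x).le_of_opNorm_le (hC x) v
  have hex (u v : H) : ∃ b : ℂ, ‖b‖ ≤ C * ‖u‖ * ‖v‖ ∧
      Tendsto (fun x => inner ℂ u (F x v)) l (𝓝 b) := by
    -- Each matrix element stays in a fixed closed disc, which is compact, so an ultrafilter forces
    -- convergence.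
    obtain ⟨b, hb1, hb2⟩ := (isCompact_closedBall (0 : ℂ) (C * ‖u‖ * ‖v‖)).ultrafilter_le_nhds'
      (l.map fun x => inner ℂ u (F x v))
      (Ultrafilter.mem_map.2 (Filter.univ_mem' fun x => mem_closedBall_zero_iff.2 (hb u v x)))
    exact ⟨b, mem_closedBall_zero_iff.1 hb1, hb2⟩
  choose b hb1 hb2 using hex
  -- The limits of the matrix elements form a bounded sesquilinear form, which the Riesz theorem
  -- represents by an operator.
  let B : H →ₗ⋆[ℂ] H →ₗ[ℂ] ℂ := LinearMap.mk₂'ₛₗ (starRingEnd ℂ) (RingHom.id ℂ) b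
    (fun u u' v => tendsto_nhds_unique (hb2 _ _) (by
      simpa only [inner_add_left] using (hb2 u v).add (hb2 u' v)))
    (fun c u v => tendsto_nhds_unique (hb2 _ _) (by
      simpa only [inner_smul_left, smul_eq_mul] using (hb2 u v).const_mul (conj c)))
    (fun u v v' => tendsto_nhds_unique (hb2 _ _) (by
      simpa only [map_add, inner_add_right] using (hb2 u v).add (hb2 u v')))
    (fun c u v => tendsto_nhds_unique (hb2 _ _) (by
      simpa only [map_smul, inner_smul_right, smul_eq_mul, RingHom.id_apply] using
        (hb2 u v).const_mul c))
  let B' : H →L⋆[ℂ] H →L[ℂ] ℂ := B.mkContinuous₂ C hb1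
  refine ⟨ContinuousLinearMap.adjoint (InnerProductSpace.continuousLinearMapOfBilin B'),
    fun u v => ?_⟩
  rw [ContinuousLinearMap.adjoint_inner_right,
    InnerProductSpace.continuousLinearMapOfBilin_apply]
  exact hb2 u v

/-- A compact operator maps bounded weakly null families to norm null families. -/
theorem tendsto_zero_of_isCompactOperator {K : H →L[ℂ] H} (hK : IsCompactOperator K)
    {l : Ultrafilter α} {w : α → H} {C : ℝ} (hC : ∀ x, ‖w x‖ ≤ C)
    (hw : ∀ u, Tendsto (fun x => inner ℂ u (w x)) l (𝓝 0)) :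
    Tendsto (fun x => K (w x)) l (𝓝 0) := by
  obtain ⟨Z, hZ, hZ'⟩ := hK.image_closedBall_subset_compact (f := (K : H →ₗ[ℂ] H)) C
  obtain ⟨z, -, hz⟩ := hZ.ultrafilter_le_nhds' (l.map fun x => K (w x))
    (Ultrafilter.mem_map.2 (Filter.univ_mem' fun x =>
      hZ' ⟨w x, mem_closedBall_zero_iff.2 (hC x), rfl⟩))
  have hz' : Tendsto (fun x => K (w x)) l (𝓝 z) := hz
  have h0 : z = 0 := by
    refine ext_inner_left ℂ fun u => ?_
    have h1 : Tendsto (fun x => inner ℂ u (K (w x))) l (𝓝 (inner ℂ u z)) :=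
      tendsto_const_nhds.inner hz'
    refine tendsto_nhds_unique h1 ?_
    simpa only [ContinuousLinearMap.adjoint_inner_left, inner_zero_right] using
      hw (ContinuousLinearMap.adjoint K u)
  rwa [h0] at hz'

/-- Sandwiching between compact operators turns weak into norm convergence. -/
theorem tendsto_norm_compact_mul_mul_compact {K K' : H →L[ℂ] H} (hK : IsCompactOperator K)
    (hK' : IsCompactOperator K') {l : Ultrafilter α} {D : α → H →L[ℂ] H} {C : ℝ}
    (hC : ∀ x, ‖D x‖ ≤ C) (hD : WeakTendsto D l 0) :
    Tendsto (fun x => ‖K * D x * K'‖) l (𝓝 0) := by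
  obtain ⟨x⟩ := (l : Filter α).nonempty_of_neBot
  have hC0 : 0 ≤ C := (norm_nonneg _).trans (hC x)
  have hpt (v : H) : Tendsto (fun x => K (D x v)) l (𝓝 0) :=
    tendsto_zero_of_isCompactOperator hK (C := C * ‖v‖) (fun x => (D x).le_of_opNorm_le (hC x) v) fun u => by
      simpa using hD u v
  -- Compactness of `K` gives `K D_x v → 0` for each single `v`. Compactness of `K'` makes this
  -- uniform, since a finite net suffices for the image of the unit ball.
  obtain ⟨Z, hZ, hZ'⟩ := hK'.image_closedBall_subset_compact (f := (K' : H →ₗ[ℂ] H)) 1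
  refine Metric.tendsto_nhds.2 fun ε hε => ?_
  set η : ℝ := ε / (2 * (‖K‖ * C + 1)) with hη
  have hη0 : 0 < η := by positivity
  obtain ⟨t, htf, ht⟩ := Metric.totallyBounded_iff.1 hZ.totallyBounded η hη0
  have hev : ∀ᶠ x in (l : Filter α), ∀ i ∈ t, ‖K (D x i)‖ < ε / 4 :=
    (htf.eventually_all).2 fun i _ => by
      have := (hpt i).norm
      rw [norm_zero] at this
      exact this.eventually_lt_const (by positivity)
  filter_upwards [hev] with x hx
  rw [Real.dist_0_eq_abs, abs_norm]
  have hlt : ε / 4 + ε / 2 < ε := by linarith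
  refine lt_of_le_of_lt (ContinuousLinearMap.opNorm_le_of_unit_norm (𝕜 := ℂ)
    (by positivity) fun f hf => ?_) hlt
  have hmem : K' f ∈ Z := hZ' ⟨f, by simp [hf], rfl⟩
  obtain ⟨i, hi, hdist⟩ := Set.mem_iUnion₂.1 (ht hmem)
  have e : (K * D x * K') f = K (D x i) + (K * D x) (K' f - i) := by
    simp only [mul_apply_eq_comp, map_sub]; abel
  rw [e]
  refine (norm_add_le _ _).trans (add_le_add (hx i hi).le ?_)
  have h2 : ‖K' f - i‖ ≤ η := by rw [← dist_eq_norm]; exact (Metric.mem_ball.1 hdist).le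
  have h3 : ‖K * D x‖ ≤ ‖K‖ * C := (norm_mul_le _ _).trans (by gcongr; exact hC x)
  calc ‖(K * D x) (K' f - i)‖ ≤ ‖K‖ * C * η :=
        ((K * D x).le_of_opNorm_le h3 _).trans (by gcongr)
    _ ≤ (‖K‖ * C + 1) * η := by gcongr; linarith
    _ = ε / 2 := by rw [hη]; field_simp

end WeakLimits

/-! ### Approximation of elements of `𝒞(ℝⁿ)` -/

/-- A limit at `0` is traded for a global quadratic bound: outside the ball where `N` is small,
`‖k‖²` dominates the uniform bound. Such a majorant can be integrated against the Gaussian, and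
rescaling `k` by a small factor then makes the quadratic term small. -/
theorem exists_le_add_mul_norm_sq {N : Space n → ℝ} {B : ℝ} (hB : ∀ k, N k ≤ B)
    (h : Tendsto N (𝓝 0) (𝓝 0)) {ε : ℝ} (hε : 0 < ε) :
    ∃ C, 0 ≤ C ∧ ∀ k, N k ≤ ε + C * ‖k‖ ^ 2 := by
  obtain ⟨δ, hδ, hδ'⟩ := Metric.eventually_nhds_iff.1 (h.eventually_lt_const hε)
  refine ⟨|B| / δ ^ 2, by positivity, fun k => ?_⟩
  rcases lt_or_ge ‖k‖ δ with hk | hk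
  · have := hδ' (by simpa using hk : dist k 0 < δ)
    have h2 : 0 ≤ |B| / δ ^ 2 * ‖k‖ ^ 2 := by positivity
    linarith
  · have h2 : |B| ≤ |B| / δ ^ 2 * ‖k‖ ^ 2 := by
      rw [div_mul_eq_mul_div, le_div_iff₀ (by positivity)]
      gcongr
    linarith [hB k, le_abs_self B]

/-- The second moment of the Gaussian. -/
def gaussMoment (n : ℕ) : ℝ := ∫ v : Space n, gauss v * ‖v‖ ^ 2

theorem integrable_gauss_mul_add (a c : ℝ) :
    Integrable fun k : Space n => gauss k * (a + c * ‖k‖ ^ 2) := by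
  refine ((integrable_gauss.mul_const a).add (integrable_gauss_mul_norm_sq.mul_const c)).congr
    (ae_of_all _ fun k => ?_)
  simp only [Pi.add_apply]
  ring

theorem integral_gauss_mul_add (a c : ℝ) :
    ∫ k : Space n, gauss k * (a + c * ‖k‖ ^ 2) = a + c * gaussMoment n := by
  have e (k : Space n) : gauss k * (a + c * ‖k‖ ^ 2) = gauss k * a + gauss k * ‖k‖ ^ 2 * c := by
    ring
  simp_rw [e]
  rw [integral_add (integrable_gauss.mul_const a) (integrable_gauss_mul_norm_sq.mul_const c),
    integral_mul_const, integral_mul_const, integral_gauss, gaussMoment]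
  ring

theorem norm_integral_gauss_smul_le {w : Space n → L2 n} {a c D : ℝ}
    (h : ∀ k, ‖w k‖ ≤ (a + c * ‖k‖ ^ 2) * D) :
    ‖∫ k : Space n, (gauss k : ℂ) • w k‖ ≤ (a + c * gaussMoment n) * D := by
  rw [← integral_gauss_mul_add, ← integral_mul_const]
  refine norm_integral_le_of_norm_le ((integrable_gauss_mul_add a c).mul_const D)
    (ae_of_all _ fun k => ?_)
  rw [norm_smul, Complex.norm_real, Real.norm_of_nonneg (gauss_pos _).le, mul_assoc]
  exact mul_le_mul_of_nonneg_left (h k) (gauss_pos _).le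

theorem integral_gauss_smul_const (f : L2 n) : ∫ k : Space n, (gauss k : ℂ) • f = f := by
  rw [integral_smul_const, integral_complex_ofReal, integral_gauss, Complex.ofReal_one, one_smul]

/-- The Gaussian has total mass one, so the difference is the Gaussian average of `(U_{tk} - 1) T`.
-/
theorem norm_psiOp_mul_sub_le {T : L2 n →L[ℂ] L2 n} {a c : ℝ}
    (h : ∀ x, ‖(U x - 1) * T‖ ≤ a + c * ‖x‖ ^ 2) (t : ℝ) :
    ‖psiOp n t * T - T‖ ≤ a + c * t ^ 2 * gaussMoment n := by
  have ha : 0 ≤ a := by simpa using (norm_nonneg _).trans (h 0)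
  have hD : 0 ≤ a + c * t ^ 2 * gaussMoment n := by
    rw [← integral_gauss_mul_add]
    refine integral_nonneg fun k => mul_nonneg (gauss_pos _).le ?_
    refine (norm_nonneg _).trans ((h (t • k)).trans_eq ?_)
    rw [norm_smul, mul_pow, Real.norm_eq_abs, sq_abs]; ring
  refine ContinuousLinearMap.opNorm_le_bound _ hD fun f => ?_
  have e : (psiOp n t * T - T) f
      = ∫ k : Space n, (gauss k : ℂ) • (((U (t • k) - 1) * T) f) := by
    have h1 := psiOp_apply_eq_integral t (1 : L2 n →L[ℂ] L2 n) (T f)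
    rw [sub_apply, mul_apply_eq_comp, show psiOp n t (T f) = _ from h1]
    nth_rw 2 [← integral_gauss_smul_const (T f)]
    have hi : Integrable fun k : Space n => (gauss k : ℂ) • T f :=
      Integrable.smul_const (integrable_gauss (n := n)).ofReal (T f)
    rw [← integral_sub (integrable_gauss_smul_U t 1 (T f)) hi]
    refine integral_congr_ae (ae_of_all _ fun k => ?_)
    simp only [one_apply_eq_self, mul_apply_eq_comp, sub_apply, smul_sub]
  rw [e]
  refine norm_integral_gauss_smul_le fun k => ?_
  refine ContinuousLinearMap.le_of_opNorm_le _ ((h (t • k)).trans_eq ?_) f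
  rw [norm_smul, mul_pow, Real.norm_eq_abs, sq_abs]; ring

/-- The commutator with a Gaussian of position is the Gaussian average of the commutators with
`V_{2πsk}`. -/
theorem norm_gaussOp_comm_le {T : L2 n →L[ℂ] L2 n} {a c : ℝ}
    (h : ∀ k, ‖T * V k - V k * T‖ ≤ a + c * ‖k‖ ^ 2) (s : ℝ) :
    ‖T * gaussOp n s - gaussOp n s * T‖ ≤ a + c * (2 * Real.pi * s) ^ 2 * gaussMoment n := by
  have hn (k : Space n) : a + c * ‖(2 * Real.pi * s) • k‖ ^ 2
      = a + c * (2 * Real.pi * s) ^ 2 * ‖k‖ ^ 2 := by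
    rw [norm_smul, mul_pow, Real.norm_eq_abs, sq_abs]; ring
  have hD : 0 ≤ a + c * (2 * Real.pi * s) ^ 2 * gaussMoment n := by
    rw [← integral_gauss_mul_add]
    refine integral_nonneg fun k => mul_nonneg (gauss_pos _).le ?_
    exact (norm_nonneg _).trans ((h ((2 * Real.pi * s) • k)).trans_eq (hn k))
  refine ContinuousLinearMap.opNorm_le_bound _ hD fun f => ?_
  have e : (T * gaussOp n s - gaussOp n s * T) f = ∫ k : Space n, (gauss k : ℂ) •
      ((T * V ((2 * Real.pi * s) • k) - V ((2 * Real.pi * s) • k) * T) f) := by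
    have h1 := gaussOp_apply_eq_integral s T f
    have h2 := gaussOp_apply_eq_integral s (1 : L2 n →L[ℂ] L2 n) (T f)
    rw [sub_apply, mul_apply_eq_comp, mul_apply_eq_comp, h1, show gaussOp n s (T f) = _ from h2,
      ← integral_sub (integrable_gauss_smul_V s T f) (integrable_gauss_smul_V s 1 (T f))]
    refine integral_congr_ae (ae_of_all _ fun k => ?_)
    simp only [one_apply_eq_self, mul_apply_eq_comp, sub_apply, smul_sub]
  rw [e]
  refine norm_integral_gauss_smul_le fun k => ?_
  exact ContinuousLinearMap.le_of_opNorm_le _ ((h _).trans_eq (hn k)) f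

/-- The translate `U_x T U_x*`. -/
def translate (T : L2 n →L[ℂ] L2 n) (x : Space n) : L2 n →L[ℂ] L2 n := U x * T * star (U x)

theorem translate_eq (T : L2 n →L[ℂ] L2 n) (x : Space n) : translate T x = U x * T * U (-x) := by
  rw [translate, star_U]

theorem norm_translate (T : L2 n →L[ℂ] L2 n) (x : Space n) : ‖translate T x‖ = ‖T‖ := by
  rw [translate_eq, norm_mul_U, norm_U_mul]

theorem translate_mul (T S : L2 n →L[ℂ] L2 n) (x : Space n) :
    translate (T * S) x = translate T x * translate S x := by
  simp only [translate_eq]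
  rw [show U x * T * U (-x) * (U x * S * U (-x)) = U x * T * (U (-x) * U x) * S * U (-x) by
    simp only [mul_assoc], U_neg_mul_U, mul_one]
  simp only [mul_assoc]

theorem star_translate (T : L2 n →L[ℂ] L2 n) (x : Space n) :
    star (translate T x) = translate (star T) x := by
  simp only [translate, star_mul, star_star, mul_assoc]

theorem translate_sub (T S : L2 n →L[ℂ] L2 n) (x : Space n) :
    translate (T - S) x = translate T x - translate S x := by
  simp only [translate, mul_sub, sub_mul]

theorem translate_add (T S : L2 n →L[ℂ] L2 n) (x : Space n) :
    translate (T + S) x = translate T x + translate S x := by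
  simp only [translate, mul_add, add_mul]

theorem translate_smul (c : ℂ) (T : L2 n →L[ℂ] L2 n) (x : Space n) :
    translate (c • T) x = c • translate T x := by
  simp only [translate, mul_smul_comm, smul_mul_assoc]

theorem translate_V (k x : Space n) :
    translate (V k) x = Complex.exp ((inner ℝ k x : ℝ) * Complex.I) • V k := by
  rw [translate_eq, U_mul_V, smul_mul_assoc, mul_assoc, U_mul_U_neg, mul_one]

theorem translate_U (y x : Space n) : translate (U y) x = U y := by
  rw [translate_eq, ← U_add, ← U_add]
  congr 1
  abel

theorem translate_one (x : Space n) : translate (1 : L2 n →L[ℂ] L2 n) x = 1 := by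
  rw [translate_eq, mul_one, U_mul_U_neg]

/-- By the Weyl relations, translating `V_k` only multiplies it by a phase. This invariance is what
makes all later estimates uniform in the translation. -/
theorem norm_translate_comm (T : L2 n →L[ℂ] L2 n) (x k : Space n) :
    ‖translate T x * V k - V k * translate T x‖ = ‖T * V k - V k * T‖ := by
  rw [← norm_translate (T * V k - V k * T) x, translate_sub, translate_mul, translate_mul,
    translate_V, mul_smul_comm, smul_mul_assoc, ← smul_sub, norm_smul,
    Complex.norm_exp_ofReal_mul_I, one_mul]

theorem norm_U_sub_one_mul_translate (T : L2 n →L[ℂ] L2 n) (x y : Space n) :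
    ‖(U y - 1) * translate T x‖ = ‖(U y - 1) * T‖ := by
  rw [← norm_translate ((U y - 1) * T) x, translate_mul, translate_sub, translate_U, translate_one]

theorem norm_comm_V_le (T : L2 n →L[ℂ] L2 n) (k : Space n) :
    ‖T * V k - V k * T‖ ≤ 2 * ‖T‖ := by
  refine (norm_sub_le _ _).trans (le_of_eq ?_)
  rw [norm_mul_V, norm_V_mul, two_mul]

theorem norm_U_sub_one_mul_le (T : L2 n →L[ℂ] L2 n) (k : Space n) :
    ‖(U k - 1) * T‖ ≤ 2 * ‖T‖ := by
  rw [sub_mul, one_mul]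
  refine (norm_sub_le _ _).trans (le_of_eq ?_)
  rw [norm_U_mul, two_mul]

theorem exists_add_mul_sq_le {c ε : ℝ} (hε : 0 < ε) :
    ∃ s : ℝ, 0 < s ∧ ∀ r, |r| ≤ s → c * r ^ 2 ≤ ε := by
  have h : Tendsto (fun r : ℝ => c * r ^ 2) (𝓝 0) (𝓝 0) := by
    have : Continuous fun r : ℝ => c * r ^ 2 := by fun_prop
    simpa using this.tendsto 0
  obtain ⟨δ, hδ, hδ'⟩ := Metric.eventually_nhds_iff.1 (h.eventually_lt_const hε)
  exact ⟨δ / 2, by positivity, fun r hr => (hδ' (by simp; linarith)).le⟩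

/-- Elements of `𝒞(ℝⁿ)` are approximated by their Gaussian regularizations, uniformly along
translations. -/
theorem exists_norm_psiOp_mul_translate_sub_le {T : L2 n →L[ℂ] L2 n}
    (hT : Tendsto (fun x : Space n => ‖(U x - 1) * T‖) (𝓝 0) (𝓝 0)) {ε : ℝ} (hε : 0 < ε) :
    ∃ t₀ : ℝ, 0 < t₀ ∧ ∀ t, |t| ≤ t₀ → ∀ x,
      ‖psiOp n t * translate T x - translate T x‖ ≤ ε := by
  obtain ⟨C, -, hC⟩ := exists_le_add_mul_norm_sq (norm_U_sub_one_mul_le T) hT (half_pos hε)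
  obtain ⟨s, hs, hs'⟩ := exists_add_mul_sq_le (c := C * gaussMoment n) (half_pos hε)
  refine ⟨s, hs, fun t ht x => ?_⟩
  refine (norm_psiOp_mul_sub_le (a := ε / 2) (c := C) (fun y => ?_) t).trans ?_
  · rw [norm_U_sub_one_mul_translate]; exact hC y
  · have := hs' t ht
    linarith

theorem exists_norm_comm_gaussOp_le {T : L2 n →L[ℂ] L2 n}
    (hT : Tendsto (fun k : Space n => ‖T * V k - V k * T‖) (𝓝 0) (𝓝 0)) {ε : ℝ} (hε : 0 < ε) :
    ∃ s₀ : ℝ, 0 < s₀ ∧ ∀ s, |s| ≤ s₀ → ∀ x,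
      ‖translate T x * gaussOp n s - gaussOp n s * translate T x‖ ≤ ε := by
  obtain ⟨C, -, hC⟩ := exists_le_add_mul_norm_sq (norm_comm_V_le T) hT (half_pos hε)
  obtain ⟨s, hs, hs'⟩ :=
    exists_add_mul_sq_le (c := C * (2 * Real.pi) ^ 2 * gaussMoment n) (half_pos hε)
  refine ⟨s, hs, fun t ht x => ?_⟩
  refine (norm_gaussOp_comm_le (a := ε / 2) (c := C) (fun y => ?_) t).trans ?_
  · rw [norm_translate_comm]; exact hC y
  · have := hs' t ht
    nlinarith

/-- Outside a ball of radius `R` the function `θ` is itself small; inside it, `1 - exp(-π|sy|²) ≤ π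
R² s²`. -/
theorem exists_norm_mulOp_sub_gaussOp_mul_le (θ : C₀(Space n, ℂ)) {ε : ℝ} (hε : 0 < ε) :
    ∃ s₀ : ℝ, 0 < s₀ ∧ ∀ s, |s| ≤ s₀ →
      ‖mulOp θ.toBCF - gaussOp n s * mulOp θ.toBCF‖ ≤ ε := by
  have h1 := (Metric.tendsto_nhds.1 θ.zero_at_infty' ε hε)
  obtain ⟨R, hR⟩ := (Metric.isBounded_iff_subset_closedBall (0 : Space n)).1
    (Metric.isCompact_iff_isClosed_bounded.1 (mem_cocompact.1 h1).choose_spec.1).2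
  have hR' : ∀ y : Space n, R < ‖y‖ → ‖θ y‖ ≤ ε := fun y hy => by
    by_contra hcon
    have : y ∈ (mem_cocompact.1 h1).choose := by
      by_contra hy'
      have := (mem_cocompact.1 h1).choose_spec.2 hy'
      simp only [Set.mem_ofPred_eq, dist_zero_right] at this
      exact hcon (le_of_lt this)
    have := hR this
    rw [mem_closedBall_zero_iff] at this
    linarith
  obtain ⟨s₀, hs₀, hs⟩ := exists_add_mul_sq_le (c := Real.pi * R ^ 2 * ‖θ.toBCF‖) hε
  refine ⟨s₀, hs₀, fun s hss => ?_⟩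
  have e : mulOp θ.toBCF - gaussOp n s * mulOp θ.toBCF
      = mulOp (θ.toBCF - gaussMul s 0 * θ.toBCF) := by
    rw [mulOp_sub, mulOp_mul]; rfl
  rw [e]
  refine (norm_mulOp_le _).trans ((BoundedContinuousFunction.norm_le hε.le).2 fun y => ?_)
  rw [BoundedContinuousFunction.sub_apply, BoundedContinuousFunction.mul_apply, gaussMul_apply,
    sub_zero, ← one_sub_mul, norm_mul]
  have hg : ‖(1 : ℂ) - (gauss (s • y) : ℂ)‖ = 1 - gauss (s • y) := by
    rw [← Complex.ofReal_one, ← Complex.ofReal_sub, Complex.norm_real,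
      Real.norm_of_nonneg (sub_nonneg.2 (gauss_le_one _))]
  rw [hg]
  rcases le_or_gt ‖y‖ R with hy | hy
  · have h2 : 1 - gauss (s • y) ≤ Real.pi * R ^ 2 * s ^ 2 := by
      have h3 := Real.add_one_le_exp (-Real.pi * ‖s • y‖ ^ 2)
      have h4 : ‖s • y‖ ^ 2 ≤ R ^ 2 * s ^ 2 := by
        rw [norm_smul, mul_pow, Real.norm_eq_abs, sq_abs, mul_comm]
        gcongr
      rw [gauss]
      nlinarith [Real.pi_pos]
    calc (1 - gauss (s • y)) * ‖θ.toBCF y‖ ≤ (Real.pi * R ^ 2 * s ^ 2) * ‖θ.toBCF‖ := by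
          refine mul_le_mul h2 (θ.toBCF.norm_coe_le_norm y) (norm_nonneg _) (by positivity)
      _ = Real.pi * R ^ 2 * ‖θ.toBCF‖ * s ^ 2 := by ring
      _ ≤ ε := hs s hss
  · calc (1 - gauss (s • y)) * ‖θ.toBCF y‖ ≤ 1 * ε := by
          refine mul_le_mul ?_ (hR' y hy) (norm_nonneg _) zero_le_one
          linarith [gauss_pos (s • y)]
      _ = ε := one_mul _

/-! ### Localization of elements of `𝒞(ℝⁿ)` along ultrafilters -/

theorem norm_star_eq (T : L2 n →L[ℂ] L2 n) : ‖star T‖ = ‖T‖ := norm_star T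

/-- Up to a small error, localized translates are sandwiched between fixed compact operators. -/
theorem exists_compact_sandwich {T : L2 n →L[ℂ] L2 n} (hT : T ∈ algC n) (θ : C₀(Space n, ℂ))
    {ε : ℝ} (hε : 0 < ε) :
    ∃ K K' : L2 n →L[ℂ] L2 n, IsCompactOperator K ∧ IsCompactOperator K' ∧
      ∀ x, ‖translate T x * mulOp θ.toBCF - K * translate T x * K'‖ ≤ ε := by
  set M : L2 n →L[ℂ] L2 n := mulOp θ.toBCF with hM
  -- The telescoping below has five terms: two are bounded by `‖T‖ η` and three by `η ‖M‖`.
  set η : ℝ := ε / (2 * ‖T‖ + 3 * ‖M‖ + 1) with hη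
  have hη0 : 0 < η := by positivity
  obtain ⟨s₁, hs₁, h1⟩ := exists_norm_mulOp_sub_gaussOp_mul_le θ hη0
  obtain ⟨s₂, hs₂, h2⟩ := exists_norm_comm_gaussOp_le hT.1 hη0
  obtain ⟨t₁, ht₁, h3⟩ := exists_norm_psiOp_mul_translate_sub_le hT.2.1 hη0
  obtain ⟨t₂, ht₂, h4⟩ := exists_norm_psiOp_mul_translate_sub_le hT.2.2 hη0
  set s := min s₁ s₂ with hs
  set t := min t₁ t₂ with ht
  have hs0 : 0 < s := lt_min hs₁ hs₂
  have ht0 : 0 < t := lt_min ht₁ ht₂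
  replace h1 := h1 s ((abs_of_pos hs0).trans_le (min_le_left _ _))
  replace h2 := h2 s ((abs_of_pos hs0).trans_le (min_le_right _ _))
  replace h3 := h3 t ((abs_of_pos ht0).trans_le (min_le_left _ _))
  replace h4 := h4 t ((abs_of_pos ht0).trans_le (min_le_right _ _))
  refine ⟨gaussOp n s * psiOp n t, psiOp n t * gaussOp n s * M,
    isCompactOperator_gaussOp_mul_psiOp hs0.ne' ht0.ne',
    (isCompactOperator_psiOp_mul_gaussOp hs0.ne' ht0.ne').comp_clm M, fun x => ?_⟩
  rw [← hM] at h1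
  set X := translate T x with hX
  set G := gaussOp n s with hG
  set P := psiOp n t with hP
  have h5 : ‖X * P - X‖ ≤ η := by
    have := h4 x
    rw [← star_translate, ← hX, hP, ← star_psiOp, ← star_mul, ← star_sub, norm_star_eq] at this
    exact this
  have hXn : ‖X‖ = ‖T‖ := norm_translate T x
  have hGn : ‖G‖ ≤ 1 := norm_gaussOp_le s
  have hPn : ‖P‖ ≤ 1 := norm_psiOp_le t
  -- With `G = g(sQ)` and `P = g(tP)`: insert `G` next to `M`, commute it to the left of `X`, insert
  -- `P` before `X`, insert a second `G` next to `M`, and finally insert `P` after `X`.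
  have e : X * M - G * P * X * (P * G * M)
      = X * (M - G * M) + (X * G - G * X) * M + -(G * (P * X - X) * M)
        + G * P * X * (M - G * M) + -(G * P * (X * P - X) * (G * M)) := by
    noncomm_ring
  rw [e]
  have b1 : ‖X * (M - G * M)‖ ≤ ‖T‖ * η :=
    (norm_mul_le _ _).trans (by rw [hXn]; gcongr)
  have b2 : ‖(X * G - G * X) * M‖ ≤ η * ‖M‖ := (norm_mul_le _ _).trans (by gcongr; exact h2 x)
  have b3 : ‖-(G * (P * X - X) * M)‖ ≤ 1 * η * ‖M‖ := by
    rw [norm_neg]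
    exact (norm_mul_le _ _).trans (by
      gcongr; exact (norm_mul_le _ _).trans (by gcongr; exact h3 x))
  have b4 : ‖G * P * X * (M - G * M)‖ ≤ 1 * 1 * ‖T‖ * η := by
    refine (norm_mul_le _ _).trans ?_
    gcongr
    refine (norm_mul_le _ _).trans ?_
    rw [hXn]
    gcongr
    exact (norm_mul_le _ _).trans (by gcongr)
  have b5 : ‖-(G * P * (X * P - X) * (G * M))‖ ≤ 1 * 1 * η * (1 * ‖M‖) := by
    rw [norm_neg]
    refine (norm_mul_le _ _).trans ?_
    gcongr
    · refine (norm_mul_le _ _).trans ?_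
      gcongr
      exact (norm_mul_le _ _).trans (by gcongr)
    · exact (norm_mul_le _ _).trans (by gcongr)
  refine (norm_add_le _ _).trans ((add_le_add ((norm_add_le _ _).trans (add_le_add
    ((norm_add_le _ _).trans (add_le_add ((norm_add_le _ _).trans (add_le_add b1 b2)) b3)) b4))
    b5).trans ?_)
  calc _ = η * (2 * ‖T‖ + 3 * ‖M‖) := by ring
    _ ≤ η * (2 * ‖T‖ + 3 * ‖M‖ + 1) := by gcongr _ * ?_; linarith
    _ = ε := by rw [hη]; field_simp

theorem star_mem_algC {T : L2 n →L[ℂ] L2 n} (hT : T ∈ algC n) : star T ∈ algC n := by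
  refine ⟨?_, hT.2.2, by simpa only [star_star] using hT.2.1⟩
  have h : Tendsto (fun k : Space n => ‖T * V (-k) - V (-k) * T‖) (𝓝 0) (𝓝 0) :=
    hT.1.comp (by simpa using (continuous_neg (G := Space n)).tendsto 0)
  refine h.congr fun k => ?_
  rw [← norm_star_eq, star_sub, star_mul, star_mul, star_V, neg_neg, norm_sub_rev]

/-- Weak convergence of the translates of an element of `𝒞(ℝⁿ)` along an ultrafilter is
convergence in `𝒞ₛ(ℝⁿ)`. -/
theorem tendsto_norm_translate_sub_mul {T S : L2 n →L[ℂ] L2 n} (hT : T ∈ algC n)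
    {l : Ultrafilter (Space n)} (h : WeakTendsto (translate T) l S) (θ : C₀(Space n, ℂ)) :
    Tendsto (fun x => ‖(translate T x - S) * mulOp θ.toBCF‖) l (𝓝 0) := by
  refine Metric.tendsto_nhds.2 fun ε hε => ?_
  obtain ⟨K, K', hK, hK', hKK⟩ := exists_compact_sandwich hT θ (show 0 < ε / 4 by positivity)
  -- The weak limit inherits the uniform sandwich estimate, so only `K (T_x - S) K'` remains, and it
  -- tends to zero in norm.
  have hS : ‖S * mulOp θ.toBCF - K * S * K'‖ ≤ ε / 4 :=
    ((h.mul_const _).sub (h.mul_mul K K')).norm_le hKK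
  have h0 : WeakTendsto (fun x => translate T x - S) l 0 := by
    simpa only [sub_self] using h.sub (weakTendsto_const S (l : Filter (Space n)))
  have h1 := tendsto_norm_compact_mul_mul_compact hK hK' (C := ‖T‖ + ‖S‖)
    (fun x => (norm_sub_le _ _).trans_eq (by rw [norm_translate])) h0
  filter_upwards [h1.eventually_lt_const (show 0 < ε / 4 by positivity)] with x hx
  rw [Real.dist_0_eq_abs, abs_norm]
  have e : (translate T x - S) * mulOp θ.toBCF
      = (translate T x * mulOp θ.toBCF - K * translate T x * K')
        - (S * mulOp θ.toBCF - K * S * K') + K * (translate T x - S) * K' := by noncomm_ring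
  rw [e]
  have := norm_add_le ((translate T x * mulOp θ.toBCF - K * translate T x * K')
        - (S * mulOp θ.toBCF - K * S * K')) (K * (translate T x - S) * K')
  have h2 := norm_sub_le (translate T x * mulOp θ.toBCF - K * translate T x * K')
    (S * mulOp θ.toBCF - K * S * K')
  linarith [hKK x]

theorem star_mulOp_zeroAtInfty (θ : C₀(Space n, ℂ)) :
    star (mulOp θ.toBCF) = mulOp (star θ).toBCF := by
  rw [star_mulOp]; rfl

theorem tendstoCs_of_weakTendsto {T S : L2 n →L[ℂ] L2 n} (hT : T ∈ algC n)
    {l : Ultrafilter (Space n)} (h : WeakTendsto (translate T) l S) :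
    TendstoCs (fun x => U x * T * star (U x)) l S := by
  intro θ
  have h1 := tendsto_norm_translate_sub_mul hT h θ
  have hs : WeakTendsto (translate (star T)) l (star S) := by
    simpa only [star_translate] using h.star
  have h2 := tendsto_norm_translate_sub_mul (star_mem_algC hT) hs (star θ)
  have h3 := h1.add h2
  rw [add_zero] at h3
  refine h3.congr fun x => ?_
  congr 1
  rw [← star_translate, ← star_sub, ← star_mulOp_zeroAtInfty, ← star_mul, norm_star_eq]
  rfl

/-- Strong continuity of `k ↦ V_k u` at `0`, averaged against the Gaussian. -/
theorem tendsto_gaussOp_apply (u : L2 n) : Tendsto (fun s => gaussOp n s u) (𝓝 0) (𝓝 u) := by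
  refine Metric.tendsto_nhds.2 fun ε hε => ?_
  have hB : ∀ k : Space n, ‖V k u - u‖ ≤ 2 * ‖u‖ := fun k =>
    (norm_sub_le _ _).trans_eq (by rw [norm_V_apply, two_mul])
  have ht : Tendsto (fun k : Space n => ‖V k u - u‖) (𝓝 0) (𝓝 0) := by
    have := ((continuous_V_apply u).sub (continuous_const (y := u))).norm.tendsto 0
    simpa [V_zero] using this
  obtain ⟨C, -, hC⟩ := exists_le_add_mul_norm_sq hB ht (show 0 < ε / 4 by positivity)
  obtain ⟨s₀, hs₀, hs⟩ := exists_add_mul_sq_le (c := C * (2 * Real.pi) ^ 2 * gaussMoment n)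
    (show 0 < ε / 4 by positivity)
  filter_upwards [Metric.ball_mem_nhds 0 hs₀] with s hss
  have hss' : |s| ≤ s₀ := by simpa using (Metric.mem_ball.1 hss).le
  have e : gaussOp n s u - u
      = ∫ k : Space n, (gauss k : ℂ) • (V ((2 * Real.pi * s) • k) u - u) := by
    have h1 := gaussOp_apply_eq_integral s (1 : L2 n →L[ℂ] L2 n) u
    have hi : Integrable fun k : Space n => (gauss k : ℂ) • u :=
      Integrable.smul_const (integrable_gauss (n := n)).ofReal u
    rw [show gaussOp n s u = _ from h1]
    nth_rw 2 [← integral_gauss_smul_const u]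
    rw [← integral_sub (integrable_gauss_smul_V s 1 u) hi]
    refine integral_congr_ae (ae_of_all _ fun k => ?_)
    simp only [one_apply_eq_self, smul_sub]
  rw [dist_eq_norm, e]
  have h2 := norm_integral_gauss_smul_le (n := n) (D := 1) (a := ε / 4)
    (c := C * (2 * Real.pi * s) ^ 2)
    (w := fun k => V ((2 * Real.pi * s) • k) u - u) fun k => by
      refine (hC _).trans_eq ?_
      rw [norm_smul, mul_pow, Real.norm_eq_abs, sq_abs]; ring
  have h3 := hs s hss'
  have h4 : C * (2 * Real.pi * s) ^ 2 * gaussMoment n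
    = C * (2 * Real.pi) ^ 2 * gaussMoment n * s ^ 2 := by ring
  linarith

/-- The function `y ↦ exp (-π ‖s y - b‖²)` vanishes at infinity if `s ≠ 0`. -/
def gaussZero {s : ℝ} (hs : s ≠ 0) (b : Space n) : C₀(Space n, ℂ) where
  toFun := gaussMul s b
  continuous_toFun := (gaussMul s b).continuous
  zero_at_infty' := by
    have h1 : Tendsto (fun y : Space n => ‖s • y - b‖) (cocompact _) atTop := by
      refine tendsto_norm_cocompact_atTop.comp ?_
      exact ((Homeomorph.smulOfNeZero s hs).trans
        (Homeomorph.subRight b)).isClosedEmbedding.tendsto_cocompact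
    have h2 : Tendsto (fun r : ℝ => Real.exp (-Real.pi * r ^ 2)) atTop (𝓝 0) := by
      refine Real.tendsto_exp_atBot.comp ?_
      exact (tendsto_pow_atTop two_ne_zero).const_mul_atTop_of_neg (by linarith [Real.pi_pos])
    have h3 := (Complex.continuous_ofReal.tendsto 0).comp (h2.comp h1)
    rw [Complex.ofReal_zero] at h3
    exact h3

/-- Convergence in `𝒞ₛ(ℝⁿ)` of a bounded family implies strong convergence. -/
theorem tendsto_translate_apply {T S : L2 n →L[ℂ] L2 n} (hT : T ∈ algC n)
    {l : Ultrafilter (Space n)} (h : WeakTendsto (translate T) l S) (u : L2 n) :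
    Tendsto (fun x => translate T x u) l (𝓝 (S u)) := by
  refine tendsto_iff_norm_sub_tendsto_zero.2 (Metric.tendsto_nhds.2 fun ε hε => ?_)
  set C := ‖T‖ + ‖S‖ + 1 with hC
  have hC0 : 0 < C := by positivity
  -- The vector is first cut off by a Gaussian. The parameter must be nonzero for the Gaussian to
  -- vanish at infinity and so serve as a function `θ`.
  have h1 : ∀ᶠ s in 𝓝[≠] (0 : ℝ), dist (gaussOp n s u) u < ε / (2 * C) :=
    ((tendsto_gaussOp_apply u).mono_left nhdsWithin_le_nhds).eventually
      (Metric.ball_mem_nhds _ (by positivity))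
  obtain ⟨s, hs1, hs2⟩ := (h1.and self_mem_nhdsWithin).exists
  have hs0 : s ≠ 0 := hs2
  have h2 := tendsto_norm_translate_sub_mul hT h (gaussZero hs0 0)
  filter_upwards [h2.eventually_lt_const (show 0 < ε / (2 * (‖u‖ + 1)) by positivity)] with x hx
  rw [Real.dist_0_eq_abs, abs_norm, ← sub_apply]
  set D := translate T x - S with hD
  have hDn : ‖D‖ ≤ C := (norm_sub_le _ _).trans (by rw [norm_translate, hC]; linarith)
  have e : D u = (D * gaussOp n s) u - D (gaussOp n s u - u) := by
    rw [map_sub, mul_apply_eq_comp]; abel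
  rw [e]
  have b1 : ‖(D * gaussOp n s) u‖ ≤ ε / (2 * (‖u‖ + 1)) * ‖u‖ :=
    ContinuousLinearMap.le_of_opNorm_le _ hx.le u
  have b2 : ‖D (gaussOp n s u - u)‖ ≤ C * ‖gaussOp n s u - u‖ :=
    ContinuousLinearMap.le_of_opNorm_le _ hDn _
  have b3 : ε / (2 * (‖u‖ + 1)) * ‖u‖ ≤ ε / 2 := by
    rw [div_mul_eq_mul_div, div_le_div_iff₀ (by positivity) two_pos]
    nlinarith [norm_nonneg u]
  have b4 : C * ‖gaussOp n s u - u‖ < ε / 2 := by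
    rw [← dist_eq_norm]
    calc C * dist (gaussOp n s u) u < C * (ε / (2 * C)) := by gcongr
      _ = ε / 2 := by field_simp
  have := norm_sub_le ((D * gaussOp n s) u) (D (gaussOp n s u - u))
  linarith

/-- Weak limits are not multiplicative in general. Here the right factor converges strongly because
it comes from `𝒞(ℝⁿ)`, and strong convergence on the right with bounded weak convergence on the left
suffices. -/
theorem weakTendsto_translate_mul {T S T' S' : L2 n →L[ℂ] L2 n} (hT' : T' ∈ algC n)
    {l : Ultrafilter (Space n)} (h : WeakTendsto (translate T) l S)
    (h' : WeakTendsto (translate T') l S') : WeakTendsto (translate (T * T')) l (S * S') := by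
  intro u v
  have h1 := tendsto_translate_apply hT' h' v
  have h2 : Tendsto (fun x => inner ℂ u (translate T x (translate T' x v - S' v))) l (𝓝 0) := by
    refine squeeze_zero_norm (a := fun x => ‖u‖ * (‖T‖ * ‖translate T' x v - S' v‖))
      (fun x => ?_) ?_
    · refine (norm_inner_le_norm _ _).trans ?_
      gcongr
      exact ContinuousLinearMap.le_of_opNorm_le _ (norm_translate T x).le _
    · have := ((tendsto_iff_norm_sub_tendsto_zero.1 h1).const_mul ‖T‖).const_mul ‖u‖
      simpa only [mul_zero] using this
  have h3 := h2.add (h u (S' v))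
  rw [zero_add] at h3
  refine h3.congr fun x => ?_
  rw [← inner_add_right, ← map_add, sub_add_cancel, translate_mul]
  rfl

/-- The three defining norms are invariant under translation and lower semicontinuous under weak
limits, so those of `S` are dominated by those of `T`. -/
theorem weakLimit_mem_algC {T S : L2 n →L[ℂ] L2 n} (hT : T ∈ algC n)
    {l : Ultrafilter (Space n)} (h : WeakTendsto (translate T) l S) : S ∈ algC n := by
  have hs : WeakTendsto (translate (star T)) l (star S) := by
    simpa only [star_translate] using h.star
  refine ⟨squeeze_zero (fun _ => norm_nonneg _) (fun k => ?_) hT.1,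
    squeeze_zero (fun _ => norm_nonneg _) (fun x => ?_) hT.2.1,
    squeeze_zero (fun _ => norm_nonneg _) (fun x => ?_) hT.2.2⟩
  · exact ((h.mul_const (V k)).sub (h.const_mul (V k))).norm_le fun y =>
      (norm_translate_comm T y k).le
  · exact (h.const_mul (U x - 1)).norm_le fun y => (norm_U_sub_one_mul_translate T y x).le
  · exact (hs.const_mul (U x - 1)).norm_le fun y =>
      (norm_U_sub_one_mul_translate (star T) y x).le

/-! ### Compactness and localizations -/

/-- Moving the translation to the right leaves a product of two Gaussians with centres `0` and `x`;
the parallelogram bound `|x|² ≤ 2(|y|² + |y - x|²)` estimates it uniformly in `y`. -/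
theorem norm_gaussOp_U_gaussOp_le (s : ℝ) (x : Space n) :
    ‖gaussOp n s * U (-x) * gaussOp n s‖ ≤ Real.exp (-(Real.pi * s ^ 2 / 2) * ‖x‖ ^ 2) := by
  have h : U (-x) * gaussOp n s = mulOp (gaussMul s (s • x)) * U (-x) :=
    U_mul_mulOp (-x) fun y => by
      rw [gaussMul_apply, gaussMul_apply, sub_zero, smul_add, smul_neg, neg_add_eq_sub]
  rw [mul_assoc, h, ← mul_assoc, norm_mul_U, gaussOp, ← mulOp_mul]
  refine (norm_mulOp_le _).trans ((BoundedContinuousFunction.norm_le (Real.exp_pos _).le).2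
    fun y => ?_)
  rw [BoundedContinuousFunction.mul_apply, gaussMul_apply, gaussMul_apply, ← Complex.ofReal_mul,
    Complex.norm_real, Real.norm_of_nonneg (mul_pos (gauss_pos _) (gauss_pos _)).le, gauss, gauss,
    ← Real.exp_add, Real.exp_le_exp, sub_zero, ← smul_sub, norm_smul, norm_smul, mul_pow, mul_pow,
    Real.norm_eq_abs, sq_abs]
  have h1 : ‖x‖ ≤ ‖y‖ + ‖y - x‖ := by
    have := norm_sub_le y (y - x)
    rwa [sub_sub_cancel] at this
  have h2 : ‖x‖ ^ 2 ≤ 2 * (‖y‖ ^ 2 + ‖y - x‖ ^ 2) := by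
    nlinarith [norm_nonneg x, sq_nonneg (‖y‖ - ‖y - x‖)]
  have h3 : 0 ≤ Real.pi * s ^ 2 := by positivity
  nlinarith [mul_le_mul_of_nonneg_left h2 h3]

/-- Translations tend weakly to zero at infinity. -/
theorem tendsto_inner_U_neg (u v : L2 n) :
    Tendsto (fun x : Space n => inner ℂ u (U (-x) v)) (cocompact _) (𝓝 0) := by
  refine Metric.tendsto_nhds.2 fun ε hε => ?_
  have hg (w : L2 n) {δ : ℝ} (hδ : 0 < δ) :
      ∀ᶠ s in 𝓝[≠] (0 : ℝ), dist (gaussOp n s w) w < δ :=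
    ((tendsto_gaussOp_apply w).mono_left nhdsWithin_le_nhds).eventually
      (Metric.ball_mem_nhds _ hδ)
  obtain ⟨s, ⟨hs1, hs2⟩, hs0⟩ := (((hg u (show 0 < ε / (4 * (‖v‖ + 1)) by positivity)).and
    (hg v (show 0 < ε / (4 * (‖u‖ + 1)) by positivity))).and self_mem_nhdsWithin).exists
  have hs0' : s ≠ 0 := hs0
  have h1 : Tendsto (fun x : Space n =>
      Real.exp (-(Real.pi * s ^ 2 / 2) * ‖x‖ ^ 2) * (‖u‖ * ‖v‖)) (cocompact _) (𝓝 0) := by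
    rw [← zero_mul (‖u‖ * ‖v‖)]
    refine Tendsto.mul_const _ (Real.tendsto_exp_atBot.comp ?_)
    refine Tendsto.const_mul_atTop_of_neg ?_
      ((tendsto_pow_atTop two_ne_zero).comp tendsto_norm_cocompact_atTop)
    have : 0 < Real.pi * s ^ 2 / 2 := by positivity
    linarith
  filter_upwards [h1.eventually_lt_const (show 0 < ε / 2 by positivity)] with x hx
  rw [dist_zero_right]
  have e : inner ℂ u (U (-x) v) = inner ℂ u ((gaussOp n s * U (-x) * gaussOp n s) v)
      - inner ℂ (gaussOp n s u - u) (U (-x) (gaussOp n s v))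
      - inner ℂ u (U (-x) (gaussOp n s v - v)) := by
    have h3 : inner ℂ u ((gaussOp n s * U (-x) * gaussOp n s) v)
        = inner ℂ (gaussOp n s u) (U (-x) (gaussOp n s v)) := by
      nth_rw 1 [← star_gaussOp]
      rw [ContinuousLinearMap.star_eq_adjoint, mul_assoc, mul_apply_eq_comp,
        ContinuousLinearMap.adjoint_inner_right]
      rfl
    rw [h3, inner_sub_left, map_sub, inner_sub_right]
    ring
  have b1 : ‖inner ℂ u ((gaussOp n s * U (-x) * gaussOp n s) v)‖
      ≤ Real.exp (-(Real.pi * s ^ 2 / 2) * ‖x‖ ^ 2) * (‖u‖ * ‖v‖) := by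
    refine (norm_inner_le_norm _ _).trans ?_
    have := ContinuousLinearMap.le_of_opNorm_le _ (norm_gaussOp_U_gaussOp_le s x) v
    calc _ ≤ ‖u‖ * (Real.exp (-(Real.pi * s ^ 2 / 2) * ‖x‖ ^ 2) * ‖v‖) := by gcongr
      _ = _ := by ring
  have b2 : ‖inner ℂ (gaussOp n s u - u) (U (-x) (gaussOp n s v))‖ ≤ ε / 4 := by
    refine (norm_inner_le_norm _ _).trans ?_
    rw [norm_U_apply, ← dist_eq_norm]
    have h4 : ‖gaussOp n s v‖ ≤ ‖v‖ := by
      simpa using ContinuousLinearMap.le_of_opNorm_le _ (norm_gaussOp_le s) v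
    calc _ ≤ ε / (4 * (‖v‖ + 1)) * ‖v‖ := by gcongr
      _ ≤ ε / (4 * (‖v‖ + 1)) * (‖v‖ + 1) := by gcongr; linarith
      _ = ε / 4 := by field_simp
  have b3 : ‖inner ℂ u (U (-x) (gaussOp n s v - v))‖ ≤ ε / 4 := by
    refine (norm_inner_le_norm _ _).trans ?_
    rw [norm_U_apply, ← dist_eq_norm]
    calc _ ≤ ‖u‖ * (ε / (4 * (‖u‖ + 1))) := by gcongr
      _ ≤ (‖u‖ + 1) * (ε / (4 * (‖u‖ + 1))) := by gcongr; linarith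
      _ = ε / 4 := by field_simp
  rw [e]
  refine lt_of_le_of_lt ((norm_sub_le _ _).trans (add_le_add (norm_sub_le _ _) b3)) ?_
  linarith

theorem inner_translate (T : L2 n →L[ℂ] L2 n) (x : Space n) (u v : L2 n) :
    inner ℂ u (translate T x v) = inner ℂ (U (-x) u) (T (U (-x) v)) := by
  have h : U x = star (U (-x)) := by rw [star_U, neg_neg]
  rw [translate_eq, h, ContinuousLinearMap.star_eq_adjoint, mul_assoc, mul_apply_eq_comp,
    ContinuousLinearMap.adjoint_inner_right]
  rfl

/-- The localizations at infinity of a compact operator vanish. -/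
theorem weakTendsto_translate_zero {T : L2 n →L[ℂ] L2 n} (hT : IsCompactOperator T)
    {l : Ultrafilter (Space n)} (hl : (l : Filter (Space n)) ≤ cocompact _) :
    WeakTendsto (translate T) l 0 := by
  intro u v
  rw [zero_apply, inner_zero_right]
  have h := tendsto_zero_of_isCompactOperator hT (l := l) (w := fun x => U (-x) v) (C := ‖v‖)
    (fun x => (norm_U_apply _ _).le) fun u => (tendsto_inner_U_neg u v).mono_left hl
  refine squeeze_zero_norm (a := fun x => ‖u‖ * ‖T (U (-x) v)‖) (fun x => ?_) ?_
  · rw [inner_translate]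
    refine (norm_inner_le_norm _ _).trans ?_
    rw [norm_U_apply]
  · simpa using h.norm.const_mul ‖u‖

theorem isCompactOperator_of_forall_exists_norm_sub_le {T : L2 n →L[ℂ] L2 n}
    (h : ∀ ε : ℝ, 0 < ε → ∃ K : L2 n →L[ℂ] L2 n, IsCompactOperator K ∧ ‖T - K‖ ≤ ε) :
    IsCompactOperator T := by
  refine isClosed_setOf_isCompactOperator.closure_subset
    (Metric.mem_closure_iff.2 fun ε hε => ?_)
  obtain ⟨K, hK, hK'⟩ := h (ε / 2) (by positivity)
  exact ⟨K, hK, by rw [dist_eq_norm]; linarith⟩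

/-- `T` is the norm limit of `T g(tP)` as `t → 0`, and `g(tP) g(rQ)` is compact. -/
theorem isCompactOperator_mul_gaussOp {T : L2 n →L[ℂ] L2 n} (hT : T ∈ algC n) {r : ℝ}
    (hr : r ≠ 0) : IsCompactOperator (T * gaussOp n r) := by
  refine isCompactOperator_of_forall_exists_norm_sub_le fun ε hε => ?_
  obtain ⟨t, ht, h⟩ := exists_norm_psiOp_mul_translate_sub_le hT.2.2 hε
  have h1 := h t (abs_of_pos ht).le 0
  rw [translate_eq, neg_zero, U_zero, one_mul, mul_one, ← star_psiOp, ← star_mul, ← star_sub,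
    norm_star_eq] at h1
  refine ⟨T * (psiOp n t * gaussOp n r),
    (isCompactOperator_psiOp_mul_gaussOp hr ht.ne').clm_comp T, ?_⟩
  have e : T * gaussOp n r - T * (psiOp n t * gaussOp n r)
      = -((T * psiOp n t - T) * gaussOp n r) := by noncomm_ring
  rw [e, norm_neg]
  calc _ ≤ ‖T * psiOp n t - T‖ * ‖gaussOp n r‖ := norm_mul_le _ _
    _ ≤ ε * 1 := by gcongr; exact norm_gaussOp_le r
    _ = ε := mul_one _

/-! ### Compactness from Plancherel in the centre of a moving Gaussian -/

theorem norm_translate_mul_gaussOp (T : L2 n →L[ℂ] L2 n) (s : ℝ) (x : Space n) :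
    ‖translate T x * gaussOp n s‖ = ‖T * mulOp (gaussMul s (s • x))‖ := by
  have h : U (-x) * gaussOp n s = mulOp (gaussMul s (s • x)) * U (-x) :=
    U_mul_mulOp (-x) fun y => by
      rw [gaussMul_apply, gaussMul_apply, sub_zero, smul_add, smul_neg, neg_add_eq_sub]
  rw [translate_eq, mul_assoc, mul_assoc, h, norm_U_mul, ← mul_assoc, norm_mul_U]

/-- `∫ ‖T M_b h‖² db` in terms of the unitaries `V`, where `M_b` is multiplication by the Gaussian
centered at `b`. -/
theorem integral_norm_sq_mul_gaussMul (T : L2 n →L[ℂ] L2 n) (s : ℝ) (h : L2 n) :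
    Integrable (fun b : Space n => ‖T (mulOp (gaussMul s b) h)‖ ^ 2) ∧
    ∫ b : Space n, ‖T (mulOp (gaussMul s b) h)‖ ^ 2
      = ∫ k : Space n, gauss k ^ 2 * ‖T (V ((2 * Real.pi * s) • k) h)‖ ^ 2 := by
  obtain ⟨h1, h2⟩ := integral_norm_sq_fourier (integrable_gauss_smul_V s T h)
    (memLp_gauss_smul_V s T h)
  have e : 𝓕 (fun k : Space n => (gauss k : ℂ) • T (V ((2 * Real.pi * s) • k) h))
      = fun b => T (mulOp (gaussMul s b) h) := funext fun b => fourier_gauss_smul_V s b T h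
  rw [e] at h1 h2
  refine ⟨(memLp_two_iff_integrable_sq_norm h1.1).1 h1, h2.trans ?_⟩
  refine integral_congr_ae (ae_of_all _ fun k => ?_)
  simp only [norm_smul, Complex.norm_real, Real.norm_of_nonneg (gauss_pos _).le, mul_pow]

/-- `V_k` is unitary, so `‖T h‖ = ‖V_k T h‖` differs from `‖T V_k h‖` by at most the commutator.
Integrating the squares against `gauss k ^ 2` and applying the Plancherel identity replaces the
`V_k` by the moving Gaussians; `gauss ^ 2 ≤ gauss` lets the error use the same second moment. -/
theorem norm_sq_le_integral {T : L2 n →L[ℂ] L2 n} {a c : ℝ}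
    (hN : ∀ k, ‖T * V k - V k * T‖ ^ 2 ≤ a + c * ‖k‖ ^ 2) (s : ℝ) (h : L2 n) :
    (∫ k : Space n, gauss k ^ 2) * ‖T h‖ ^ 2 ≤
      2 * (∫ b : Space n, ‖T (mulOp (gaussMul s b) h)‖ ^ 2) +
        2 * ((a + c * (2 * Real.pi * s) ^ 2 * gaussMoment n) * ‖h‖ ^ 2) := by
  rw [(integral_norm_sq_mul_gaussMul T s h).2, ← integral_mul_const, ← integral_gauss_mul_add,
    ← integral_mul_const, ← integral_const_mul, ← integral_const_mul]
  have hi1 : Integrable fun k : Space n =>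
      2 * (gauss k ^ 2 * ‖T (V ((2 * Real.pi * s) • k) h)‖ ^ 2) := by
    refine Integrable.const_mul ?_ 2
    have := (memLp_two_iff_integrable_sq_norm (memLp_gauss_smul_V s T h).1).1
      (memLp_gauss_smul_V s T h)
    refine this.congr (ae_of_all _ fun k => ?_)
    simp only [norm_smul, Complex.norm_real, Real.norm_of_nonneg (gauss_pos _).le, mul_pow]
  have hi2 : Integrable fun k : Space n =>
      2 * (gauss k * (a + c * (2 * Real.pi * s) ^ 2 * ‖k‖ ^ 2) * ‖h‖ ^ 2) :=
    ((integrable_gauss_mul_add _ _).mul_const _).const_mul 2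
  rw [← integral_add hi1 hi2]
  refine integral_mono (integrable_gauss_sq.mul_const _) (hi1.add hi2) fun k => ?_
  set k' := (2 * Real.pi * s) • k with hk'
  have hn : ‖T * V k' - V k' * T‖ ^ 2 ≤ a + c * (2 * Real.pi * s) ^ 2 * ‖k‖ ^ 2 := by
    refine (hN k').trans_eq ?_
    rw [hk', norm_smul, mul_pow, Real.norm_eq_abs, sq_abs]; ring
  have h1 : ‖T h‖ ≤ ‖T (V k' h)‖ + ‖T * V k' - V k' * T‖ * ‖h‖ := by
    have e : V k' (T h) = T (V k' h) - (T * V k' - V k' * T) h := by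
      simp only [sub_apply, mul_apply_eq_comp]; abel
    rw [← norm_V_apply k' (T h), e]
    exact (norm_sub_le _ _).trans (add_le_add le_rfl (ContinuousLinearMap.le_opNorm _ _))
  have h2 : ‖T h‖ ^ 2 ≤ 2 * ‖T (V k' h)‖ ^ 2 + 2 * (‖T * V k' - V k' * T‖ ^ 2 * ‖h‖ ^ 2) := by
    have h3 := pow_le_pow_left₀ (norm_nonneg _) h1 2
    nlinarith [sq_nonneg (‖T (V k' h)‖ - ‖T * V k' - V k' * T‖ * ‖h‖)]
  have h4 : ‖T * V k' - V k' * T‖ ^ 2 * ‖h‖ ^ 2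
      ≤ (a + c * (2 * Real.pi * s) ^ 2 * ‖k‖ ^ 2) * ‖h‖ ^ 2 := by gcongr
  have h5 : 0 ≤ (a + c * (2 * Real.pi * s) ^ 2 * ‖k‖ ^ 2) * ‖h‖ ^ 2 := by
    refine mul_nonneg ((sq_nonneg _).trans hn) (sq_nonneg _)
  have h6 := gauss_sq_le k
  beta_reduce
  calc gauss k ^ 2 * ‖T h‖ ^ 2 ≤ gauss k ^ 2 * (2 * ‖T (V k' h)‖ ^ 2 +
        2 * ((a + c * (2 * Real.pi * s) ^ 2 * ‖k‖ ^ 2) * ‖h‖ ^ 2)) := by gcongr; linarith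
    _ = 2 * (gauss k ^ 2 * ‖T (V k' h)‖ ^ 2) +
        2 * (gauss k ^ 2 * ((a + c * (2 * Real.pi * s) ^ 2 * ‖k‖ ^ 2) * ‖h‖ ^ 2)) := by ring
    _ ≤ 2 * (gauss k ^ 2 * ‖T (V k' h)‖ ^ 2) +
        2 * (gauss k * ((a + c * (2 * Real.pi * s) ^ 2 * ‖k‖ ^ 2) * ‖h‖ ^ 2)) := by gcongr
    _ = _ := by ring

theorem norm_sq_eq_integral (h : L2 n) : ‖h‖ ^ 2 = ∫ y, ‖h y‖ ^ 2 := by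
  have h1 := inner_eq_integral h h
  rw [inner_self_eq_norm_sq_to_K] at h1
  have h3 : ((‖h‖ ^ 2 : ℝ) : ℂ) = ((∫ x, ‖h x‖ ^ 2 : ℝ) : ℂ) := by
    rw [← integral_complex_ofReal]
    push_cast
    refine h1.trans (integral_congr_ae (ae_of_all _ fun x => ?_))
    simp only [Complex.conj_mul']
  exact_mod_cast h3

theorem integrable_norm_sq (h : L2 n) : Integrable fun y => ‖h y‖ ^ 2 :=
  (memLp_two_iff_integrable_sq_norm (Lp.memLp h).1).1 (Lp.memLp h)

theorem gauss_inv_sqrt_two_smul_sq (z : Space n) : gauss ((√2)⁻¹ • z) ^ 2 = gauss z := by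
  rw [gauss, gauss, ← Real.exp_nat_mul, norm_smul, mul_pow, Real.norm_eq_abs, sq_abs, inv_pow,
    Real.sq_sqrt zero_le_two]
  congr 1
  push_cast
  ring

/-- One factor is spent on making `T` small in norm, the other on keeping `b ↦ ‖M_b h‖²` integrable.
-/
theorem gaussMul_eq_mul (s : ℝ) (b : Space n) : gaussMul s b
    = gaussMul ((√2)⁻¹ * s) ((√2)⁻¹ • b) * gaussMul ((√2)⁻¹ * s) ((√2)⁻¹ • b) := by
  ext y
  rw [BoundedContinuousFunction.mul_apply, gaussMul_apply, gaussMul_apply, mul_smul, ← smul_sub,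
    ← gauss_inv_sqrt_two_smul_sq, sq]
  push_cast
  rfl

/-- The squared multipliers form a continuous partition of unity in `b`, since a translated Gaussian
has integral one; the rest is Tonelli. -/
theorem integral_norm_sq_gaussMul (s : ℝ) (h : L2 n) :
    Integrable (fun b : Space n => ‖mulOp (gaussMul ((√2)⁻¹ * s) ((√2)⁻¹ • b)) h‖ ^ 2) ∧
    ∫ b : Space n, ‖mulOp (gaussMul ((√2)⁻¹ * s) ((√2)⁻¹ • b)) h‖ ^ 2 = ‖h‖ ^ 2 := by
  have e (b : Space n) : ‖mulOp (gaussMul ((√2)⁻¹ * s) ((√2)⁻¹ • b)) h‖ ^ 2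
      = ∫ y, ‖h y‖ ^ 2 * gauss (b - s • y) := by
    rw [norm_sq_eq_integral]
    refine integral_congr_ae ?_
    filter_upwards [coeFn_mulOp (gaussMul ((√2)⁻¹ * s) ((√2)⁻¹ • b)) h] with y hy
    rw [hy, gaussMul_apply, norm_mul, Complex.norm_real, Real.norm_of_nonneg (gauss_pos _).le,
      mul_pow, mul_smul, ← smul_sub, gauss_inv_sqrt_two_smul_sq, ← gauss_neg, neg_sub, mul_comm]
  have hg (y : Space n) : ∫ b, gauss (b - s • y) = 1 := by
    rw [integral_sub_right_eq_self (gauss : Space n → ℝ), integral_gauss]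
  have hi : Integrable (fun p : Space n × Space n => ‖h p.1‖ ^ 2 * gauss (p.2 - s • p.1))
      (volume.prod volume) := by
    refine (integrable_prod_iff ?_).2 ⟨ae_of_all _ fun y => ?_, ?_⟩
    · exact ((integrable_norm_sq h).1.comp_fst).mul
        (continuous_gauss.comp (by fun_prop)).aestronglyMeasurable
    · exact (integrable_gauss.comp_sub_right (s • y)).const_mul (‖h y‖ ^ 2)
    · refine (integrable_norm_sq h).congr (ae_of_all _ fun y => ?_)
      have : ∀ b : Space n, ‖‖h y‖ ^ 2 * gauss (b - s • y)‖ = ‖h y‖ ^ 2 * gauss (b - s • y) :=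
        fun b => Real.norm_of_nonneg (mul_nonneg (sq_nonneg _) (gauss_pos _).le)
      simp only [this, integral_const_mul, hg, mul_one]
  simp_rw [e]
  refine ⟨hi.integral_prod_right, ?_⟩
  rw [← integral_integral_swap (f := fun y b => ‖h y‖ ^ 2 * gauss (b - s • y)) hi,
    norm_sq_eq_integral]
  simp only [integral_const_mul, hg, mul_one]

/-- For bounded `b` the Gaussian at `s • y - b` confines `y` to a bounded region up to Gaussian
tails, where `1 - gauss (r • y) ≤ π r² |y|²` is small. -/
theorem norm_mulOp_gaussMul_sub_le {s : ℝ} (hs : 0 < s) {B : ℝ} {b : Space n} (hb : ‖b‖ ≤ B)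
    (r : ℝ) : ‖mulOp (gaussMul s b) * (1 - gaussOp n r)‖
      ≤ Real.pi * ((2 + 2 * B ^ 2) / s ^ 2) * r ^ 2 := by
  have e : mulOp (gaussMul s b) * (1 - gaussOp n r)
      = mulOp (gaussMul s b * (1 - gaussMul r 0)) := by
    rw [mulOp_mul, mulOp_sub, mulOp_one]; rfl
  rw [e]
  refine (norm_mulOp_le _).trans ((BoundedContinuousFunction.norm_le (by positivity)).2
    fun y => ?_)
  rw [BoundedContinuousFunction.mul_apply, BoundedContinuousFunction.sub_apply, gaussMul_apply,
    gaussMul_apply, sub_zero, BoundedContinuousFunction.coe_one, Pi.one_apply,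
    ← Complex.ofReal_one, ← Complex.ofReal_sub, ← Complex.ofReal_mul, Complex.norm_real,
    Real.norm_of_nonneg (mul_nonneg (gauss_pos _).le (sub_nonneg.2 (gauss_le_one _)))]
  have h1 : 1 - gauss (r • y) ≤ Real.pi * r ^ 2 * ‖y‖ ^ 2 := by
    have h3 := Real.add_one_le_exp (-Real.pi * ‖r • y‖ ^ 2)
    rw [gauss]
    rw [norm_smul, mul_pow, Real.norm_eq_abs, sq_abs] at h3 ⊢
    linarith
  have h2 : gauss (s • y - b) * ‖s • y - b‖ ^ 2 ≤ 1 := by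
    set q := ‖s • y - b‖ ^ 2 with hq
    have hq0 : 0 ≤ q := sq_nonneg _
    have h3 : q ≤ Real.exp (Real.pi * q) := by
      have := Real.add_one_le_exp (Real.pi * q)
      nlinarith [Real.pi_gt_three]
    rw [gauss, ← hq, neg_mul, Real.exp_neg, mul_comm, ← div_eq_mul_inv]
    exact div_le_one_of_le₀ h3 (Real.exp_pos _).le
  have h4 : s ^ 2 * ‖y‖ ^ 2 ≤ 2 * ‖s • y - b‖ ^ 2 + 2 * B ^ 2 := by
    have h5 : s * ‖y‖ ≤ ‖s • y - b‖ + B := by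
      have h6 : ‖s • y‖ = s * ‖y‖ := by rw [norm_smul, Real.norm_of_nonneg hs.le]
      have := norm_add_le (s • y - b) b
      rw [sub_add_cancel, h6] at this
      linarith
    have h7 : 0 ≤ s * ‖y‖ := by positivity
    nlinarith [sq_nonneg (‖s • y - b‖ - B)]
  have h5 : gauss (s • y - b) * ‖y‖ ^ 2 ≤ (2 + 2 * B ^ 2) / s ^ 2 := by
    rw [le_div_iff₀ (by positivity)]
    have h6 := mul_le_mul_of_nonneg_left h4 (gauss_pos (s • y - b)).le
    have h7 := mul_le_mul_of_nonneg_right (gauss_le_one (s • y - b)) (sq_nonneg B)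
    nlinarith
  calc gauss (s • y - b) * (1 - gauss (r • y))
      ≤ gauss (s • y - b) * (Real.pi * r ^ 2 * ‖y‖ ^ 2) := by
        gcongr
        exact (gauss_pos _).le
    _ = Real.pi * (gauss (s • y - b) * ‖y‖ ^ 2) * r ^ 2 := by ring
    _ ≤ _ := by gcongr

/-- Translating back, `‖T M_{sx}‖ = ‖T_x g(sQ)‖`. This tends to zero along every ultrafilter at
infinity, hence along the whole filter. -/
theorem exists_norm_mul_gaussMul_le {T : L2 n →L[ℂ] L2 n} (hT : T ∈ algC n)
    (h0 : ∀ l : Ultrafilter (Space n), (l : Filter (Space n)) ≤ cocompact _ →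
      WeakTendsto (translate T) l 0) {s : ℝ} (hs : 0 < s) {ε : ℝ} (hε : 0 < ε) :
    ∃ B : ℝ, ∀ b : Space n, B < ‖b‖ → ‖T * mulOp (gaussMul s b)‖ ≤ ε := by
  have h1 : Tendsto (fun x => ‖translate T x * gaussOp n s‖) (cocompact (Space n)) (𝓝 0) := by
    refine tendsto_iff_ultrafilter _ _ _ |>.2 fun l hl => ?_
    have := tendsto_norm_translate_sub_mul hT (h0 l hl) (gaussZero hs.ne' 0)
    simp only [sub_zero] at this
    exact this
  have h2 := h1.eventually_le_const hε
  rw [← Metric.cobounded_eq_cocompact, ← comap_norm_atTop] at h2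
  obtain ⟨B, -, hB⟩ := (atTop_basis_Ioi.comap _).eventually_iff.1 h2
  refine ⟨s * B, fun b hb => ?_⟩
  have h3 : B < ‖s⁻¹ • b‖ := by
    rw [norm_smul, norm_inv, Real.norm_of_nonneg hs.le, inv_mul_eq_div, lt_div_iff₀ hs, mul_comm]
    exact hb
  have h4 := hB h3
  rwa [norm_translate_mul_gaussOp, smul_inv_smul₀ hs.ne'] at h4

/-- An element of `𝒞(ℝⁿ)` all of whose localizations at infinity vanish is compact. -/
theorem isCompactOperator_of_weakTendsto_zero {T : L2 n →L[ℂ] L2 n} (hT : T ∈ algC n)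
    (h0 : ∀ l : Ultrafilter (Space n), (l : Filter (Space n)) ≤ cocompact _ →
      WeakTendsto (translate T) l 0) : IsCompactOperator T := by
  refine isCompactOperator_of_forall_exists_norm_sub_le fun δ hδ => ?_
  have hN : 0 < ∫ v : Space n, gauss v ^ 2 := integral_gauss_sq_pos
  set N : ℝ := ∫ v : Space n, gauss v ^ 2 with hNdef
  -- The errors add up to `2(4η + η) + 2(2η · 4) = 26 η` times `‖f‖²`; the factors `4` come from
  -- `‖h‖ ≤ 2‖f‖`.
  set η : ℝ := N * δ ^ 2 / 26 with hη
  have hη0 : 0 < η := by positivity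
  obtain ⟨c, -, hc⟩ := exists_le_add_mul_norm_sq
    (N := fun k : Space n => ‖T * V k - V k * T‖ ^ 2) (B := (2 * ‖T‖) ^ 2)
    (fun k => by gcongr; exact norm_comm_V_le T k) (by simpa using hT.1.pow 2) hη0
  obtain ⟨s, hs, hs'⟩ := exists_add_mul_sq_le (c := c * (2 * Real.pi) ^ 2 * gaussMoment n) hη0
  have h2 : 0 < (√2)⁻¹ := by positivity
  obtain ⟨B₀, hB₀⟩ := exists_norm_mul_gaussMul_le hT h0 (mul_pos h2 hs) (Real.sqrt_pos.2 hη0)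
  -- The square-root Gaussian is centred at `b / √2`, so its threshold `B₀` becomes `√2 B₀` for `b`.
  set B : ℝ := √2 * B₀ with hB
  set D : ℝ := ‖T‖ * (Real.pi * ((2 + 2 * B ^ 2) / s ^ 2)) with hD
  set vol : ℝ := volume.real (Metric.closedBall (0 : Space n) B) with hvol
  obtain ⟨r₀, hr₀, hr'⟩ := exists_add_mul_sq_le (c := vol * D ^ 2) hη0
  -- The cap at `1` allows the quartic quantity in `r` to be bounded by a quadratic one.
  set r : ℝ := min r₀ 1 with hr
  have hr0 : 0 < r := lt_min hr₀ one_pos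
  have hr1 : vol * (D * r ^ 2) ^ 2 ≤ η := by
    have h3 := hr' r (by rw [abs_of_pos hr0]; exact min_le_left _ _)
    have h4 : r ^ 2 ≤ 1 := pow_le_one₀ hr0.le (min_le_right _ _)
    calc vol * (D * r ^ 2) ^ 2 = vol * D ^ 2 * r ^ 2 * r ^ 2 := by ring
      _ ≤ vol * D ^ 2 * r ^ 2 * 1 := by gcongr
      _ ≤ η := by rw [mul_one]; exact h3
  refine ⟨T * gaussOp n r, isCompactOperator_mul_gaussOp hT hr0.ne', ?_⟩
  refine ContinuousLinearMap.opNorm_le_bound _ hδ.le fun f => ?_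
  set h : L2 n := (1 - gaussOp n r) f with hh
  have e1 : (T - T * gaussOp n r) f = T h := by
    simp [hh]
  have e2 : ‖h‖ ≤ 2 * ‖f‖ := by
    refine (norm_sub_le _ _).trans ?_
    rw [two_mul]
    refine add_le_add le_rfl ?_
    exact ((gaussOp n r).le_of_opNorm_le (norm_gaussOp_le r) f).trans_eq (one_mul _)
  have e2' : ‖h‖ ^ 2 ≤ 4 * ‖f‖ ^ 2 := by
    calc ‖h‖ ^ 2 ≤ (2 * ‖f‖) ^ 2 := by gcongr
      _ = _ := by ring
  have e3 := norm_sq_le_integral hc s h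
  have e4 : ∫ b : Space n, ‖T (mulOp (gaussMul s b) h)‖ ^ 2
      ≤ η * ‖h‖ ^ 2 + vol * ((D * r ^ 2) * ‖f‖) ^ 2 := by
    obtain ⟨i1, i2⟩ := integral_norm_sq_gaussMul s h
    have i3 : Integrable ((Metric.closedBall (0 : Space n) B).indicator
        fun _ => ((D * r ^ 2) * ‖f‖) ^ 2) :=
      (integrable_indicator_iff Metric.isClosed_closedBall.measurableSet).2
        (integrableOn_const measure_closedBall_lt_top.ne)
    have i4 : ∫ b : Space n, (Metric.closedBall (0 : Space n) B).indicator
        (fun _ => ((D * r ^ 2) * ‖f‖) ^ 2) b = vol * ((D * r ^ 2) * ‖f‖) ^ 2 := by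
      rw [integral_indicator Metric.isClosed_closedBall.measurableSet, setIntegral_const,
        smul_eq_mul]
    rw [← i2, ← i4, ← integral_const_mul, ← integral_add (i1.const_mul _) i3]
    refine integral_mono (integral_norm_sq_mul_gaussMul T s h).1 ((i1.const_mul _).add i3)
      fun b => ?_
    beta_reduce
    -- For `b` in the ball, `M_b (1 - g(rQ))` is small and the ball has finite volume. For `b`
    -- outside, vanishing at infinity gives `√η` for one square-root Gaussian and the partition of
    -- unity integrates the other.
    by_cases hb : ‖b‖ ≤ B
    · rw [Set.indicator_of_mem (by simpa using hb)]
      refine le_add_of_nonneg_of_le (by positivity) ?_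
      gcongr
      have h5 : T (mulOp (gaussMul s b) h) = T ((mulOp (gaussMul s b) * (1 - gaussOp n r)) f) := rfl
      rw [h5, hD, mul_assoc, mul_assoc]
      refine T.le_opNorm_of_le ?_
      rw [← mul_assoc]
      exact ContinuousLinearMap.le_of_opNorm_le _ (norm_mulOp_gaussMul_sub_le hs hb r) f
    · rw [Set.indicator_of_notMem (by simpa using hb), add_zero]
      have h5 : B₀ < ‖(√2)⁻¹ • b‖ := by
        rw [norm_smul, Real.norm_of_nonneg h2.le, inv_mul_eq_div, lt_div_iff₀ (by positivity),
          mul_comm]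
        exact not_le.1 hb
      have h6 := hB₀ _ h5
      rw [gaussMul_eq_mul s b, mulOp_mul, mul_apply_eq_comp]
      calc _ ≤ (√η * ‖mulOp (gaussMul ((√2)⁻¹ * s) ((√2)⁻¹ • b)) h‖) ^ 2 := by
            gcongr
            exact ContinuousLinearMap.le_of_opNorm_le
              (T * mulOp (gaussMul ((√2)⁻¹ * s) ((√2)⁻¹ • b))) h6 _
        _ = _ := by rw [mul_pow, Real.sq_sqrt hη0.le]
  have e5 := hs' s (abs_of_pos hs).le
  have e6 : N * ‖T h‖ ^ 2 ≤ N * (δ * ‖f‖) ^ 2 := by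
    have f1 : vol * ((D * r ^ 2) * ‖f‖) ^ 2 ≤ η * ‖f‖ ^ 2 := by
      rw [mul_pow, ← mul_assoc]; gcongr
    have f2 : (η + c * (2 * Real.pi * s) ^ 2 * gaussMoment n) * ‖h‖ ^ 2
        ≤ (2 * η) * (4 * ‖f‖ ^ 2) := by
      gcongr
      calc η + c * (2 * Real.pi * s) ^ 2 * gaussMoment n
          = η + c * (2 * Real.pi) ^ 2 * gaussMoment n * s ^ 2 := by ring
        _ ≤ 2 * η := by linarith
    have f3 : η * ‖h‖ ^ 2 ≤ η * (4 * ‖f‖ ^ 2) := by gcongr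
    have f4 : N * (δ * ‖f‖) ^ 2 = 26 * η * ‖f‖ ^ 2 := by rw [hη]; ring
    rw [f4]
    linarith
  rw [e1]
  exact abs_le_of_sq_le_sq' (le_of_mul_le_mul_left e6 hN) (by positivity) |>.2

/-! ### Localized observables and the essential spectrum -/

theorem weakTendsto_choose (T : L2 n →L[ℂ] L2 n) (l : Ultrafilter (Space n)) :
    WeakTendsto (translate T) l
      (exists_weakTendsto l fun x => (norm_translate T x).le).choose :=
  (exists_weakTendsto l fun x => (norm_translate T x).le).choose_spec

/-- The localization at infinity of an affiliated observable along an ultrafilter. -/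
def Observable.localization {Φ : Observable n} (hΦ : Φ.Affiliated)
    (l : Ultrafilter (Space n)) : Observable n where
  toFun φ := (exists_weakTendsto l fun x => (norm_translate (Φ φ) x).le).choose
  map_smul' c φ := by
    refine (weakTendsto_choose _ _).unique ?_
    have := (weakTendsto_choose (Φ φ) l).smul c
    rw [map_smul]
    simpa only [← translate_smul, MonoidHom.id_apply] using this
  map_zero' := by
    refine (weakTendsto_choose _ _).unique fun u v => ?_
    simp [translate]
  map_add' φ ψ := by
    refine (weakTendsto_choose _ _).unique ?_
    have := (weakTendsto_choose (Φ φ) l).add (weakTendsto_choose (Φ ψ) l)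
    rw [map_add]
    simpa only [← translate_add] using this
  map_mul' φ ψ := by
    refine (weakTendsto_choose _ _).unique ?_
    rw [map_mul]
    exact weakTendsto_translate_mul (hΦ ψ) (weakTendsto_choose (Φ φ) l)
      (weakTendsto_choose (Φ ψ) l)
  map_star' φ := by
    refine (weakTendsto_choose _ _).unique ?_
    have := (weakTendsto_choose (Φ φ) l).star
    rw [map_star]
    simpa only [star_translate] using this

theorem weakTendsto_localization {Φ : Observable n} (hΦ : Φ.Affiliated)
    (l : Ultrafilter (Space n)) (φ : C₀(ℝ, ℂ)) :
    WeakTendsto (translate (Φ φ)) l (Observable.localization hΦ l φ) :=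
  weakTendsto_choose (Φ φ) l

/-- The kernel of an observable contains every compactly supported function whose support is
covered by the nonvanishing sets of elements of the kernel. -/
theorem Observable.apply_eq_zero (Φ : Observable n) {K : Set ℝ} (hK : IsCompact K)
    (hψ : ∀ t ∈ K, ∃ ψ : C₀(ℝ, ℂ), ψ t ≠ 0 ∧ Φ ψ = 0) {φ : C₀(ℝ, ℂ)} (hφ : ∀ t ∉ K, φ t = 0) :
    Φ φ = 0 := by
  choose! ψ h1 h2 using hψ
  -- Finitely many `|ψ_t|²` sum to an element `g` of the kernel that is strictly positive on `K`.
  -- Then `φ` is a multiple of `g`; the maximum with the lower bound `m` keeps the quotient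
  -- continuous off `K`, where `φ` vanishes anyway.
  obtain ⟨s, hsK, hs⟩ := hK.elim_nhds_subcover (fun t => {x | ψ t x ≠ 0}) fun t ht =>
    (isOpen_ne_fun (ψ t).continuous continuous_const).mem_nhds (h1 t ht)
  set g : C₀(ℝ, ℂ) := ∑ t ∈ s, star (ψ t) * ψ t with hg
  have hg0 : Φ g = 0 := by
    rw [hg, map_sum]
    exact Finset.sum_eq_zero fun t ht => by rw [map_mul, h2 t (hsK t ht), mul_zero]
  have hgx (x : ℝ) : g x = ((∑ t ∈ s, ‖ψ t x‖ ^ 2 : ℝ) : ℂ) := by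
    have : g x = ∑ t ∈ s, (star (ψ t) * ψ t) x := by
      rw [hg]
      exact map_sum (⟨⟨fun f : C₀(ℝ, ℂ) => f x, rfl⟩, fun _ _ => rfl⟩ : C₀(ℝ, ℂ) →+ ℂ) _ s
    rw [this, Complex.ofReal_sum]
    refine Finset.sum_congr rfl fun t _ => ?_
    rw [ZeroAtInftyContinuousMap.mul_apply, ZeroAtInftyContinuousMap.star_apply,
      Complex.ofReal_pow]
    exact Complex.conj_mul' _
  set G : ℝ → ℝ := fun x => ∑ t ∈ s, ‖ψ t x‖ ^ 2 with hG
  have hGc : Continuous G := continuous_finsetSum _ fun t _ => (ψ t).continuous.norm.pow 2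
  obtain ⟨m, hm, hmK⟩ := hK.exists_forall_le' hGc.continuousOn (a := 0) fun x hx => by
    obtain ⟨t, hts, hxt⟩ := Set.mem_iUnion₂.1 (hs hx)
    exact Finset.sum_pos' (fun _ _ => by positivity) ⟨t, hts, by
      have : ψ t x ≠ 0 := hxt
      positivity⟩
  have hpos (x : ℝ) : 0 < max (G x) m := lt_max_of_lt_right hm
  have hcont : Continuous fun x => φ x * (((max (G x) m)⁻¹ : ℝ) : ℂ) :=
    φ.continuous.mul (Complex.continuous_ofReal.comp
      ((hGc.max continuous_const).inv₀ fun x => (hpos x).ne'))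
  let h : C₀(ℝ, ℂ) := ⟨⟨fun x => φ x * (((max (G x) m)⁻¹ : ℝ) : ℂ), hcont⟩, by
    have := (φ.zero_at_infty'.norm).mul_const (m⁻¹)
    rw [norm_zero, zero_mul] at this
    refine squeeze_zero_norm (fun x => ?_) this
    rw [norm_mul, Complex.norm_real, Real.norm_of_nonneg (inv_nonneg.2 (hpos x).le)]
    gcongr
    · rfl
    · exact le_max_right _ _⟩
  have e : φ = h * g := by
    ext x
    rw [ZeroAtInftyContinuousMap.mul_apply, hgx]
    change φ x = φ x * (((max (G x) m)⁻¹ : ℝ) : ℂ) * (G x : ℂ)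
    by_cases hx : x ∈ K
    · rw [max_eq_left (hmK x hx), mul_assoc, ← Complex.ofReal_mul,
        inv_mul_cancel₀ (hm.trans_le (hmK x hx)).ne', Complex.ofReal_one, mul_one]
    · rw [hφ x hx, zero_mul, zero_mul]
  rw [e, map_mul, hg0, mul_zero]

/-- Compactness of `φ(H)` is equivalent to `φ(ϰ.H) = 0` for all `ϰ` simultaneously. The closure is
needed because a single `φ` must work for every `ϰ`: a point at positive distance from the union
admits a common bump function, a point in the closure does not. -/
theorem Observable.essSpectrum_eq {Φ : Observable n} (hΦ : Φ.Affiliated) :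
    Φ.essSpectrum
      = closure (⋃ ϰ : UltraInfty n, (Observable.localization hΦ ϰ.1).spectrum) := by
  refine subset_antisymm (fun t ht => ?_) fun t ht φ hφ hc => ?_
  · by_contra hcl
    rw [Metric.mem_closure_iff] at hcl
    push Not at hcl
    obtain ⟨r, hr, hr'⟩ := hcl
    -- A tent of radius `r / 2` around `t`. Its closed support ball lies strictly inside the ball of
    -- radius `r` missed by every localized spectrum.
    let φ : C₀(ℝ, ℂ) := ⟨⟨fun x => ((max 0 (r / 2 - dist t x) : ℝ) : ℂ), by fun_prop⟩, by
      refine tendsto_const_nhds.congr' ?_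
      have := (isCompact_closedBall t (r / 2)).compl_mem_cocompact
      filter_upwards [this] with x hx
      have hx' : r / 2 < dist t x := by simpa [dist_comm] using hx
      change (0 : ℂ) = ((max 0 (r / 2 - dist t x) : ℝ) : ℂ)
      rw [max_eq_left (by linarith), Complex.ofReal_zero]⟩
    have hφx (x : ℝ) : φ x = ((max 0 (r / 2 - dist t x) : ℝ) : ℂ) := rfl
    refine ht φ ?_ ⟨hΦ φ, isCompactOperator_of_weakTendsto_zero (hΦ φ) fun l hl => ?_⟩
    · rw [hφx, dist_self, sub_zero, max_eq_right (by positivity)]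
      exact_mod_cast (half_pos hr).ne'
    · have := weakTendsto_localization hΦ l φ
      rwa [Observable.apply_eq_zero (Observable.localization hΦ l) (isCompact_closedBall t (r / 2)) (fun x hx => ?_)
        fun x hx => ?_] at this
      · have hx' : x ∉ (Observable.localization hΦ l).spectrum := fun hxs => by
          have h1 := hr' x (Set.mem_iUnion.2 ⟨⟨l, hl⟩, hxs⟩)
          rw [Metric.mem_closedBall, dist_comm] at hx
          linarith
        simp only [Observable.spectrum, Set.mem_ofPred_eq] at hx'
        push Not at hx'
        exact hx'
      · have hx' : r / 2 < dist t x := by simpa [dist_comm] using hx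
        rw [hφx, max_eq_left (by linarith), Complex.ofReal_zero]
  -- The set where `φ` is nonzero is open and contains `t`, so it meets some localized spectrum, and
  -- there `φ(ϰ.H) ≠ 0`; a compact `φ(H)` would localize to zero.
  · obtain ⟨x, hx, hxs⟩ := mem_closure_iff.1 ht _ (isOpen_ne_fun φ.continuous continuous_const) hφ
    obtain ⟨ϰ, hϰ⟩ := Set.mem_iUnion.1 hxs
    exact hϰ φ hx ((weakTendsto_localization hΦ ϰ.1 φ).unique (weakTendsto_translate_zero hc.2 ϰ.2))

theorem Observable.exists_localization {Φ : Observable n} (hΦ : Φ.Affiliated) :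
    ∃ L : UltraInfty n → Observable n,
      (∀ ϰ : UltraInfty n, (L ϰ).Affiliated ∧ IsLocalizationAt Φ ϰ (L ϰ)) ∧
      Φ.essSpectrum = closure (⋃ ϰ : UltraInfty n, (L ϰ).spectrum) :=
  ⟨fun ϰ => Observable.localization hΦ ϰ.1, fun ϰ =>
    ⟨fun φ => weakLimit_mem_algC (hΦ φ) (weakTendsto_localization hΦ ϰ.1 φ),
      fun φ => tendstoCs_of_weakTendsto (hΦ φ) (weakTendsto_localization hΦ ϰ.1 φ)⟩,
    Observable.essSpectrum_eq hΦ⟩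

/-! ### `𝒞(ℝⁿ)` is a closed `*`-algebra -/

theorem isClosed_setOf_tendsto_zero {α E : Type*} [SeminormedAddCommGroup E] {l : Filter α}
    {N : α → E → ℝ} (h0 : ∀ x T, 0 ≤ N x T) (h : ∀ x T S, N x T ≤ N x S + 2 * ‖T - S‖) :
    IsClosed {T | Tendsto (fun x => N x T) l (𝓝 0)} := by
  refine isClosed_of_closure_subset fun T hT => Metric.tendsto_nhds.2 fun ε hε => ?_
  obtain ⟨S, hS, hTS⟩ := Metric.mem_closure_iff.1 hT (ε / 4) (by positivity)
  rw [dist_eq_norm] at hTS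
  filter_upwards [Metric.tendsto_nhds.1 hS (ε / 2) (by positivity)] with x hx
  rw [dist_zero_right, Real.norm_of_nonneg (h0 _ _)] at hx ⊢
  linarith [h x T S]

theorem norm_U_sub_one_mul_sub_le (T S : L2 n →L[ℂ] L2 n) (x : Space n) :
    ‖(U x - 1) * T‖ ≤ ‖(U x - 1) * S‖ + 2 * ‖T - S‖ := by
  have h := norm_U_sub_one_mul_le (T - S) x
  rw [mul_sub] at h
  linarith [norm_le_norm_add_norm_sub' ((U x - 1) * T) ((U x - 1) * S)]

theorem norm_comm_V_sub_le (T S : L2 n →L[ℂ] L2 n) (k : Space n) :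
    ‖T * V k - V k * T‖ ≤ ‖S * V k - V k * S‖ + 2 * ‖T - S‖ := by
  have h := norm_comm_V_le (T - S) k
  rw [sub_mul, mul_sub, sub_sub_sub_comm] at h
  linarith [norm_le_norm_add_norm_sub' (T * V k - V k * T) (S * V k - V k * S)]

theorem isClosed_algC : IsClosed (algC n) := by
  have h2 := isClosed_setOf_tendsto_zero (l := 𝓝 (0 : Space n))
    (N := fun x (T : L2 n →L[ℂ] L2 n) => ‖(U x - 1) * T‖) (fun _ _ => norm_nonneg _)
    fun x T S => norm_U_sub_one_mul_sub_le T S x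
  refine IsClosed.inter (isClosed_setOf_tendsto_zero
    (N := fun k (T : L2 n →L[ℂ] L2 n) => ‖T * V k - V k * T‖) (fun _ _ => norm_nonneg _)
    fun x T S => norm_comm_V_sub_le T S x) (IsClosed.inter h2 ?_)
  exact h2.preimage (continuous_star (R := L2 n →L[ℂ] L2 n))

theorem mul_mem_algC {T S : L2 n →L[ℂ] L2 n} (hT : T ∈ algC n) (hS : S ∈ algC n) :
    T * S ∈ algC n := by
  have aux {A B : L2 n →L[ℂ] L2 n}
      (h : Tendsto (fun x : Space n => ‖(U x - 1) * A‖) (𝓝 0) (𝓝 0)) :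
      Tendsto (fun x : Space n => ‖(U x - 1) * (A * B)‖) (𝓝 0) (𝓝 0) := by
    have h' := h.mul_const ‖B‖
    rw [zero_mul] at h'
    refine squeeze_zero (fun _ => norm_nonneg _) (fun x => ?_) h'
    rw [← mul_assoc]
    exact norm_mul_le _ _
  refine ⟨?_, aux hT.2.1, by rw [star_mul]; exact aux hS.2.2⟩
  have h' := (hS.1.const_mul ‖T‖).add (hT.1.mul_const ‖S‖)
  rw [mul_zero, zero_mul, add_zero] at h'
  refine squeeze_zero (fun _ => norm_nonneg _) (fun k => ?_) h'
  have e : T * S * V k - V k * (T * S) = T * (S * V k - V k * S) + (T * V k - V k * T) * S := by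
    simp only [mul_sub, sub_mul, mul_assoc]; abel
  rw [e]
  exact (norm_add_le _ _).trans (add_le_add (norm_mul_le _ _) (norm_mul_le _ _))

theorem add_mem_algC {T S : L2 n →L[ℂ] L2 n} (hT : T ∈ algC n) (hS : S ∈ algC n) :
    T + S ∈ algC n := by
  have aux {A B : L2 n →L[ℂ] L2 n}
      (h : Tendsto (fun x : Space n => ‖(U x - 1) * A‖) (𝓝 0) (𝓝 0))
      (h' : Tendsto (fun x : Space n => ‖(U x - 1) * B‖) (𝓝 0) (𝓝 0)) :
      Tendsto (fun x : Space n => ‖(U x - 1) * (A + B)‖) (𝓝 0) (𝓝 0) := by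
    have h2 := h.add h'
    rw [zero_add] at h2
    refine squeeze_zero (fun _ => norm_nonneg _) (fun x => ?_) h2
    rw [mul_add]
    exact norm_add_le _ _
  refine ⟨?_, aux hT.2.1 hS.2.1, by rw [star_add]; exact aux hT.2.2 hS.2.2⟩
  have h2 := hT.1.add hS.1
  rw [zero_add] at h2
  refine squeeze_zero (fun _ => norm_nonneg _) (fun k => ?_) h2
  rw [add_mul, mul_add, add_sub_add_comm]
  exact norm_add_le _ _

theorem smul_mem_algC (c : ℂ) {T : L2 n →L[ℂ] L2 n} (hT : T ∈ algC n) : c • T ∈ algC n := by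
  have aux (c : ℂ) {A : L2 n →L[ℂ] L2 n}
      (h : Tendsto (fun x : Space n => ‖(U x - 1) * A‖) (𝓝 0) (𝓝 0)) :
      Tendsto (fun x : Space n => ‖(U x - 1) * (c • A)‖) (𝓝 0) (𝓝 0) := by
    simpa only [mul_smul_comm, norm_smul, mul_zero] using h.const_mul ‖c‖
  refine ⟨?_, aux c hT.2.1, by rw [star_smul]; exact aux _ hT.2.2⟩
  simpa only [mul_smul_comm, smul_mul_assoc, ← smul_sub, norm_smul, mul_zero]
    using hT.1.const_mul ‖c‖

/-- `𝒞(ℝⁿ)` as a `*`-algebra. -/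
def starAlgC (n : ℕ) : NonUnitalStarSubalgebra ℂ (L2 n →L[ℂ] L2 n) where
  carrier := algC n
  add_mem' := add_mem_algC
  zero_mem' := by simp [algC]
  mul_mem' := mul_mem_algC
  smul_mem' c _ hT := smul_mem_algC c hT
  star_mem' := star_mem_algC

/-! ### Functional calculus of an operator given through a bounded inverse -/

/-- The function `φ(1/s - c)` of `s = re z`, extended by `0` at `s = 0`. -/
def invFun (c : ℝ) (φ : C₀(ℝ, ℂ)) (z : ℂ) : ℂ := if z.re = 0 then 0 else φ (z.re⁻¹ - c)

theorem invFun_zero (c : ℝ) (φ : C₀(ℝ, ℂ)) : invFun c φ 0 = 0 := if_pos rfl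

/-- At `s = 0` the argument `1/s - c` escapes to infinity, where `φ` tends to zero, so the value `0`
is the continuous one. -/
theorem continuous_invFun (c : ℝ) (φ : C₀(ℝ, ℂ)) : Continuous (invFun c φ) := by
  have h : Continuous fun s : ℝ => if s = 0 then (0 : ℂ) else φ (s⁻¹ - c) := by
    refine continuous_iff_continuousAt.2 fun s => ?_
    by_cases hs : s = 0
    · subst hs
      rw [continuousAt_iff_punctured_nhds, if_pos rfl]
      have h1 : Tendsto (fun s : ℝ => s⁻¹ - c) (𝓝[≠] 0) (cocompact ℝ) := by
        have := (Homeomorph.subRight c).isClosedEmbedding.tendsto_cocompact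
        rw [← Metric.cobounded_eq_cocompact] at this ⊢
        exact this.comp tendsto_inv₀_nhdsNE_zero
      refine (φ.zero_at_infty'.comp h1).congr' ?_
      filter_upwards [self_mem_nhdsWithin] with s hs
      exact (if_neg (Set.mem_compl_singleton_iff.1 hs)).symm
    · have h1 : ContinuousAt (fun s : ℝ => φ (s⁻¹ - c)) s :=
        φ.continuous.continuousAt.comp ((continuousAt_inv₀ hs).sub continuousAt_const)
      refine h1.congr ?_
      filter_upwards [isOpen_ne.mem_nhds hs] with r hr
      rw [if_neg hr]
  exact h.comp Complex.continuous_re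

/-- The functional calculus of the self-adjoint operator `R⁻¹ - c`, for `R` bounded, self-adjoint
and injective. -/
def invObservable (R : L2 n →L[ℂ] L2 n) (c : ℝ) : Observable n where
  -- For non-normal `R` the calculus returns `0` by default, so the morphism laws need no hypothesis
  -- on `R`.
  toFun φ := cfcₙ (invFun c φ) R
  map_smul' a φ := by
    rw [MonoidHom.id_apply, ← cfcₙ_smul a _ R (continuous_invFun c φ).continuousOn
      (invFun_zero c φ)]
    congr 1
    ext z
    simp only [invFun]
    split_ifs <;> simp
  map_zero' := by
    rw [← cfcₙ_zero ℂ R]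
    congr 1
    ext z
    simp [invFun]
  map_add' φ ψ := by
    rw [← cfcₙ_add _ _ R (continuous_invFun c φ).continuousOn (invFun_zero c φ)
      (continuous_invFun c ψ).continuousOn (invFun_zero c ψ)]
    congr 1
    ext z
    simp only [invFun]
    split_ifs <;> simp
  map_mul' φ ψ := by
    rw [← cfcₙ_mul _ _ R (continuous_invFun c φ).continuousOn (invFun_zero c φ)
      (continuous_invFun c ψ).continuousOn (invFun_zero c ψ)]
    congr 1
    ext z
    simp only [invFun]
    split_ifs <;> simp
  map_star' φ := by
    rw [← cfcₙ_star]
    congr 1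
    ext z
    simp only [invFun]
    split_ifs <;> simp

theorem invObservable_apply (R : L2 n →L[ℂ] L2 n) (c : ℝ) (φ : C₀(ℝ, ℂ)) : invObservable R c φ = cfcₙ (invFun c φ) R := rfl

theorem affiliated_invObservable {R : L2 n →L[ℂ] L2 n} (hRC : R ∈ algC n) (c : ℝ) : (invObservable R c).Affiliated := fun φ => by
  have : IsClosed (starAlgC n : Set (L2 n →L[ℂ] L2 n)) := isClosed_algC
  exact cfcₙ_mem (𝕜' := ℂ) (s := starAlgC n) (invFun c φ) hRC

/-- On the real spectrum the function is `s / (1 - (c + z) s)`, which satisfies `g = s + (c + z) g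
s`: the resolvent identity between `-c` and `z`. Both orders are kept, one for each side of the
inverse. -/
theorem invObservable_resolventFun {R : L2 n →L[ℂ] L2 n} (hR : IsSelfAdjoint R) (c : ℝ) {z : ℂ}
    (hz : z.im ≠ 0) :
    invObservable R c (resolventFun z hz)
        = R + (c + z) • (invObservable R c (resolventFun z hz) * R) ∧
      invObservable R c (resolventFun z hz)
        = R + (c + z) • (R * invObservable R c (resolventFun z hz)) := by
  have hn : IsStarNormal R := hR.isStarNormal
  set g := invFun c (resolventFun z hz) with hg
  have hgc : ContinuousOn g (quasispectrum ℂ R) := (continuous_invFun c _).continuousOn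
  have hg0 : g 0 = 0 := invFun_zero c _
  have h1 : cfcₙ g R = cfcₙ (fun x : ℂ => x + (c + z) * (g x * x)) R := by
    refine cfcₙ_congr fun x hx => ?_
    obtain ⟨s, rfl⟩ : ∃ s : ℝ, x = s := by
      rw [quasispectrum_eq_spectrum_union_zero] at hx
      rcases hx with hx | hx
      · exact ⟨_, hR.mem_spectrum_eq_re hx⟩
      · exact ⟨0, by rw [Set.mem_singleton_iff.1 hx, Complex.ofReal_zero]⟩
    have hgx : g s = if s = 0 then 0 else (((s⁻¹ - c : ℝ) : ℂ) - z)⁻¹ := rfl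
    rw [hgx]
    split_ifs with h
    · rw [h]; simp
    · have h2 : ((s⁻¹ - c : ℝ) : ℂ) - z ≠ 0 := fun h => hz (by
        have := congrArg Complex.im h
        simpa using this)
      have h3 : (s : ℂ) ≠ 0 := by exact_mod_cast h
      have h4 : (((s⁻¹ - c : ℝ) : ℂ) - z) * s = 1 - (c + z) * s := by
        push_cast
        field_simp
        ring
      generalize ((s⁻¹ - c : ℝ) : ℂ) - z = d at h2 h4
      field_simp
      linear_combination -h4
  have h2 : cfcₙ g R = R + ((c : ℂ) + z) • (cfcₙ g R * R) := by
    conv_lhs => rw [h1]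
    rw [cfcₙ_add (fun x : ℂ => x) (fun x => (c + z) * (g x * x)) R continuousOn_id rfl
      (by fun_prop) (by simp), cfcₙ_id' ℂ R,
      cfcₙ_const_mul _ (fun x => g x * x) R (hgc.mul continuousOn_id) (by simp),
      cfcₙ_mul g (fun x => x) R hgc hg0 continuousOn_id rfl, cfcₙ_id' ℂ R]
  have h3 : Commute (cfcₙ g R) R := by
    have := cfcₙ_commute_cfcₙ g (fun x : ℂ => x) R
    rwa [cfcₙ_id' ℂ R] at this
  refine ⟨h2, ?_⟩
  rw [invObservable_apply, ← hg, ← h3.eq]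
  exact h2

/-- The self-adjoint operator `R⁻¹ - c`. -/
theorem exists_isSelfAdjoint_of_resolvent {R : L2 n →L[ℂ] L2 n} (hR : IsSelfAdjoint R)
    (hinj : ∀ f, R f = 0 → f = 0) (c : ℝ) :
    ∃ A : L2 n →ₗ.[ℂ] L2 n, IsSelfAdjoint A ∧
      (∀ u w, (u, w) ∈ A.graph ↔ R (w + (c : ℂ) • u) = u) ∧
      IsObservableOf A (invObservable R c) := by
  have hsymm (u v : L2 n) : inner ℂ (R u) v = inner ℂ u (R v) :=
    hR.isSymmetric u v
  let g : Submodule ℂ (L2 n × L2 n) :=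
    { carrier := {x | R (x.2 + (c : ℂ) • x.1) = x.1}
      add_mem' := fun {x y} hx hy => by
        simp only [Set.mem_ofPred_eq] at hx hy ⊢
        rw [Prod.snd_add, Prod.fst_add, smul_add, add_add_add_comm, map_add, hx, hy]
      zero_mem' := by simp
      smul_mem' := fun a x hx => by
        simp only [Set.mem_ofPred_eq] at hx ⊢
        rw [Prod.smul_snd, Prod.smul_fst, smul_comm, ← smul_add, map_smul, hx] }
  have hg (u w : L2 n) : (u, w) ∈ g ↔ R (w + (c : ℂ) • u) = u := Iff.rfl
  -- Injectivity of `R` makes the relation single-valued; self-adjointness with injectivity makes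
  -- its domain, the range of `R`, dense.
  have hA : g.toLinearPMap.graph = g := Submodule.toLinearPMap_graph_eq g fun x hx hx' => by
    have := (hg x.1 x.2).1 hx
    rw [hx', smul_zero, add_zero] at this
    exact hinj _ this
  set A := g.toLinearPMap with hAdef
  have hgr (u w : L2 n) : (u, w) ∈ A.graph ↔ R (w + (c : ℂ) • u) = u := by rw [hA, hg]
  have hmem (f : L2 n) : (R f, f - (c : ℂ) • R f) ∈ A.graph := by
    rw [hgr, sub_add_cancel]
  have hdense : Dense (A.domain : Set (L2 n)) := by
    rw [Submodule.dense_iff_topologicalClosure_eq_top, Submodule.topologicalClosure_eq_top_iff,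
      Submodule.eq_bot_iff]
    intro v hv
    refine hinj v (ext_inner_left ℂ fun u => ?_)
    rw [inner_zero_right, ← hsymm]
    exact (Submodule.mem_orthogonal _ _).1 hv _ (LinearPMap.mem_domain_of_mem_graph (hmem u))
  refine ⟨A, LinearPMap.isSelfAdjoint_def.2 (LinearPMap.eq_of_eq_graph ?_), hgr, ?_⟩
  · rw [LinearPMap.adjoint_graph_eq_graph_adjoint hdense]
    ext ⟨x, y⟩
    rw [Submodule.mem_adjoint_iff, hgr]
    constructor
    · intro h
      refine ext_inner_left ℂ fun f => ?_
      have := h _ _ (hmem f)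
      simp only [inner_sub_left, inner_smul_left, Complex.conj_ofReal, hsymm] at this
      rw [map_add, map_smul, inner_add_right, inner_smul_right]
      linear_combination -this
    · intro h a b hab
      have h1 : inner ℂ (b + (c : ℂ) • a) x = inner ℂ a (y + (c : ℂ) • x) := by
        conv_lhs => rw [← h]
        rw [← hsymm, (hgr a b).1 hab]
      rw [inner_add_left, inner_add_right, inner_smul_left, inner_smul_right,
        Complex.conj_ofReal] at h1
      linear_combination h1
  · intro z hz
    obtain ⟨h1, h2⟩ := invObservable_resolventFun hR c hz
    set P := invObservable R c (resolventFun z hz) with hP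
    refine ⟨fun f => ?_, fun u => ?_⟩
    · have hm : (P f, f + z • P f) ∈ A.graph := by
        rw [hgr, add_assoc, ← add_smul, map_add, map_smul]
        conv_rhs => rw [h2]
        rw [add_comm z]
        rfl
      obtain ⟨u, hu, hu'⟩ := (LinearPMap.mem_graph_iff _).1 hm
      exact ⟨u, hu, by rw [hu', hu]; exact add_sub_cancel_right _ _⟩
    · have h3 := (hgr _ _).1 (A.mem_graph u)
      set f := A u + (c : ℂ) • (u : L2 n) with hf
      have h4 : A u - z • (u : L2 n) = f - ((c : ℂ) + z) • R f := by
        rw [h3, hf, add_smul]; abel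
      rw [h4, map_sub, map_smul]
      conv_lhs => enter [1]; rw [h1]
      rw [add_apply, smul_apply, mul_apply_eq_comp, add_sub_cancel_right, h3]

/-! ### Lax-Milgram for a coercive form -/

section Resolvent

variable {E H : Type*} [NormedAddCommGroup E] [InnerProductSpace ℂ E] [CompleteSpace E]
  [NormedAddCommGroup H] [InnerProductSpace ℂ H] [CompleteSpace H]

/-- The resolvent of a bounded symmetric coercive form on a Hilbert space `E` which is densely
embedded in `H`. -/
theorem exists_resolvent_of_coercive (J : E →L[ℂ] H) (hJ : ∀ e, J e = 0 → e = 0)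
    (hJd : DenseRange J) (b : E →ₗ⋆[ℂ] E →ₗ[ℂ] ℂ) {C α : ℝ}
    (hb : ∀ v e, ‖b v e‖ ≤ C * ‖v‖ * ‖e‖) (hsymm : ∀ v e, b v e = conj (b e v)) (hα : 0 < α)
    (hco : ∀ e, α * ‖e‖ ^ 2 ≤ (b e e).re) :
    ∃ S : H →L[ℂ] E, IsSelfAdjoint (J ∘L S) ∧ (∀ f, (J ∘L S) f = 0 → f = 0) ∧
      ∀ e f, S f = e ↔ ∀ v, b v e = inner ℂ (J v) f := by
  set A : E →L[ℂ] E := InnerProductSpace.continuousLinearMapOfBilin (b.mkContinuous₂ C hb) with hA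
  have hAb (v e : E) : inner ℂ (A v) e = b v e :=
    InnerProductSpace.continuousLinearMapOfBilin_apply _ _ _
  have hAb' (v e : E) : inner ℂ v (A e) = b v e := by
    rw [← inner_conj_symm, hAb, hsymm v e]
  have hu : IsUnit A := by
    refine ContinuousLinearMap.isUnit_of_forall_le_norm_inner_map A (c := α.toNNReal)
      (Real.toNNReal_pos.2 hα) fun e => ?_
    rw [hAb, Real.coe_toNNReal _ hα.le, mul_comm]
    exact (hco e).trans (Complex.re_le_norm _)
  obtain ⟨u, hu⟩ := hu
  have h1 (e : E) : (↑u⁻¹ : E →L[ℂ] E) (A e) = e := by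
    rw [← hu, ← mul_apply_eq_comp, Units.inv_mul]; rfl
  have h2 (e : E) : A ((↑u⁻¹ : E →L[ℂ] E) e) = e := by
    rw [← hu, ← mul_apply_eq_comp, Units.mul_inv]; rfl
  -- With `A` the bounded operator of the form, `b(v, e) = ⟨J v, f⟩` for all `v` says `A e = J* f`.
  set S : H →L[ℂ] E := (↑u⁻¹ : E →L[ℂ] E) ∘L ContinuousLinearMap.adjoint J with hS
  have hSf (e : E) (f : H) : S f = e ↔ ∀ v, b v e = inner ℂ (J v) f := by
    have h3 : S f = e ↔ A e = ContinuousLinearMap.adjoint J f := by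
      constructor
      · rintro rfl; exact h2 _
      · intro h
        rw [hS, ContinuousLinearMap.comp_apply, ← h, h1]
    rw [h3]
    constructor
    · intro h v
      rw [← hAb', h, ContinuousLinearMap.adjoint_inner_right]
    · intro h
      refine ext_inner_left ℂ fun v => ?_
      rw [hAb', h, ContinuousLinearMap.adjoint_inner_right]
  have hb' (v : E) (f : H) : b v (S f) = inner ℂ (J v) f := (hSf _ f).1 rfl v
  refine ⟨S, ?_, fun f hf => ?_, hSf⟩
  · refine ContinuousLinearMap.isSelfAdjoint_iff_isSymmetric.2 fun f g => ?_
    change inner ℂ (J (S f)) g = inner ℂ f (J (S g))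
    rw [← hb', ← inner_conj_symm, ← hb', ← hsymm]
  · refine hJd.eq_zero_of_inner_left ℂ fun v => ?_
    rw [← inner_conj_symm, ← hb', hJ (S f) hf, map_zero, map_zero]

end Resolvent

/-! ### Unbounded multiplication operators and `|P|` -/

/-- The domain of the operator of multiplication by `m`. -/
def mulDomain (m : Space n → ℂ) : Submodule ℂ (L2 n) where
  carrier := {u | MemLp (fun x => m x * u x) 2 volume}
  add_mem' {u v} hu hv := by
    refine (memLp_congr_ae ?_).1 (MemLp.add hu hv)
    filter_upwards [Lp.coeFn_add u v] with x hx
    simp only [Pi.add_apply] at hx ⊢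
    rw [hx, mul_add]
  zero_mem' := by
    refine (memLp_congr_ae ?_).1 (MemLp.zero (ε := ℂ))
    filter_upwards [Lp.coeFn_zero ℂ 2 (volume : Measure (Space n))] with x hx
    rw [hx]
    simp
  smul_mem' c u hu := by
    refine (memLp_congr_ae ?_).1 (MemLp.const_mul hu c)
    filter_upwards [Lp.coeFn_smul c u] with x hx
    rw [hx, Pi.smul_apply, smul_eq_mul]
    ring

theorem mem_mulDomain {m : Space n → ℂ} {u : L2 n} :
    u ∈ mulDomain m ↔ MemLp (fun x => m x * u x) 2 volume := Iff.rfl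

/-- The operator of multiplication by `m`. -/
def mulMap (m : Space n → ℂ) : mulDomain m →ₗ[ℂ] L2 n where
  toFun u := MemLp.toLp _ u.2
  map_add' u v := by
    refine Lp.ext ?_
    filter_upwards [MemLp.coeFn_toLp (u + v).2, MemLp.coeFn_toLp u.2, MemLp.coeFn_toLp v.2,
      Lp.coeFn_add (MemLp.toLp _ u.2) (MemLp.toLp _ v.2), Lp.coeFn_add (u : L2 n) v]
      with x h1 h2 h3 h4 h5
    rw [h1, h4, Pi.add_apply, h2, h3, Submodule.coe_add, h5, Pi.add_apply, mul_add]
  map_smul' c u := by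
    refine Lp.ext ?_
    filter_upwards [MemLp.coeFn_toLp (c • u).2, MemLp.coeFn_toLp u.2,
      Lp.coeFn_smul c (MemLp.toLp _ u.2), Lp.coeFn_smul c (u : L2 n)] with x h1 h2 h3 h4
    rw [h1, RingHom.id_apply, h3, Pi.smul_apply, h2, Submodule.coe_smul, h4, Pi.smul_apply,
      smul_eq_mul, smul_eq_mul]
    ring

theorem coeFn_mulMap (m : Space n → ℂ) (u : mulDomain m) :
    ∀ᵐ x, mulMap m u x = m x * (u : L2 n) x := MemLp.coeFn_toLp u.2

theorem mem_mulDomain_of_ae_eq {m : Space n → ℂ} {u g : L2 n} (h : ∀ᵐ x, g x = m x * u x) :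
    u ∈ mulDomain m := (memLp_congr_ae h).1 (Lp.memLp g)

theorem mulMap_eq {m : Space n → ℂ} {u g : L2 n} (h : ∀ᵐ x, g x = m x * u x)
    (hu : u ∈ mulDomain m) : mulMap m ⟨u, hu⟩ = g := by
  refine Lp.ext ?_
  filter_upwards [coeFn_mulMap m ⟨u, hu⟩, h] with x h1 h2
  rw [h1, h2]

/-- Convergence in `L²` gives almost everywhere convergence along a subsequence, and pointwise
multiplication passes to the limit. -/
theorem isClosed_setOf_ae_eq_mul (m : Space n → ℂ) :
    IsClosed {w : L2 n × L2 n | ∀ᵐ x, w.2 x = m x * w.1 x} := by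
  refine IsSeqClosed.isClosed fun w z hw hz => ?_
  have h1 : Tendsto (fun k => (w k).1) atTop (𝓝 z.1) := (continuous_fst.tendsto z).comp hz
  obtain ⟨φ, hφ, h2⟩ := (tendstoInMeasure_of_tendsto_Lp h1).exists_seq_tendsto_ae
  have h3 : Tendsto (fun k => (w (φ k)).2) atTop (𝓝 z.2) :=
    ((continuous_snd.tendsto z).comp hz).comp hφ.tendsto_atTop
  obtain ⟨ψ, hψ, h4⟩ := (tendstoInMeasure_of_tendsto_Lp h3).exists_seq_tendsto_ae
  filter_upwards [h2, h4, ae_all_iff.2 fun k => hw k] with x hx2 hx4 hx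
  refine tendsto_nhds_unique hx4 ?_
  simp only [hx]
  exact (hx2.comp hψ.tendsto_atTop).const_mul _

theorem mulMap_V (m : Space n → ℂ) (k : Space n) (u : mulDomain m)
    (h : V k (u : L2 n) ∈ mulDomain m) : mulMap m ⟨V k u, h⟩ = V k (mulMap m u) := by
  refine mulMap_eq ?_ h
  filter_upwards [coeFn_V k (mulMap m u), coeFn_V k (u : L2 n), coeFn_mulMap m u] with x h1 h2 h3
  rw [h1, h2, h3]
  ring

/-- The operator `|P|` on `ℋ¹`, up to the Fourier transform. -/
def grad : H1 n →ₗ[ℂ] L2 n :=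
  mulMap (fun ξ : Space n => ((2 * Real.pi * ‖ξ‖ : ℝ) : ℂ)) ∘ₗ
    ((ft n : L2 n →ₗ[ℂ] L2 n) ∘ₗ (H1 n).subtype).codRestrict _ fun u => by
      rw [mem_mulDomain]
      refine (((mem_H1_iff (u : L2 n)).1 u.2).const_mul ((2 * Real.pi : ℝ) : ℂ)).congr_norm ?_ ?_
      · exact (Continuous.aestronglyMeasurable (by fun_prop)).mul (Lp.memLp _).1
      · refine ae_of_all _ fun ξ => ?_
        simp [ft_apply, mul_assoc]

theorem coeFn_grad (u : H1 n) :
    ∀ᵐ ξ, grad u ξ = ((2 * Real.pi * ‖ξ‖ : ℝ) : ℂ) * (𝓕 (u : L2 n) : L2 n) ξ :=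
  coeFn_mulMap _ _

theorem mem_H1_of_ae_eq {u g : L2 n}
    (h : ∀ᵐ ξ, g ξ = ((2 * Real.pi * ‖ξ‖ : ℝ) : ℂ) * (𝓕 u : L2 n) ξ) : u ∈ H1 n := by
  rw [mem_H1_iff]
  refine ((Lp.memLp g).const_mul (((2 * Real.pi : ℝ) : ℂ)⁻¹)).congr_norm ?_ ?_
  · exact (Continuous.aestronglyMeasurable (by fun_prop)).mul (Lp.memLp _).1
  · filter_upwards [h] with ξ hξ
    have : ((2 * Real.pi : ℝ) : ℂ) ≠ 0 := by exact_mod_cast Real.two_pi_pos.ne'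
    have e : ((2 * Real.pi * ‖ξ‖ : ℝ) : ℂ) = ((2 * Real.pi : ℝ) : ℂ) * (‖ξ‖ : ℂ) :=
      Complex.ofReal_mul _ _
    rw [hξ, e, mul_assoc, inv_mul_cancel_left₀ this]

theorem grad_eq {u : H1 n} {g : L2 n}
    (h : ∀ᵐ ξ, g ξ = ((2 * Real.pi * ‖ξ‖ : ℝ) : ℂ) * (𝓕 (u : L2 n) : L2 n) ξ) : grad u = g := by
  refine Lp.ext ?_
  filter_upwards [coeFn_grad u, h] with x h1 h2
  rw [h1, h2]

theorem laplacianForm_eq (u v : H1 n) : laplacianForm u v = inner ℂ (grad u) (grad v) := by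
  rw [inner_eq_integral, laplacianForm]
  refine integral_congr_ae ?_
  filter_upwards [coeFn_grad u, coeFn_grad v] with ξ h1 h2
  rw [h1, h2, map_mul, Complex.conj_ofReal]
  push_cast
  ring

theorem laplacianForm_self (u : H1 n) : laplacianForm u u = ((‖grad u‖ ^ 2 : ℝ) : ℂ) := by
  rw [laplacianForm_eq, inner_self_eq_norm_sq_to_K]
  push_cast
  rfl

theorem sobolevNorm_sq (u : H1 n) : sobolevNorm u ^ 2 = ‖(u : L2 n)‖ ^ 2 + ‖grad u‖ ^ 2 := by
  rw [sobolevNorm, laplacianForm_self, Complex.ofReal_re, Real.sq_sqrt (by positivity)]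

theorem sobolevNorm_nonneg (u : H1 n) : 0 ≤ sobolevNorm u := Real.sqrt_nonneg _

theorem norm_le_sobolevNorm (u : H1 n) : ‖(u : L2 n)‖ ≤ sobolevNorm u :=
  Real.le_sqrt_of_sq_le (by
    rw [laplacianForm_self, Complex.ofReal_re]; nlinarith [sq_nonneg ‖grad u‖])

theorem norm_grad_le_sobolevNorm (u : H1 n) : ‖grad u‖ ≤ sobolevNorm u :=
  Real.le_sqrt_of_sq_le (by
    rw [laplacianForm_self, Complex.ofReal_re]; nlinarith [sq_nonneg ‖(u : L2 n)‖])

/-- In Fourier space this is `|exp(2πi⟨x,ξ⟩) - 1| ≤ 2π|x||ξ|`. -/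
theorem norm_U_sub_self_le (x : Space n) (u : H1 n) :
    ‖U x (u : L2 n) - u‖ ≤ ‖x‖ * ‖grad u‖ := by
  have hn (w : L2 n) : ‖(𝓕 w : L2 n)‖ = ‖w‖ := (Lp.fourierTransformₗᵢ (Space n) ℂ).norm_map w
  have e : (𝓕 (U x (u : L2 n) - u) : L2 n) = V ((2 * Real.pi) • x) (𝓕 (u : L2 n)) - 𝓕 (u : L2 n) := by
    rw [← fourier_U]
    exact map_sub (ft n) _ _
  rw [← hn, e]
  refine Lp.norm_le_mul_norm_of_ae_le_mul ?_
  filter_upwards [Lp.coeFn_sub (V ((2 * Real.pi) • x) (𝓕 (u : L2 n))) (𝓕 (u : L2 n)),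
    coeFn_V ((2 * Real.pi) • x) (𝓕 (u : L2 n)), coeFn_grad u] with ξ h1 h2 h3
  rw [h1, Pi.sub_apply, h2, h3, ← sub_one_mul, norm_mul, norm_mul, ← mul_assoc]
  gcongr
  rw [mul_comm _ Complex.I]
  refine (Real.norm_exp_I_mul_ofReal_sub_one_le).trans ?_
  rw [real_inner_smul_left, norm_mul, Complex.norm_real,
    Real.norm_of_nonneg (by positivity : 0 ≤ 2 * Real.pi * ‖ξ‖),
    Real.norm_of_nonneg Real.two_pi_pos.le]
  nlinarith [norm_inner_le_norm (𝕜 := ℝ) x ξ, Real.two_pi_pos]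

/-- Commutation of `|P|` with modulations. -/
theorem norm_grad_VH1_sub_le (k : Space n) (u : H1 n) :
    ‖grad (VH1 k u) - U (-((2 * Real.pi)⁻¹ • k)) (grad u)‖ ≤ ‖k‖ * ‖(u : L2 n)‖ := by
  set a : Space n := (2 * Real.pi)⁻¹ • k with ha
  have hn : ‖(𝓕 (u : L2 n) : L2 n)‖ = ‖(u : L2 n)‖ :=
    (Lp.fourierTransformₗᵢ (Space n) ℂ).norm_map (u : L2 n)
  have h5 : 𝓕 (VH1 k u : L2 n) = U (-a) (𝓕 (u : L2 n)) := fourier_V k u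
  rw [← hn, ← norm_U_apply (-a) (𝓕 (u : L2 n))]
  refine Lp.norm_le_mul_norm_of_ae_le_mul ?_
  have h4 := ae_comp_add (x := -a) (coeFn_grad u)
  filter_upwards [Lp.coeFn_sub (grad (VH1 k u)) (U (-a) (grad u)), coeFn_grad (VH1 k u),
    coeFn_U (-a) (grad u), coeFn_U (-a) (𝓕 (u : L2 n)), h4] with ξ h1 h2 h3 h6 h7
  rw [h1, Pi.sub_apply, h2, h3, h7, h5, h6, ← sub_mul, norm_mul, ← Complex.ofReal_sub,
    Complex.norm_real, ← mul_sub, norm_mul, Real.norm_of_nonneg Real.two_pi_pos.le]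
  gcongr
  have h8 : ‖ξ‖ - ‖-a + ξ‖ ≤ ‖a‖ ∧ ‖-a + ξ‖ - ‖ξ‖ ≤ ‖a‖ := by
    constructor
    · have := norm_sub_norm_le ξ (-a + ξ)
      simpa using this
    · have := norm_sub_norm_le (-a + ξ) ξ
      simpa using this
  have h9 : ‖a‖ = (2 * Real.pi)⁻¹ * ‖k‖ := by
    rw [ha, norm_smul, norm_inv, Real.norm_of_nonneg Real.two_pi_pos.le]
  have h10 : ‖k‖ = 2 * Real.pi * ‖a‖ := by
    rw [h9, mul_inv_cancel_left₀ Real.two_pi_pos.ne']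
  rw [h10]
  gcongr
  rw [Real.norm_eq_abs, abs_le]
  constructor <;> linarith [h8.1, h8.2]

/-- The graph of the operator of multiplication by `m`. -/
def mulGraph (m : Space n → ℂ) : Submodule ℂ (L2 n × L2 n) :=
  LinearMap.range ((mulDomain m).subtype.prod (mulMap m))

theorem mem_mulGraph {m : Space n → ℂ} {w : L2 n × L2 n} :
    w ∈ mulGraph m ↔ ∀ᵐ x, w.2 x = m x * w.1 x := by
  constructor
  · rintro ⟨u, rfl⟩
    exact coeFn_mulMap m u
  · intro h
    exact ⟨⟨w.1, mem_mulDomain_of_ae_eq h⟩, Prod.ext rfl (mulMap_eq h _)⟩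

theorem isClosed_mulGraph (m : Space n → ℂ) : IsClosed (mulGraph m : Set (L2 n × L2 n)) := by
  have e : (mulGraph m : Set (L2 n × L2 n)) = {w | ∀ᵐ x, w.2 x = m x * w.1 x} :=
    Set.ext fun _ => mem_mulGraph
  rw [e]
  exact isClosed_setOf_ae_eq_mul m

/-! ### The form domain as a Hilbert space -/

/-- The square root of the positive part of `p`. -/
def sqrtPos (p : Space n → ℝ) (x : Space n) : ℂ := (√(max (p x) 0) : ℂ)

/-- The form domain as a Hilbert space: triples `(u, |P| u, p₊^{1/2} u)`. -/
def formSpace (p : Space n → ℝ) : Submodule ℂ (PiLp 2 fun _ : Fin 3 => L2 n) :=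
  (mulGraph fun ξ : Space n => ((2 * Real.pi * ‖ξ‖ : ℝ) : ℂ)).comap
      ((((ft n).comp (PiLp.proj 2 _ 0)).prod (PiLp.proj 2 _ 1) :
        (PiLp 2 fun _ : Fin 3 => L2 n) →L[ℂ] L2 n × L2 n) :
        (PiLp 2 fun _ : Fin 3 => L2 n) →ₗ[ℂ] L2 n × L2 n) ⊓
    (mulGraph (sqrtPos p)).comap
      (((PiLp.proj 2 _ 0).prod (PiLp.proj 2 _ 2) :
        (PiLp 2 fun _ : Fin 3 => L2 n) →L[ℂ] L2 n × L2 n) :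
        (PiLp 2 fun _ : Fin 3 => L2 n) →ₗ[ℂ] L2 n × L2 n)

theorem mem_formSpace {p : Space n → ℝ} {w : PiLp 2 fun _ : Fin 3 => L2 n} :
    w ∈ formSpace p ↔ (∀ᵐ ξ, w 1 ξ = ((2 * Real.pi * ‖ξ‖ : ℝ) : ℂ) * (𝓕 (w 0) : L2 n) ξ) ∧
      ∀ᵐ x, w 2 x = sqrtPos p x * w 0 x :=
  and_congr mem_mulGraph mem_mulGraph

/-- Both defining conditions are closed-graph conditions for multiplication operators, one of them
after a Fourier transform. -/
instance completeSpace_formSpace (p : Space n → ℝ) : CompleteSpace (formSpace p) := by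
  refine IsClosed.completeSpace_coe (hs := ?_)
  exact ((isClosed_mulGraph _).preimage (ContinuousLinearMap.continuous _)).inter
    ((isClosed_mulGraph _).preimage (ContinuousLinearMap.continuous _))

/-- The inclusion of the form domain in `ℋ¹`. -/
def toH1 (p : Space n → ℝ) : formDomain p →ₗ[ℂ] H1 n := Submodule.inclusion fun _ hu => hu.1

/-- The operator of multiplication by `p₊^{1/2}` on the form domain. -/
def posRoot (p : Space n → ℝ) : formDomain p →ₗ[ℂ] L2 n :=
  mulMap (sqrtPos p) ∘ₗ Submodule.inclusion fun _ hu => hu.2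

theorem coeFn_posRoot (p : Space n → ℝ) (u : formDomain p) :
    ∀ᵐ x, posRoot p u x = sqrtPos p x * (u : L2 n) x := coeFn_mulMap _ _

/-- The embedding of the Hilbert space of triples in the form domain. -/
def toDomain (p : Space n → ℝ) : formSpace p →ₗ[ℂ] formDomain p :=
  (((PiLp.proj 2 (fun _ : Fin 3 => L2 n) 0 : (PiLp 2 fun _ : Fin 3 => L2 n) →L[ℂ] L2 n) :
    (PiLp 2 fun _ : Fin 3 => L2 n) →ₗ[ℂ] L2 n) ∘ₗ (formSpace p).subtype).codRestrict _ fun e =>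
      ⟨mem_H1_of_ae_eq (mem_formSpace.1 e.2).1, mem_mulDomain_of_ae_eq (mem_formSpace.1 e.2).2⟩

theorem coe_toDomain {p : Space n → ℝ} (e : formSpace p) :
    (toDomain p e : L2 n) = (e : PiLp 2 fun _ : Fin 3 => L2 n) 0 := rfl

theorem grad_toDomain {p : Space n → ℝ} (e : formSpace p) :
    grad (toH1 p (toDomain p e)) = (e : PiLp 2 fun _ : Fin 3 => L2 n) 1 :=
  grad_eq (mem_formSpace.1 e.2).1

theorem posRoot_toDomain {p : Space n → ℝ} (e : formSpace p) :
    posRoot p (toDomain p e) = (e : PiLp 2 fun _ : Fin 3 => L2 n) 2 :=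
  mulMap_eq (mem_formSpace.1 e.2).2 _

theorem toDomain_surjective (p : Space n → ℝ) (u : formDomain p) :
    ∃ e : formSpace p, toDomain p e = u :=
  ⟨⟨WithLp.toLp 2 ![(u : L2 n), grad (toH1 p u), posRoot p u],
    mem_formSpace.2 ⟨coeFn_grad (toH1 p u), coeFn_posRoot p u⟩⟩, rfl⟩

theorem norm_sq_formSpace {p : Space n → ℝ} (e : formSpace p) : ‖e‖ ^ 2
    = ‖(toDomain p e : L2 n)‖ ^ 2 + ‖grad (toH1 p (toDomain p e))‖ ^ 2
      + ‖posRoot p (toDomain p e)‖ ^ 2 := by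
  rw [grad_toDomain, posRoot_toDomain, coe_toDomain]
  exact (PiLp.norm_sq_eq_of_L2 _ _).trans (Fin.sum_univ_three _)

/-- The square root of the negative part of `p`. -/
def sqrtNeg (p : Space n → ℝ) (x : Space n) : ℂ := (√(max (-p x) 0) : ℂ)

theorem norm_sqrtNeg_mul_sq (p : Space n → ℝ) (x : Space n) (z : ℂ) :
    ‖sqrtNeg p x * z‖ ^ 2 = max (-p x) 0 * ‖z‖ ^ 2 := by
  rw [sqrtNeg, norm_mul, mul_pow, Complex.norm_real, Real.norm_of_nonneg (Real.sqrt_nonneg _),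
    Real.sq_sqrt (le_max_right _ _)]

theorem mem_mulDomain_sqrtNeg {W : H1 n → H1 n → ℂ} {p : Space n → ℝ} (hp : LocallyIntegrable p)
    (h : NegPartRelBounded W p) {u : L2 n} (hu : u ∈ H1 n) : u ∈ mulDomain (sqrtNeg p) := by
  obtain ⟨a, b, -, -, h⟩ := h
  have hm : AEStronglyMeasurable (sqrtNeg p) :=
    Complex.continuous_ofReal.comp_aestronglyMeasurable
      (Real.continuous_sqrt.comp_aestronglyMeasurable
        ((continuous_id.max continuous_const).comp_aestronglyMeasurable
          hp.aestronglyMeasurable.neg))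
  refine (memLp_two_iff_integrable_sq_norm (hm.mul (Lp.memLp u).1)).2 ?_
  exact (h ⟨u, hu⟩).1.congr (ae_of_all _ fun x => (norm_sqrtNeg_mul_sq p x _).symm)

/-- The operator of multiplication by `p₋^{1/2}` on `ℋ¹`. -/
def negRoot {W : H1 n → H1 n → ℂ} {p : Space n → ℝ} (hp : LocallyIntegrable p)
    (h : NegPartRelBounded W p) : H1 n →ₗ[ℂ] L2 n :=
  mulMap (sqrtNeg p) ∘ₗ Submodule.inclusion fun _ hu => mem_mulDomain_sqrtNeg hp h hu

theorem coeFn_negRoot {W : H1 n → H1 n → ℂ} {p : Space n → ℝ} (hp : LocallyIntegrable p)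
    (h : NegPartRelBounded W p) (u : H1 n) :
    ∀ᵐ x, negRoot hp h u x = sqrtNeg p x * (u : L2 n) x := coeFn_mulMap _ _

theorem norm_sq_negRoot {W : H1 n → H1 n → ℂ} {p : Space n → ℝ} (hp : LocallyIntegrable p)
    (h : NegPartRelBounded W p) (u : H1 n) :
    ‖negRoot hp h u‖ ^ 2 = ∫ x : Space n, max (-p x) 0 * ‖(u : L2 n) x‖ ^ 2 := by
  rw [norm_sq_eq_integral]
  refine integral_congr_ae ?_
  filter_upwards [coeFn_negRoot hp h u] with x hx
  rw [hx, norm_sqrtNeg_mul_sq]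

/-- Both roots of the potential give `L²` functions, so `p = p₊ - p₋` may be split under the
integral. The form is then expressed through linear maps, and its algebra becomes that of inner
products. -/
theorem fullForm_eq {W : H1 n → H1 n → ℂ} {p : Space n → ℝ} (hp : LocallyIntegrable p)
    (h : NegPartRelBounded W p) (u v : formDomain p) : fullForm W p u v
      = inner ℂ (grad (toH1 p u)) (grad (toH1 p v)) + W (toH1 p u) (toH1 p v)
        + (inner ℂ (posRoot p u) (posRoot p v)
          - inner ℂ (negRoot hp h (toH1 p u)) (negRoot hp h (toH1 p v))) := by
  rw [fullForm, freeForm, laplacianForm_eq]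
  congr 1
  rw [inner_eq_integral, inner_eq_integral, ← integral_sub (integrable_conj_mul _ _)
    (integrable_conj_mul _ _)]
  refine integral_congr_ae ?_
  filter_upwards [coeFn_posRoot p u, coeFn_posRoot p v, coeFn_negRoot hp h (toH1 p u),
    coeFn_negRoot hp h (toH1 p v)] with x h1 h2 h3 h4
  rw [h1, h2, h3, h4]
  have e1 : conj (sqrtPos p x) * sqrtPos p x = ((max (p x) 0 : ℝ) : ℂ) := by
    rw [sqrtPos, Complex.conj_ofReal, ← Complex.ofReal_mul,
      Real.mul_self_sqrt (le_max_right _ _)]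
  have e2 : conj (sqrtNeg p x) * sqrtNeg p x = ((max (-p x) 0 : ℝ) : ℂ) := by
    rw [sqrtNeg, Complex.conj_ofReal, ← Complex.ofReal_mul,
      Real.mul_self_sqrt (le_max_right _ _)]
  have e3 : (p x : ℂ) = ((max (p x) 0 : ℝ) : ℂ) - ((max (-p x) 0 : ℝ) : ℂ) := by
    rw [← Complex.ofReal_sub]
    congr 1
    rcases le_total (p x) 0 with hx | hx
    · rw [max_eq_right hx, max_eq_left (by linarith)]; ring
    · rw [max_eq_left hx, max_eq_right (by linarith)]; ring
  have e4 : ((toH1 p u : H1 n) : L2 n) = u := rfl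
  have e5 : ((toH1 p v : H1 n) : L2 n) = v := rfl
  rw [e3, ← e1, ← e2, map_mul, map_mul, e4, e5]
  ring

/-- Smooth compactly supported functions lie in `ℋ¹`, and local integrability of `p₊` is exactly
what their weighted norm requires. -/
theorem dense_formDomain {p : Space n → ℝ} (hp : LocallyIntegrable p) :
    Dense (formDomain p : Set (L2 n)) := by
  refine (Lp.dense_hasCompactSupport_contDiff (p := 2) (F := ℂ)
    (μ := (volume : Measure (Space n))) ENNReal.ofNat_ne_top).mono ?_
  rintro f ⟨g, hfg, hg, hg'⟩
  constructor
  · have e : f = (hg.toSchwartzMap hg').toLp 2 volume := by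
      refine Lp.ext ?_
      filter_upwards [hfg, (hg.toSchwartzMap hg').coeFn_toLp 2 volume] with x h1 h2
      rw [h1, h2]; rfl
    change TemperedDistribution.MemSobolev 1 2 (Lp.toTemperedDistribution f)
    rw [e, Lp.toTemperedDistribution_toLp_eq]
    exact SchwartzMap.memSobolev _
  · have hm : AEStronglyMeasurable (fun x => (√(max (p x) 0) : ℂ)) :=
      Complex.continuous_ofReal.comp_aestronglyMeasurable
        (Real.continuous_sqrt.comp_aestronglyMeasurable
          ((continuous_id.max continuous_const).comp_aestronglyMeasurable
            hp.aestronglyMeasurable))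
    refine (memLp_two_iff_integrable_sq_norm (hm.mul (Lp.memLp f).1)).2 ?_
    have h1 : LocallyIntegrable (fun x => max (p x) 0) := by
      refine hp.mono ((continuous_id.max continuous_const).comp_aestronglyMeasurable
        hp.aestronglyMeasurable) (ae_of_all _ fun x => ?_)
      rw [Real.norm_of_nonneg (le_max_right _ _)]
      exact max_le (le_abs_self _) (abs_nonneg _)
    have h2 := h1.integrable_smul_left_of_hasCompactSupport (g := fun x => ‖g x‖ ^ 2)
      (by have := hg'.continuous; fun_prop) (hg.comp_left (g := fun z : ℂ => ‖z‖ ^ 2) (by simp))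
    refine h2.congr ?_
    filter_upwards [hfg] with x hx
    rw [Pi.mul_apply, hx, norm_mul, mul_pow, Complex.norm_real,
      Real.norm_of_nonneg (Real.sqrt_nonneg _), Real.sq_sqrt (le_max_right _ _), smul_eq_mul, mul_comm]

/-- The form `Δ + W + p + c` on the Hilbert space of triples. -/
def shiftedForm (W : H1 n →ₗ⋆[ℂ] H1 n →ₗ[ℂ] ℂ) {p : Space n → ℝ} (hp : LocallyIntegrable p)
    (h : NegPartRelBounded (fun u v => W u v) p) (c : ℝ) :
    formSpace p →ₗ⋆[ℂ] formSpace p →ₗ[ℂ] ℂ :=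
  LinearMap.mk₂'ₛₗ (starRingEnd ℂ) (RingHom.id ℂ)
    (fun e e' => fullForm (fun u v => W u v) p (toDomain p e) (toDomain p e')
      + c * inner ℂ (toDomain p e : L2 n) (toDomain p e' : L2 n))
    (fun e₁ e₂ e' => by
      simp only [fullForm_eq hp h, map_add, LinearMap.add_apply, inner_add_left,
        Submodule.coe_add]
      ring)
    (fun a e e' => by
      simp only [fullForm_eq hp h, map_smul, LinearMap.map_smulₛₗ, LinearMap.smul_apply,
        inner_smul_left, Submodule.coe_smul, smul_eq_mul]
      ring)
    (fun e e₁ e₂ => by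
      simp only [fullForm_eq hp h, map_add, inner_add_right, Submodule.coe_add]
      ring)
    (fun a e e' => by
      simp only [fullForm_eq hp h, map_smul, inner_smul_right, Submodule.coe_smul, smul_eq_mul,
        RingHom.id_apply]
      ring)

theorem shiftedForm_apply (W : H1 n →ₗ⋆[ℂ] H1 n →ₗ[ℂ] ℂ) {p : Space n → ℝ}
    (hp : LocallyIntegrable p) (h : NegPartRelBounded (fun u v => W u v) p) (c : ℝ)
    (e e' : formSpace p) : shiftedForm W hp h c e e'
      = fullForm (fun u v => W u v) p (toDomain p e) (toDomain p e')
        + c * inner ℂ (toDomain p e : L2 n) (toDomain p e' : L2 n) := rfl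

theorem shiftedForm_symm {W : H1 n →ₗ⋆[ℂ] H1 n →ₗ[ℂ] ℂ} (hW : ∀ u v, W u v = conj (W v u))
    {p : Space n → ℝ} (hp : LocallyIntegrable p) (h : NegPartRelBounded (fun u v => W u v) p)
    (c : ℝ) (e e' : formSpace p) :
    shiftedForm W hp h c e e' = conj (shiftedForm W hp h c e' e) := by
  simp only [shiftedForm_apply, fullForm_eq hp h, map_add, map_sub, map_mul, inner_conj_symm,
    Complex.conj_ofReal, ← hW]

/-- Only the negative part is not controlled directly by the graph norm; the relative bound together
with continuity of `W` gives `‖p₋^{1/2} u‖² ≤ (a(1 + CW) + |b|) ‖e‖²`. -/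
theorem exists_norm_shiftedForm_le {W : H1 n →ₗ⋆[ℂ] H1 n →ₗ[ℂ] ℂ} {CW : ℝ} (hCW : 0 ≤ CW)
    (hW : ∀ u v, ‖W u v‖ ≤ CW * sobolevNorm u * sobolevNorm v) {p : Space n → ℝ}
    (hp : LocallyIntegrable p) (h : NegPartRelBounded (fun u v => W u v) p) (c : ℝ) :
    ∃ C : ℝ, ∀ e e', ‖shiftedForm W hp h c e e'‖ ≤ C * ‖e‖ * ‖e'‖ := by
  obtain ⟨a, b, ha0, -, hab⟩ := id h
  have hsob (e : formSpace p) : sobolevNorm (toH1 p (toDomain p e)) ≤ ‖e‖ := by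
    refine abs_le_of_sq_le_sq' ?_ (norm_nonneg _) |>.2
    rw [sobolevNorm_sq, norm_sq_formSpace]
    exact le_add_of_nonneg_right (sq_nonneg _)
  have h0 (e : formSpace p) : ‖(toDomain p e : L2 n)‖ ≤ ‖e‖ :=
    (norm_le_sobolevNorm (toH1 p (toDomain p e))).trans (hsob e)
  have h1 (e : formSpace p) : ‖grad (toH1 p (toDomain p e))‖ ≤ ‖e‖ :=
    (norm_grad_le_sobolevNorm _).trans (hsob e)
  have h2 (e : formSpace p) : ‖posRoot p (toDomain p e)‖ ≤ ‖e‖ := by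
    refine abs_le_of_sq_le_sq' ?_ (norm_nonneg _) |>.2
    rw [norm_sq_formSpace]
    exact le_add_of_nonneg_left (by positivity)
  set K : ℝ := a * (1 + CW) + |b| with hK
  have hK0 : 0 ≤ K := by positivity
  have h3 (e : formSpace p) : ‖negRoot hp h (toH1 p (toDomain p e))‖ ≤ √K * ‖e‖ := by
    refine abs_le_of_sq_le_sq' ?_ (by positivity) |>.2
    set u := toH1 p (toDomain p e)
    rw [norm_sq_negRoot, mul_pow, Real.sq_sqrt hK0]
    refine (hab u).2.trans ?_
    have h4 : (freeForm (fun u v => W u v) u u).re ≤ (1 + CW) * ‖e‖ ^ 2 := by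
      rw [freeForm, laplacianForm_self, Complex.add_re, Complex.ofReal_re, add_mul, one_mul]
      refine add_le_add (by gcongr; exact h1 e) ?_
      refine ((Complex.re_le_norm _).trans (hW u u)).trans ?_
      rw [sq, ← mul_assoc]
      have := hsob e
      have := sobolevNorm_nonneg u
      gcongr
    have h5 : ‖(u : L2 n)‖ ^ 2 ≤ ‖e‖ ^ 2 := by gcongr; exact h0 e
    calc _ ≤ a * ((1 + CW) * ‖e‖ ^ 2) + |b| * ‖e‖ ^ 2 := by
          gcongr
          exact le_abs_self b
      _ = K * ‖e‖ ^ 2 := by rw [hK]; ring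
  refine ⟨1 + CW + (1 + K) + |c|, fun e e' => ?_⟩
  rw [shiftedForm_apply, fullForm_eq hp h]
  have i (x y : L2 n) {s t : ℝ} (hx : ‖x‖ ≤ s) (hy : ‖y‖ ≤ t) : ‖inner ℂ x y‖ ≤ s * t :=
    (norm_inner_le_norm x y).trans (by gcongr; exact (norm_nonneg _).trans hx)
  have i1 := i _ _ (h1 e) (h1 e')
  have i2 := i _ _ (h2 e) (h2 e')
  have i3 := i _ _ (h3 e) (h3 e')
  have i0 := i _ _ (h0 e) (h0 e')
  have i4 : ‖W (toH1 p (toDomain p e)) (toH1 p (toDomain p e'))‖ ≤ CW * ‖e‖ * ‖e'‖ := by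
    refine (hW _ _).trans ?_
    have := hsob e
    have := hsob e'
    have := sobolevNorm_nonneg (toH1 p (toDomain p e'))
    gcongr
  have i5 : √K * ‖e‖ * (√K * ‖e'‖) = K * (‖e‖ * ‖e'‖) := by
    rw [mul_mul_mul_comm, Real.mul_self_sqrt hK0]
  rw [i5] at i3
  refine (norm_add_le _ _).trans ?_
  have j1 := norm_add_le (inner ℂ (grad (toH1 p (toDomain p e))) (grad (toH1 p (toDomain p e')))
    + W (toH1 p (toDomain p e)) (toH1 p (toDomain p e')))
    (inner ℂ (posRoot p (toDomain p e)) (posRoot p (toDomain p e'))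
      - inner ℂ (negRoot hp h (toH1 p (toDomain p e))) (negRoot hp h (toH1 p (toDomain p e'))))
  have j2 := norm_add_le (inner ℂ (grad (toH1 p (toDomain p e))) (grad (toH1 p (toDomain p e'))))
    (W (toH1 p (toDomain p e)) (toH1 p (toDomain p e')))
  have j3 := norm_sub_le (inner ℂ (posRoot p (toDomain p e)) (posRoot p (toDomain p e')))
    (inner ℂ (negRoot hp h (toH1 p (toDomain p e))) (negRoot hp h (toH1 p (toDomain p e'))))
  have j4 : ‖(c : ℂ) * inner ℂ (toDomain p e : L2 n) (toDomain p e' : L2 n)‖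
      ≤ |c| * (‖e‖ * ‖e'‖) := by
    rw [norm_mul, Complex.norm_real, Real.norm_eq_abs]
    gcongr
  linarith

theorem exists_shiftedForm_coercive {W : H1 n →ₗ⋆[ℂ] H1 n →ₗ[ℂ] ℂ}
    (hW : ∃ μ ν : ℝ, μ < 1 ∧ 0 < ν ∧ ∀ u : H1 n,
      -μ * (laplacianForm u u).re - ν * ‖(u : L2 n)‖ ^ 2 ≤ (W u u).re) {p : Space n → ℝ}
    (hp : LocallyIntegrable p) (h : NegPartRelBounded (fun u v => W u v) p) :
    ∃ c α : ℝ, 0 < α ∧ ∀ e, α * ‖e‖ ^ 2 ≤ (shiftedForm W hp h c e e).re := by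
  obtain ⟨a, b, -, ha1, hab⟩ := id h
  obtain ⟨μ, ν, hμ, -, hμν⟩ := hW
  set β : ℝ := (1 - a) * (1 - μ) with hβ
  have hβ0 : 0 < β := mul_pos (by linarith) (by linarith)
  -- Since `Δ + W - p₋ ≥ (1 - a)(Δ + W) - b ≥ (1 - a)(1 - μ) Δ - (1 - a) ν - b`, this shift leaves
  -- `β Δ + 1 + p₊`, with `β` as above.
  refine ⟨b + (1 - a) * ν + 1, min β 1, lt_min hβ0 one_pos, fun e => ?_⟩
  set u := toH1 p (toDomain p e) with hu
  have h1 : (shiftedForm W hp h (b + (1 - a) * ν + 1) e e).re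
      = ‖grad u‖ ^ 2 + (W u u).re + (‖posRoot p (toDomain p e)‖ ^ 2 - ‖negRoot hp h u‖ ^ 2)
        + (b + (1 - a) * ν + 1) * ‖(u : L2 n)‖ ^ 2 := by
    have i (x : L2 n) : inner ℂ x x = ((‖x‖ ^ 2 : ℝ) : ℂ) := by
      rw [inner_self_eq_norm_sq_to_K]
      push_cast
      rfl
    rw [shiftedForm_apply, fullForm_eq hp h, i, i, i, i, ← Complex.ofReal_mul]
    simp only [Complex.add_re, Complex.sub_re, Complex.ofReal_re]
    rfl
  have h2 := (hab u).2
  rw [← norm_sq_negRoot hp h, freeForm, laplacianForm_self, Complex.add_re,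
    Complex.ofReal_re] at h2
  have h3 := hμν u
  rw [laplacianForm_self, Complex.ofReal_re] at h3
  have h4 : ‖e‖ ^ 2 = ‖(u : L2 n)‖ ^ 2 + ‖grad u‖ ^ 2 + ‖posRoot p (toDomain p e)‖ ^ 2 :=
    norm_sq_formSpace e
  have h5 : (1 - a) * (-μ * ‖grad u‖ ^ 2 - ν * ‖(u : L2 n)‖ ^ 2) ≤ (1 - a) * (W u u).re :=
    mul_le_mul_of_nonneg_left h3 (by linarith)
  have h6 : min β 1 * ‖grad u‖ ^ 2 ≤ β * ‖grad u‖ ^ 2 := by gcongr; exact min_le_left _ _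
  have h7 : min β 1 * ‖(u : L2 n)‖ ^ 2 ≤ 1 * ‖(u : L2 n)‖ ^ 2 := by
    gcongr; exact min_le_right _ _
  have h8 : min β 1 * ‖posRoot p (toDomain p e)‖ ^ 2 ≤ 1 * ‖posRoot p (toDomain p e)‖ ^ 2 := by
    gcongr; exact min_le_right _ _
  rw [h1, h4]
  rw [hβ] at h6
  linarith

/-- The resolvent of the form sum `Δ + W + p`. -/
theorem exists_form_resolvent {W : H1 n →ₗ⋆[ℂ] H1 n →ₗ[ℂ] ℂ} {CW : ℝ} (hCW : 0 ≤ CW)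
    (hWc : ∀ u v, ‖W u v‖ ≤ CW * sobolevNorm u * sobolevNorm v)
    (hWs : ∀ u v, W u v = conj (W v u))
    (hW : ∃ μ ν : ℝ, μ < 1 ∧ 0 < ν ∧ ∀ u : H1 n,
      -μ * (laplacianForm u u).re - ν * ‖(u : L2 n)‖ ^ 2 ≤ (W u u).re) {p : Space n → ℝ}
    (hp : LocallyIntegrable p) (h : NegPartRelBounded (fun u v => W u v) p) :
    ∃ (R : L2 n →L[ℂ] L2 n) (c α C : ℝ), 0 < α ∧ 0 ≤ C ∧ IsSelfAdjoint R ∧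
      (∀ f, R f = 0 → f = 0) ∧
      (∀ u f : L2 n, R f = u ↔ ∃ hu : u ∈ formDomain p, ∀ v : formDomain p,
        fullForm (fun u v => W u v) p v ⟨u, hu⟩ + c * inner ℂ (v : L2 n) u
          = inner ℂ (v : L2 n) f) ∧
      (∀ (f : L2 n) (hu : R f ∈ formDomain p), sobolevNorm (toH1 p ⟨R f, hu⟩) ≤ C * ‖f‖) ∧
      ∀ v : formDomain p, α * sobolevNorm (toH1 p v) ^ 2
        ≤ (fullForm (fun u v => W u v) p v v + c * inner ℂ (v : L2 n) (v : L2 n)).re := by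
  obtain ⟨c, α, hα, hco⟩ := exists_shiftedForm_coercive hW hp h
  obtain ⟨C, hC⟩ := exists_norm_shiftedForm_le hCW hWc hp h c
  set J : formSpace p →L[ℂ] L2 n :=
    (PiLp.proj 2 (fun _ : Fin 3 => L2 n) 0).comp (formSpace p).subtypeL with hJ
  have hJe (e : formSpace p) : J e = toDomain p e := rfl
  have hinj (e : formSpace p) (he : J e = 0) : e = 0 := by
    have h1 : toDomain p e = 0 := Subtype.ext he
    have h2 := norm_sq_formSpace e
    rw [h1, map_zero, map_zero, map_zero, Submodule.coe_zero, norm_zero] at h2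
    exact norm_eq_zero.1 (pow_eq_zero_iff two_ne_zero |>.1 (by linarith))
  have hsob (e : formSpace p) : sobolevNorm (toH1 p (toDomain p e)) ≤ ‖e‖ := by
    refine abs_le_of_sq_le_sq' ?_ (norm_nonneg _) |>.2
    rw [sobolevNorm_sq, norm_sq_formSpace]
    exact le_add_of_nonneg_right (sq_nonneg _)
  have hdense : DenseRange J := (dense_formDomain hp).mono fun u hu => by
    obtain ⟨e, he⟩ := toDomain_surjective p ⟨u, hu⟩
    exact ⟨e, congrArg Subtype.val he⟩
  obtain ⟨S, hS1, hS2, hS3⟩ := exists_resolvent_of_coercive J hinj hdense (shiftedForm W hp h c)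
    hC (shiftedForm_symm hWs hp h c) hα hco
  refine ⟨J ∘L S, c, α, ‖S‖, hα, S.opNorm_nonneg, hS1, hS2, fun u f => ?_, fun f hu => ?_,
    fun v => ?_⟩
  · constructor
    · rintro rfl
      refine ⟨(toDomain p (S f)).2, fun v => ?_⟩
      obtain ⟨e, rfl⟩ := toDomain_surjective p v
      exact (hS3 (S f) f).1 rfl e
    · rintro ⟨hu, hq⟩
      obtain ⟨e, he⟩ := toDomain_surjective p ⟨u, hu⟩
      have h1 : S f = e := (hS3 e f).2 fun v => by
        rw [shiftedForm_apply, he]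
        exact hq (toDomain p v)
      rw [ContinuousLinearMap.comp_apply, h1, hJe, he]
  · exact (hsob (S f)).trans (S.le_opNorm f)
  · obtain ⟨e, rfl⟩ := toDomain_surjective p v
    refine le_trans ?_ (hco e)
    have := hsob e
    have := sobolevNorm_nonneg (toH1 p (toDomain p e))
    gcongr

/-! ### Commutators with modulations and affiliation -/

theorem inner_V_neg (k : Space n) (u v : L2 n) : inner ℂ (V (-k) u) v = inner ℂ u (V k v) := by
  rw [← star_V, ContinuousLinearMap.star_eq_adjoint, ContinuousLinearMap.adjoint_inner_left]

theorem inner_U_neg (x : Space n) (u v : L2 n) : inner ℂ (U (-x) u) v = inner ℂ u (U x v) := by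
  rw [← star_U, ContinuousLinearMap.star_eq_adjoint, ContinuousLinearMap.adjoint_inner_left]

theorem V_mem_formDomain (k : Space n) {p : Space n → ℝ} {u : L2 n} (hu : u ∈ formDomain p) :
    V k u ∈ formDomain p := by
  refine ⟨V_mem_H1 k hu.1, mem_mulDomain.1 (mem_mulDomain_of_ae_eq (m := sqrtPos p)
    (g := V k (posRoot p ⟨u, hu⟩)) ?_)⟩
  filter_upwards [coeFn_V k (posRoot p ⟨u, hu⟩), coeFn_V k u, coeFn_posRoot p ⟨u, hu⟩]
    with x h1 h2 h3
  rw [h1, h2, h3]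
  ring

/-- The modulation `V_k` as an operator on the form domain. -/
def VDomain (k : Space n) {p : Space n → ℝ} (u : formDomain p) : formDomain p :=
  ⟨V k (u : L2 n), V_mem_formDomain k u.2⟩

/-- Under the Fourier transform `V_k` is a translation, which changes the weight `2π|ξ|` by at most
`|k|`. Comparing both gradients with the translated one leaves only first-order errors. -/
theorem norm_laplacian_comm_le (k : Space n) (u v : H1 n) :
    ‖inner ℂ (grad (VH1 (-k) u)) (grad v) - inner ℂ (grad u) (grad (VH1 k v))‖
      ≤ 2 * ‖k‖ * sobolevNorm u * sobolevNorm v := by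
  set a : Space n := (2 * Real.pi)⁻¹ • k with ha
  have h1 := norm_grad_VH1_sub_le (-k) u
  have h2 := norm_grad_VH1_sub_le k v
  rw [smul_neg, neg_neg, norm_neg, ← ha] at h1
  rw [← ha] at h2
  have e : inner ℂ (grad (VH1 (-k) u)) (grad v) - inner ℂ (grad u) (grad (VH1 k v))
      = inner ℂ (grad (VH1 (-k) u) - U a (grad u)) (grad v)
        - inner ℂ (grad u) (grad (VH1 k v) - U (-a) (grad v)) := by
    rw [inner_sub_left, inner_sub_right, ← inner_U_neg (-a), neg_neg]
    ring
  rw [e]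
  have h3 := norm_le_sobolevNorm u
  have h4 := norm_le_sobolevNorm v
  have h5 := norm_grad_le_sobolevNorm u
  have h6 := norm_grad_le_sobolevNorm v
  have h7 := sobolevNorm_nonneg u
  calc _ ≤ ‖k‖ * sobolevNorm u * sobolevNorm v + sobolevNorm u * (‖k‖ * sobolevNorm v) := by
        refine (norm_sub_le _ _).trans (add_le_add ?_ ?_)
        · refine (norm_inner_le_norm _ _).trans ?_
          gcongr
          exact h1.trans (by gcongr)
        · refine (norm_inner_le_norm _ _).trans ?_
          gcongr
          exact h2.trans (by gcongr)
    _ = _ := by ring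

/-- The two potential terms cancel exactly because multiplication commutes with `V_k`; hence no
regularity of `p` enters. -/
theorem norm_fullForm_comm_le {W : H1 n → H1 n → ℂ} {p : Space n → ℝ} (hp : LocallyIntegrable p)
    (h : NegPartRelBounded W p) {k : Space n} {ε : ℝ}
    (hW : ∀ u v, ‖commutatorForm k W u v‖ ≤ ε * sobolevNorm u * sobolevNorm v)
    (u v : formDomain p) :
    ‖fullForm W p (VDomain (-k) u) v - fullForm W p u (VDomain k v)‖
      ≤ (2 * ‖k‖ + ε) * sobolevNorm (toH1 p u) * sobolevNorm (toH1 p v) := by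
  have e1 : toH1 p (VDomain (-k) u) = VH1 (-k) (toH1 p u) := rfl
  have e2 : toH1 p (VDomain k v) = VH1 k (toH1 p v) := rfl
  have e3 (k : Space n) (w : formDomain p) : posRoot p (VDomain k w) = V k (posRoot p w) :=
    mulMap_V (sqrtPos p) k ⟨w, w.2.2⟩ (VDomain k w).2.2
  have e4 (k : Space n) (w : H1 n) : negRoot hp h (VH1 k w) = V k (negRoot hp h w) :=
    mulMap_V (sqrtNeg p) k ⟨w, mem_mulDomain_sqrtNeg hp h w.2⟩
      (mem_mulDomain_sqrtNeg hp h (VH1 k w).2)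
  rw [fullForm_eq hp h, fullForm_eq hp h, e1, e2, e3, e3, e4, e4, inner_V_neg, inner_V_neg,
    add_sub_add_right_eq_sub, add_sub_add_comm]
  refine (norm_add_le _ _).trans ?_
  have h1 := norm_laplacian_comm_le k (toH1 p u) (toH1 p v)
  have h2 := hW (toH1 p u) (toH1 p v)
  rw [commutatorForm] at h2
  linarith

theorem norm_le_of_formNorm_lt {B : H1 n → H1 n → ℂ} {C : ℝ} (h : formNorm B < ENNReal.ofReal C)
    (u v : H1 n) : ‖B u v‖ ≤ C * sobolevNorm u * sobolevNorm v := by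
  obtain ⟨D, hD⟩ := iInf_lt_iff.1 h
  obtain ⟨hD, hDC⟩ := iInf_lt_iff.1 hD
  rw [← ENNReal.ofReal_coe_nnreal] at hDC
  have h1 : (D : ℝ) ≤ C := ((ENNReal.ofReal_lt_ofReal_iff_of_nonneg D.2).1 hDC).le
  refine (hD u v).trans ?_
  have := sobolevNorm_nonneg u
  have := sobolevNorm_nonneg v
  gcongr

/-- The `ℋ¹` bound on `R` gives `‖(U_x - 1) R‖ ≤ C|x|`, and `R` is self-adjoint. For `[R, V_k]`,
coercivity is applied to the vector `v = [R, V_k] f` itself, so the form commutator is only ever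
paired with `ℋ¹` vectors. -/
theorem resolvent_mem_algC {W : H1 n →ₗ⋆[ℂ] H1 n →ₗ[ℂ] ℂ} {p : Space n → ℝ}
    (hp : LocallyIntegrable p) (h : NegPartRelBounded (fun u v => W u v) p)
    (hW : Tendsto (fun k : Space n => formNorm (commutatorForm k (fun u v => W u v)))
      (𝓝 0) (𝓝 0)) {R : L2 n →L[ℂ] L2 n} {c α C : ℝ} (hα : 0 < α) (hC : 0 ≤ C)
    (hR : IsSelfAdjoint R)
    (hRf : ∀ u f : L2 n, R f = u ↔ ∃ hu : u ∈ formDomain p, ∀ v : formDomain p,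
        fullForm (fun u v => W u v) p v ⟨u, hu⟩ + c * inner ℂ (v : L2 n) u
          = inner ℂ (v : L2 n) f)
    (hRC : ∀ (f : L2 n) (hu : R f ∈ formDomain p), sobolevNorm (toH1 p ⟨R f, hu⟩) ≤ C * ‖f‖)
    (hco : ∀ v : formDomain p, α * sobolevNorm (toH1 p v) ^ 2
      ≤ (fullForm (fun u v => W u v) p v v + c * inner ℂ (v : L2 n) (v : L2 n)).re) :
    R ∈ algC n := by
  have hmem (f : L2 n) : R f ∈ formDomain p := ((hRf (R f) f).1 rfl).1
  have hq (f : L2 n) (v : formDomain p) : fullForm (fun u v => W u v) p v ⟨R f, hmem f⟩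
      + c * inner ℂ (v : L2 n) (R f) = inner ℂ (v : L2 n) f := by
    obtain ⟨_, h1⟩ := (hRf (R f) f).1 rfl
    exact h1 v
  have hU : Tendsto (fun x : Space n => ‖(U x - 1) * R‖) (𝓝 0) (𝓝 0) := by
    have h1 : Tendsto (fun x : Space n => ‖x‖ * C) (𝓝 0) (𝓝 0) := by
      have : Continuous fun x : Space n => ‖x‖ * C := by fun_prop
      simpa using this.tendsto 0
    refine squeeze_zero (fun _ => norm_nonneg _) (fun x => ?_) h1
    refine ContinuousLinearMap.opNorm_le_bound _ (by positivity) fun f => ?_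
    refine (norm_U_sub_self_le x (toH1 p ⟨R f, hmem f⟩)).trans ?_
    rw [mul_assoc]
    gcongr
    exact (norm_grad_le_sobolevNorm _).trans (hRC f (hmem f))
  refine ⟨?_, hU, by rw [hR.star_eq]; exact hU⟩
  have hbound {k : Space n} {ε : ℝ} (hε : 0 ≤ ε)
      (hk : ∀ u v, ‖commutatorForm k (fun u v => W u v) u v‖
        ≤ ε * sobolevNorm u * sobolevNorm v) :
      ‖R * V k - V k * R‖ ≤ (2 * ‖k‖ + ε) * C / α := by
    refine ContinuousLinearMap.opNorm_le_bound _ (by positivity) fun f => ?_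
    set u₀ : formDomain p := ⟨R f, hmem f⟩ with hu₀
    set u₁ : formDomain p := ⟨R (V k f), hmem (V k f)⟩ with hu₁
    set v : formDomain p := u₁ - VDomain k u₀ with hv
    have e0 : (R * V k - V k * R) f = (toH1 p v : L2 n) := rfl
    have e1 := hq (V k f) v
    have e2 := hq f (VDomain (-k) v)
    have e3 : fullForm (fun u v => W u v) p v v = fullForm (fun u v => W u v) p v u₁
        - fullForm (fun u v => W u v) p v (VDomain k u₀) := by
      simp only [fullForm_eq hp h]
      have (w : formDomain p) : toH1 p w = toH1 p u₁ - toH1 p (VDomain k u₀) →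
          posRoot p w = posRoot p u₁ - posRoot p (VDomain k u₀) →
          inner ℂ (grad (toH1 p v)) (grad (toH1 p w)) + W (toH1 p v) (toH1 p w)
            + (inner ℂ (posRoot p v) (posRoot p w)
              - inner ℂ (negRoot hp h (toH1 p v)) (negRoot hp h (toH1 p w)))
          = inner ℂ (grad (toH1 p v)) (grad (toH1 p u₁)) + W (toH1 p v) (toH1 p u₁)
            + (inner ℂ (posRoot p v) (posRoot p u₁)
              - inner ℂ (negRoot hp h (toH1 p v)) (negRoot hp h (toH1 p u₁)))
          - (inner ℂ (grad (toH1 p v)) (grad (toH1 p (VDomain k u₀)))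
            + W (toH1 p v) (toH1 p (VDomain k u₀))
            + (inner ℂ (posRoot p v) (posRoot p (VDomain k u₀))
              - inner ℂ (negRoot hp h (toH1 p v)) (negRoot hp h (toH1 p (VDomain k u₀))))) := by
        intro h1 h2
        rw [h1, h2]
        simp only [map_sub, inner_sub_right]
        ring
      exact this v (map_sub _ _ _) (map_sub _ _ _)
    have e4 : inner ℂ (v : L2 n) (v : L2 n) = inner ℂ (v : L2 n) (R (V k f))
        - inner ℂ (v : L2 n) (V k (R f)) := inner_sub_right _ _ _
    have e5 : ((VDomain (-k) v : formDomain p) : L2 n) = V (-k) (v : L2 n) := rfl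
    rw [e5, inner_V_neg, inner_V_neg] at e2
    -- The two resolvent equations, for `V_k f` tested on `v` and for `f` tested on `V_{-k} v`, have
    -- the same right-hand side `⟨v, V_k f⟩`. Subtracting them, the shift by `c` cancels and a pure
    -- form commutator remains.
    have e6 : fullForm (fun u v => W u v) p v v + c * inner ℂ (v : L2 n) (v : L2 n)
        = fullForm (fun u v => W u v) p (VDomain (-k) v) u₀
          - fullForm (fun u v => W u v) p v (VDomain k u₀) := by
      rw [e3, e4]
      linear_combination e1 - e2
    have h1 := hco v
    rw [e6] at h1
    have h2 := (h1.trans (Complex.re_le_norm _)).trans (norm_fullForm_comm_le hp h hk v u₀)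
    have h3 := hRC f (hmem f)
    have h4 := sobolevNorm_nonneg (toH1 p v)
    rw [e0]
    refine (norm_le_sobolevNorm _).trans ?_
    rw [div_mul_eq_mul_div, le_div_iff₀ hα]
    -- The estimate is quadratic in `‖v‖₁` on the left and linear on the right, so one factor is
    -- divided out.
    rcases h4.eq_or_lt with h5 | h5
    · rw [← h5, zero_mul]; positivity
    · refine le_of_mul_le_mul_right ?_ h5
      calc _ = α * sobolevNorm (toH1 p v) ^ 2 := by ring
        _ ≤ _ := h2
        _ ≤ (2 * ‖k‖ + ε) * sobolevNorm (toH1 p v) * (C * ‖f‖) := by gcongr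
        _ = _ := by ring
  refine Metric.tendsto_nhds.2 fun ε hε => ?_
  -- With `‖k‖ < η` and form commutator below `η`, the bound is at most `3 η C / α`, which is less
  -- than `ε`.
  set η : ℝ := ε * α / (3 * C + 1) / 2 with hη
  have hη0 : 0 < η := by positivity
  filter_upwards [hW.eventually_lt_const (ENNReal.ofReal_pos.2 hη0),
    Metric.ball_mem_nhds (0 : Space n) hη0] with k h1 h2
  rw [mem_ball_zero_iff] at h2
  rw [dist_zero_right, norm_norm]
  refine (hbound hη0.le (norm_le_of_formNorm_lt h1)).trans_lt ?_
  rw [div_lt_iff₀ hα]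
  have h3 : η * (3 * C + 1) = ε * α / 2 := by
    rw [hη]; field_simp
  have h4 : 0 < ε * α := mul_pos hε hα
  nlinarith

theorem isFormOperator_of_resolvent {D : Submodule ℂ (L2 n)} {q : D → D → ℂ}
    {R : L2 n →L[ℂ] L2 n} {c : ℝ} (hR : ∀ u f : L2 n, R f = u ↔ ∃ hu : u ∈ D, ∀ v : D,
      q v ⟨u, hu⟩ + c * inner ℂ (v : L2 n) u = inner ℂ (v : L2 n) f) {A : L2 n →ₗ.[ℂ] L2 n}
    (hA : ∀ u w, (u, w) ∈ A.graph ↔ R (w + (c : ℂ) • u) = u) : IsFormOperator q A := by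
  intro u f
  rw [hA, hR]
  refine exists_congr fun hu => forall_congr' fun v => ?_
  rw [inner_add_right, inner_smul_right, add_left_inj]

theorem negPartRelBounded_zero (W : H1 n → H1 n → ℂ) : NegPartRelBounded W 0 :=
  ⟨0, 0, le_rfl, one_pos, fun u => by simp⟩

theorem mem_formDomain_zero {u : L2 n} : u ∈ formDomain (0 : Space n → ℝ) ↔ u ∈ H1 n := by
  refine ⟨fun hu => hu.1, fun hu => ⟨hu, ?_⟩⟩
  simp

theorem IsFormOperator.freeForm_of_fullForm {W : H1 n → H1 n → ℂ} {A : L2 n →ₗ.[ℂ] L2 n}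
    (hA : IsFormOperator (fullForm W 0) A) : IsFormOperator (freeForm W) A := by
  have e (u v : formDomain (0 : Space n → ℝ)) :
      fullForm W 0 u v = freeForm W ⟨u.1, u.2.1⟩ ⟨v.1, v.2.1⟩ := by
    simp [fullForm]
  intro u f
  rw [hA]
  constructor
  · rintro ⟨hu, h⟩
    refine ⟨hu.1, fun v => ?_⟩
    rw [← h ⟨v, mem_formDomain_zero.2 v.2⟩, e]
  · rintro ⟨hu, h⟩
    refine ⟨mem_formDomain_zero.2 hu, fun v => ?_⟩
    rw [e]
    exact h ⟨v.1, v.2.1⟩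

end LocInfty

end

theorem mainTheorem11 (n : ℕ)
    -- a continuous symmetric sesquilinear form `W` on `ℋ¹`
    (W : H1 n →ₗ⋆[ℂ] H1 n →ₗ[ℂ] ℂ)
    (hW_cont : formNorm (fun u v => W u v) < ∞)
    (hW_symm : ∀ u v : H1 n, W u v = conj (W v u))
    -- `W ≥ -μ Δ - ν`
    (hW_below : ∃ μ ν : ℝ, μ < 1 ∧ 0 < ν ∧ ∀ u : H1 n,
      -μ * (laplacianForm u u).re - ν * ‖(u : L2 n)‖ ^ 2 ≤ (W u u).re)
    -- `‖[V_k, W]‖_{ℋ¹ → ℋ⁻¹} → 0`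
    (hW_comm : Tendsto (fun k : Space n => formNorm (commutatorForm k (fun u v => W u v)))
      (𝓝 0) (𝓝 0))
    (p : Space n → ℝ) (hp : LocallyIntegrable p)
    (hp_neg : NegPartRelBounded (fun u v => W u v) p) :
    -- `H₀ = Δ + W` and `H = H₀ + p(Q)` are self-adjoint operators
    (∃ H₀ : L2 n →ₗ.[ℂ] L2 n, IsSelfAdjoint H₀ ∧ IsFormOperator (freeForm (fun u v => W u v)) H₀) ∧
    ∃ H : L2 n →ₗ.[ℂ] L2 n, IsSelfAdjoint H ∧ IsFormOperator (fullForm (fun u v => W u v) p) H ∧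
      -- `H` is affiliated to `𝒞(ℝⁿ)`
      ∃ Φ : Observable n, IsObservableOf H Φ ∧ Φ.Affiliated ∧
        -- the localizations at infinity exist and determine the essential spectrum
        ∃ L : UltraInfty n → Observable n,
          (∀ ϰ : UltraInfty n, (L ϰ).Affiliated ∧ IsLocalizationAt Φ ϰ (L ϰ)) ∧
          Φ.essSpectrum = closure (⋃ ϰ : UltraInfty n, (L ϰ).spectrum) := by
  obtain ⟨CW, hCW⟩ := ENNReal.lt_iff_exists_nnreal_btwn.1 hW_cont
  have hWc : ∀ u v, ‖W u v‖ ≤ (CW : ℝ) * sobolevNorm u * sobolevNorm v :=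
    norm_le_of_formNorm_lt (B := fun u v => W u v) (by
      rw [ENNReal.ofReal_coe_nnreal]; exact hCW.1)
  constructor
  -- `Δ + W` is the case of zero potential, where the form domain is all of `ℋ¹`.
  · obtain ⟨R, c, α, C, -, -, hR, hinj, hRf, -⟩ := exists_form_resolvent CW.2 hWc hW_symm hW_below
      (p := 0) (locallyIntegrable_zero) (negPartRelBounded_zero _)
    obtain ⟨H₀, h1, h2, -⟩ := exists_isSelfAdjoint_of_resolvent hR hinj c
    exact ⟨H₀, h1, (isFormOperator_of_resolvent hRf h2).freeForm_of_fullForm⟩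
  · obtain ⟨R, c, α, C, hα, hC, hR, hinj, hRf, hRC, hco⟩ :=
      exists_form_resolvent CW.2 hWc hW_symm hW_below hp hp_neg
    obtain ⟨H, h1, h2, h3⟩ := exists_isSelfAdjoint_of_resolvent hR hinj c
    have haff := affiliated_invObservable
      (resolvent_mem_algC hp hp_neg hW_comm hα hC hR hRf hRC hco) c
    exact ⟨H, h1, isFormOperator_of_resolvent hRf h2, invObservable R c, h3, haff,
      Observable.exists_localization haff⟩
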